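/- **Conventions.** $\lambda$ is the security parameter. A function $\mu:\mathbb N\to\mathbb R$ is *negligible* if $\lambda^c\mu(\lambda)\to 0$ for every $c$. A *family of efficient unitaries* on $N(\lambda)\ge 1$ dimensions with keys in $\{0,1\}^{d(\lambda)}$ assigns to each $\lambda$ and $k\in\{0,1\}^{d(\lambda)}$ a unitary $W_k$ on $\mathbb C^{N(\lambda)}$, where $N(\lambda)\le 2^{\mathrm{poly}(\lambda)}$, such that one classical algorithm computes from $(1^\lambda,k)$, in time $\mathrm{poly}(\lambda)$, the description of a quantum circuit that implements $W_k$ on $\lceil\log_2 N(\lambda)\rceil$ qubits (with ancillas starting and ending in $|0\rangle$). Circuits with a description are made of Pauli $X$ gates, rotations with rational $\cos^2$ and diagonal gates $\mathrm{diag}(1,e^{2\pi i a/b})$, with any number of control qubits. Adversaries are non-uniform: polynomial-size quantum circuits (arbitrary controlled single-qubit gates) with quantum advice. *PRU.* $\{U_k\}_{k\in\{0,1\}^{d(\lambda)}}$ is a *pseudorandom unitary (PRU) family* on $p(\lambda)$ dimensions if it is a family of efficient unitaries and, for every polynomial-size quantum oracle circuit family $A$ with quantum advice, $$\Bigl|\,\mathbb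 E_{k\leftarrow\{0,1\}^{d(\lambda)}}\Pr[A^{U_k}=1]-\int_{U(p)}\Pr[A^{V}=1]\,dV\Bigr|$$ is negligible in $\lambda$, where $dV$ is the Haar probability measure. *One-time secure quantum encryption.* A family of efficient unitaries $\{W_k\}$ on $N(\lambda)$ dimensions is a *one-time secure quantum encryption scheme* with messages of dimension $N(\lambda)$ if there is a negligible function $\mu$ such that every polynomial-size quantum adversary $A$ satisfies $\Pr_{b\leftarrow\{0,1\}}[\mathrm{Expt}_{A,b}(\lambda)=b]\le\frac12+\mu(\lambda)$ for all sufficiently large $\lambda$. In $\mathrm{Expt}_{A,b}(\lambda)$, $A$ sends an $N(\lambda)$-dimensional message register $\mathsf M$ (possibly entangled with its private qubits); the challenger samples $k\leftarrow\{0,1\}^{d(\lambda)}$, if $b=1$ swaps the contents of $\mathsf M$ with $|0\rangle$, applies $W_k$ to $\mathsf M$ and returns $\mathsf M$; the output is $A$'s guess $b'$. *Expand.* For a unitary $U$ on $\mathbb C^p$ and $\ell\ge 1$ let $N=\binom{\ell+p-1}{\ell}$ and let $T_0,\dots,T_{N-1}$ be the multisets of size $\ell$ of elements of $\{0,\dots,p-1\}$,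 where the multiset with elements $x_0\le\dots\le x_{\ell-1}$ has number $\sum_i\binom{x_i+i}{i+1}$. On the symmetric subspace of $(\mathbb C^p)^{\otimes\ell}$ the Schur transform sends the uniform superposition of all words with multiset of letters $T_m$ to $|m\rangle\in\mathbb C^N$; let $V:\mathbb C^N\to(\mathbb C^p)^{\otimes\ell}$ be its inverse (an isometry onto the symmetric subspace). Then $\mathrm{Expand}(U,\ell)=V^\dagger U^{\otimes\ell}V$ on $\mathbb C^N$. **Theorem C.1 (PRU expansion).** Let $\{U_k\}_{k\in\{0,1\}^{d(\lambda)}}$ be a PRU family on $p(\lambda)$ dimensions, and let $\ell(\lambda)\ge 1$ be such that $1^\lambda\mapsto 1^{\ell(\lambda)}$ is computable in polynomial time. Then $\{\mathrm{Expand}(U_k,\ell(\lambda))\}_{k\in\{0,1\}^{d(\lambda)}}$ is a one-time secure quantum encryption scheme with messages of dimension $\binom{\ell+p-1}{\ell}$, and $$\binom{\ell+p-1}{\ell}\ \ge\ \Bigl(1+\frac{p-1}{\ell}\Bigr)^{\ell}\qquad\text{for every }\lambda .$$ -/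

import Mathlib

open MeasureTheory Filter Topology

namespace QExpand

/-! ## Polynomial time: structured programs on finitely many stacks, with a step count -/

/-- Programs of a multi-stack machine. The stacks hold bits and are numbered; a program mentions
only finitely many of them. The tests compare the top of a stack (`none` if it is empty). -/
inductive Prog : Type
  | skip : Prog
  | push : ℕ → Bool → Prog
  | pop : ℕ → Prog
  | seq : Prog → Prog → Prog
  /-- `ite r c P Q`: if the top of stack `r` is `c` then `P` else `Q`. -/
  | ite : ℕ → Option Bool → Prog → Prog → Prog
  /-- `loop r c P`: while the top of stack `r` is different from `c`, run `P`. -/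
  | loop : ℕ → Option Bool → Prog → Prog

/-- The contents of all stacks. -/
abbrev Store := ℕ → List Bool

/-- `Runs P s s' t`: started on `s`, the program `P` halts on `s'` after exactly `t` steps.
Every elementary instruction and every test is one step. -/
inductive Runs : Prog → Store → Store → ℕ → Prop
  | skip (s : Store) : Runs Prog.skip s s 1
  | push (s : Store) (r : ℕ) (b : Bool) :
      Runs (Prog.push r b) s (Function.update s r (b :: s r)) 1
  | pop (s : Store) (r : ℕ) : Runs (Prog.pop r) s (Function.update s r (s r).tail) 1
  | seq {P Q : Prog} {s s' s'' : Store} {t t' : ℕ} (h : Runs P s s' t) (h' : Runs Q s' s'' t') :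
      Runs (Prog.seq P Q) s s'' (t + t')
  | iteTrue {P Q : Prog} {s s' : Store} {t : ℕ} {r : ℕ} {c : Option Bool}
      (hc : (s r).head? = c) (h : Runs P s s' t) : Runs (Prog.ite r c P Q) s s' (t + 1)
  | iteFalse {P Q : Prog} {s s' : Store} {t : ℕ} {r : ℕ} {c : Option Bool}
      (hc : (s r).head? ≠ c) (h : Runs Q s s' t) : Runs (Prog.ite r c P Q) s s' (t + 1)
  | loopStop {P : Prog} {s : Store} {r : ℕ} {c : Option Bool}
      (hc : (s r).head? = c) : Runs (Prog.loop r c P) s s 1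
  | loopStep {P : Prog} {s s' s'' : Store} {t t' : ℕ} {r : ℕ} {c : Option Bool}
      (hc : (s r).head? ≠ c) (h : Runs P s s' t) (h' : Runs (Prog.loop r c P) s' s'' t') :
      Runs (Prog.loop r c P) s s'' (t + t' + 1)

/-- Initial stacks: `1ⁿ` on stack 0, the word `w` on stack 1, all other stacks empty. -/
def initStore (n : ℕ) (w : List Bool) : Store := fun r =>
  if r = 0 then List.replicate n true else if r = 1 then w else []

/-- On input `(1ⁿ, w)` the program `P` halts within `T` steps with `out` on stack 2. -/
def OutputsWithin (P : Prog) (n : ℕ) (w out : List Bool) (T : ℕ) : Prop :=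
  ∃ (s : Store) (t : ℕ), Runs P (initStore n w) s t ∧ s 2 = out ∧ t ≤ T

/-- The function `1ⁿ ↦ 1^(f n)` is computable in polynomial time. -/
def PolyTimeUnary (f : ℕ → ℕ) : Prop :=
  ∃ (P : Prog) (q : Polynomial ℕ), ∀ n : ℕ,
    OutputsWithin P n [] (List.replicate (f n) true) (q.eval n)

/-! ## Qubits and circuits -/

/-- States of a supply of qubits (wires) numbered by `ℕ`. The basis ket `|S⟩` has the wires of the
finite set `S` equal to 1 and all others equal to 0; in particular fresh ancillas `|0⟩` are always
available. -/
abbrev QState := Finset ℕ →₀ ℂ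

/-- The ket of the number `x` in binary: bit `i` of `x` is on wire `i`. -/
def code (x : ℕ) : Finset ℕ := x.bitIndices.toFinset

/-- Shift of a set of wires by `o`. -/
def shift (o : ℕ) (S : Finset ℕ) : Finset ℕ := S.image (fun i => i + o)

/-- The single-qubit operator `u` on wire `t`, controlled on all wires of `cs` (other than `t`). -/
noncomputable def ctrlMap (cs : Finset ℕ) (t : ℕ) (u : Matrix (Fin 2) (Fin 2) ℂ) :
    QState →ₗ[ℂ] QState :=
  Finsupp.linearCombination ℂ fun S : Finset ℕ =>
    if cs.erase t ⊆ S then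
      Finsupp.single (S.erase t) (u 0 (if t ∈ S then 1 else 0)) +
        Finsupp.single (insert t S) (u 1 (if t ∈ S then 1 else 0))
    else Finsupp.single S 1

/-- Probability that measuring wire 0 in the standard basis gives 1. -/
noncomputable def acceptProb (ψ : QState) : ℝ :=
  ψ.sum fun S z => if 0 ∈ S then ‖z‖ ^ 2 else 0

/-! ### Circuits with a finite description, and families of efficient unitaries -/

/-- Single-qubit gates with a finite description. -/
inductive Elem : Type
  | flip : Elem
  | rot : ℕ → ℕ → Elem
  | phase : ℕ → ℕ → Elem

/-- `flip` is Pauli `X`, `rot a b` is the rotation with `cos² = a / (a + b)`, and `phase a b` is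
`diag(1, exp(2πi a / b))`. With controls these give, exactly, all gates of Clifford + T, Toffoli
gates and the controlled phases of the quantum Fourier transform. -/
noncomputable def Elem.mat : Elem → Matrix (Fin 2) (Fin 2) ℂ
  | .flip => !![0, 1; 1, 0]
  | .rot a b =>
      let q : ℝ := (a : ℝ) / ((a : ℝ) + (b : ℝ))
      !![(Real.sqrt q : ℂ), -(Real.sqrt (1 - q) : ℂ); (Real.sqrt (1 - q) : ℂ), (Real.sqrt q : ℂ)]
  | .phase a b => !![1, 0; 0, Complex.exp (2 * Real.pi * Complex.I * ((a : ℂ) / (b : ℂ)))]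

/-- A gate with a finite description: control wires, target wire, single-qubit gate. -/
structure DGate where
  controls : List ℕ
  target : ℕ
  elem : Elem

/-- Action of a described circuit; the head of the list is the first gate. -/
noncomputable def runD : List DGate → (QState →ₗ[ℂ] QState)
  | [] => LinearMap.id
  | g :: gs => (runD gs).comp (ctrlMap g.controls.toFinset g.target g.elem.mat)

/-- Self-delimiting unary code, used for wire numbers. -/
def encUnary (n : ℕ) : List Bool := List.replicate n true ++ [false]

/-- Self-delimiting binary code (least significant bit first), used for gate parameters. -/
def encBinary (n : ℕ) : List Bool := n.bits.flatMap (fun b => [true, b]) ++ [false]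

def encElem : Elem → List Bool
  | .flip => [false]
  | .rot a b => [true, false] ++ encBinary a ++ encBinary b
  | .phase a b => [true, true] ++ encBinary a ++ encBinary b

def encDGate (g : DGate) : List Bool :=
  g.controls.flatMap (fun i => true :: encUnary i) ++ [false] ++ encUnary g.target ++ encElem g.elem

/-- The description of a circuit as a bit string. -/
def encCircuit (c : List DGate) : List Bool :=
  c.flatMap (fun g => true :: encDGate g) ++ [false]

/-- The circuit `c` implements the operator `W` on the `N`-dimensional register whose basis is the
numbers below `N` in binary, with ancillas that start and end in `|0⟩`. -/
def Implements {N : ℕ} (c : List DGate) (W : Matrix (Fin N) (Fin N) ℂ) : Prop :=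
  ∀ x : Fin N, runD c (Finsupp.single (code x) 1) = ∑ y : Fin N, Finsupp.single (code y) (W y x)

/-- `{W n k}` with keys `k ∈ {0,1}^(d n)` is a family of efficient unitaries on `N n` dimensions:
the register has polynomially many qubits, and one classical procedure produces from `(1ⁿ, k)`, in
time polynomial in `n`, the description of a circuit for `W n k`. -/
structure EfficientFamily (d N : ℕ → ℕ)
    (W : ∀ n, (Fin (d n) → Bool) → Matrix (Fin (N n)) (Fin (N n)) ℂ) : Prop where
  dim_pos : ∀ n, 0 < N n
  dim_le : ∃ q : Polynomial ℕ, ∀ n, N n ≤ 2 ^ q.eval n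
  isUnitary : ∀ n k, W n k ∈ Matrix.unitaryGroup (Fin (N n)) ℂ
  generate : ∃ (P : Prog) (q : Polynomial ℕ), ∀ (n : ℕ) (k : Fin (d n) → Bool),
    ∃ c : List DGate, OutputsWithin P n (List.ofFn k) (encCircuit c) (q.eval n) ∧
      Implements c (W n k)

/-! ### Non-uniform circuits of adversaries -/

/-- An arbitrary single-qubit unitary on `target`, controlled on the wires of `controls`. -/
structure Gate where
  controls : Finset ℕ
  target : ℕ
  mat : Matrix.unitaryGroup (Fin 2) ℂ

noncomputable def Gate.map (g : Gate) : QState →ₗ[ℂ] QState :=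
  ctrlMap g.controls g.target (g.mat : Matrix (Fin 2) (Fin 2) ℂ)

def Gate.size (g : Gate) : ℕ := g.controls.card + 1

/-- Action of a circuit; the head of the list is the first gate. -/
noncomputable def runGates : List Gate → (QState →ₗ[ℂ] QState)
  | [] => LinearMap.id
  | g :: gs => (runGates gs).comp g.map

/-- A gate of an oracle circuit: an ordinary gate, or a query to the oracle on the register that
starts at wire `o`. -/
inductive OGate : Type
  | gate : Gate → OGate
  | query : ℕ → OGate

def OGate.size : OGate → ℕ
  | .gate g => g.size
  | .query _ => 1

/-- The oracle `U` on `p` dimensions, applied to the `⌈log₂ p⌉` wires from wire `o` on. If these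
wires do not hold a state of the `p`-dimensional register, the run is aborted (and not accepted):
this component of the state is set to 0. -/
noncomputable def oracleMap {p : ℕ} (U : Matrix (Fin p) (Fin p) ℂ) (o : ℕ) :
    QState →ₗ[ℂ] QState :=
  Finsupp.linearCombination ℂ fun S : Finset ℕ =>
    ∑ x : Fin p,
      if S ∩ shift o (Finset.range (Nat.clog 2 p)) = shift o (code x) then
        ∑ y : Fin p,
          Finsupp.single ((S \ shift o (Finset.range (Nat.clog 2 p))) ∪ shift o (code y)) (U y x)
      else 0

noncomputable def OGate.map {p : ℕ} (U : Matrix (Fin p) (Fin p) ℂ) : OGate → (QState →ₗ[ℂ] QState)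
  | .gate g => g.map
  | .query o => oracleMap U o

/-- Action of an oracle circuit; the head of the list is the first gate. -/
noncomputable def runOracle {p : ℕ} (U : Matrix (Fin p) (Fin p) ℂ) :
    List OGate → (QState →ₗ[ℂ] QState)
  | [] => LinearMap.id
  | g :: gs => (runOracle U gs).comp (g.map U)

/-! ## Pseudorandom unitaries -/

/-- A function is negligible if it decreases faster than the inverse of any polynomial. -/
def Negligible (f : ℕ → ℝ) : Prop :=
  Asymptotics.SuperpolynomialDecay atTop (fun n : ℕ => (n : ℝ)) f

/-- Average over a uniformly random key. -/
noncomputable def keyAvg {d : ℕ} (f : (Fin d → Bool) → ℝ) : ℝ :=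
  (∑ k : Fin d → Bool, f k) / 2 ^ d

/-- One member of a non-uniform quantum distinguisher: an oracle circuit together with an advice
state. A circuit touches finitely many wires only; the advice on the others serves as a
purification, so that this covers mixed advice. -/
structure Distinguisher where
  circuit : List OGate
  advice : QState
  advice_unit : (advice.sum fun _ z => ‖z‖ ^ 2) = 1

def Distinguisher.size (A : Distinguisher) : ℕ := (A.circuit.map OGate.size).sum

/-- Probability that the distinguisher outputs 1 with black-box access to `U`. -/
noncomputable def Distinguisher.prob (A : Distinguisher) {p : ℕ}
    (U : Matrix (Fin p) (Fin p) ℂ) : ℝ :=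
  acceptProb (runOracle U A.circuit A.advice)

noncomputable instance unitaryMeasurableSpace (p : ℕ) : MeasurableSpace (Matrix.unitaryGroup (Fin p) ℂ) :=
  borel _

instance unitaryBorelSpace (p : ℕ) : BorelSpace (Matrix.unitaryGroup (Fin p) ℂ) := ⟨rfl⟩

instance unitaryCompactSpace (p : ℕ) : CompactSpace (Matrix.unitaryGroup (Fin p) ℂ) := by
  have hK : IsCompact {M : Matrix (Fin p) (Fin p) ℂ | ∀ i j, M i j ∈ Metric.closedBall (0 : ℂ) 1} :=
    isCompact_pi_infinite (ι := Fin p) (X := fun _ => Fin p → ℂ)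
      (s := fun _ => {v | ∀ j, v j ∈ Metric.closedBall (0 : ℂ) 1})
      fun _ => isCompact_pi_infinite fun _ => isCompact_closedBall 0 1
  have hcl : IsClosed (unitary (Matrix (Fin p) (Fin p) ℂ) : Set (Matrix (Fin p) (Fin p) ℂ)) :=
    isClosed_unitary
  refine isCompact_iff_compactSpace.mp (hK.of_isClosed_subset hcl ?_)
  intro U hU i j
  simpa using entry_norm_bound_of_unitary hU i j

/-- The Haar probability measure on the unitary group `U(p)`. -/
noncomputable def haarUnitary (p : ℕ) : Measure (Matrix.unitaryGroup (Fin p) ℂ) :=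
  Measure.haarMeasure ⊤

/-- `{U n k}` with keys `k ∈ {0,1}^(d n)` is a PRU family on `p n` dimensions: a family of efficient
unitaries, such that no polynomial-size quantum distinguisher tells black-box access to `U n k` for
a random key `k` from black-box access to a Haar random unitary. -/
structure IsPRU (d p : ℕ → ℕ)
    (U : ∀ n, (Fin (d n) → Bool) → Matrix (Fin (p n)) (Fin (p n)) ℂ) : Prop where
  efficient : EfficientFamily d p U
  pseudorandom : ∀ A : ℕ → Distinguisher,
    (∃ q : Polynomial ℕ, ∀ n, (A n).size ≤ q.eval n) →
    Negligible fun n =>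
      |keyAvg (fun k => (A n).prob (U n k)) -
        ∫ V : Matrix.unitaryGroup (Fin (p n)) ℂ,
          (A n).prob (V : Matrix (Fin (p n)) (Fin (p n)) ℂ) ∂(haarUnitary (p n))|

/-! ## One-time secure quantum encryption -/

/-- One member of a non-uniform quantum adversary against an encryption scheme for messages of
dimension `N`: the joint state of the message register and of its private wires when the message is
sent, and the circuit that it runs after the reply. Any quantum advice and the circuit that prepares
the message are part of the joint state. -/
structure EncAdversary (N : ℕ) where
  state : (Fin N × Finset ℕ) →₀ ℂ
  state_unit : (state.sum fun _ z => ‖z‖ ^ 2) = 1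
  circuit : List Gate

def EncAdversary.size {N : ℕ} (A : EncAdversary N) : ℕ := (A.circuit.map Gate.size).sum

/-- The ket with `|y⟩` in the message register (the first `⌈log₂ N⌉` wires) and `|R⟩` in the private
wires of the adversary (the wires from `⌈log₂ N⌉` on). -/
def jointKet {N : ℕ} (y : Fin N) (R : Finset ℕ) : Finset ℕ :=
  code y ∪ shift (Nat.clog 2 N) R

/-- What the adversary holds after the reply if the challenge bit is 0: the operator `W` has been
applied to the message register. -/
noncomputable def reply0 {N : ℕ} (W : Matrix (Fin N) (Fin N) ℂ) (A : EncAdversary N) : QState :=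
  A.state.sum fun mR z => ∑ y : Fin N, Finsupp.single (jointKet y mR.2) (z * W y mR.1)

/-- The state `|0⟩` of the message register. -/
def zeroKet (N : ℕ) : Fin N → ℂ := fun x => if (x : ℕ) = 0 then 1 else 0

/-- What the adversary holds after the reply if the challenge bit is 1: the message has been swapped
with `|0⟩` and `W` has been applied. The original message stays with the challenger; this is the
(sub-normalized) component in which it equals `m`. -/
noncomputable def reply1 {N : ℕ} (W : Matrix (Fin N) (Fin N) ℂ) (A : EncAdversary N) (m : Fin N) :
    QState :=
  A.state.sum fun mR z =>
    if mR.1 = m then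
      ∑ y : Fin N, Finsupp.single (jointKet y mR.2) (z * W.mulVec (zeroKet N) y)
    else 0

/-- Probability that the adversary outputs 1 if the challenge bit is 0. -/
noncomputable def guess0 {N : ℕ} (W : Matrix (Fin N) (Fin N) ℂ) (A : EncAdversary N) : ℝ :=
  acceptProb (runGates A.circuit (reply0 W A))

/-- Probability that the adversary outputs 1 if the challenge bit is 1 (the message that stays with
the challenger is traced out). -/
noncomputable def guess1 {N : ℕ} (W : Matrix (Fin N) (Fin N) ℂ) (A : EncAdversary N) : ℝ :=
  ∑ m : Fin N, acceptProb (runGates A.circuit (reply1 W A m))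

/-- Probability that the adversary guesses the uniformly random challenge bit, for a uniformly
random key. -/
noncomputable def winProb {d N : ℕ} (W : (Fin d → Bool) → Matrix (Fin N) (Fin N) ℂ)
    (A : EncAdversary N) : ℝ :=
  (1 / 2) * (1 - keyAvg fun k => guess0 (W k) A) + (1 / 2) * keyAvg fun k => guess1 (W k) A

/-- `{W n k}` with keys `k ∈ {0,1}^(d n)` is a one-time secure quantum encryption scheme with
messages of dimension `N n`. -/
structure IsOneTimeSecureQEnc (d N : ℕ → ℕ)
    (W : ∀ n, (Fin (d n) → Bool) → Matrix (Fin (N n)) (Fin (N n)) ℂ) : Prop where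
  efficient : EfficientFamily d N W
  secure : ∃ μ : ℕ → ℝ, Negligible μ ∧
    ∀ A : ∀ n, EncAdversary (N n),
      (∃ q : Polynomial ℕ, ∀ n, (A n).size ≤ q.eval n) →
      ∀ᶠ n in atTop, winProb (W n) (A n) ≤ 1 / 2 + μ n

/-! ## The Schur transform on the symmetric subspace, and the expansion of a unitary -/

/-- Dimension of the symmetric subspace of `(ℂ^p)^{⊗ℓ}`. -/
def symDim (l p : ℕ) : ℕ := (l + p - 1).choose l

/-- The index of the type (multiset of entries) of a word `x`. If `x₀ ≤ ⋯ ≤ x_{ℓ-1}` are the sorted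
entries, it is `∑ i, C(xᵢ + i, i + 1)`: this enumerates the multisets of size `ℓ` of `{0, …, p-1}` by
the numbers below `C(ℓ + p - 1, ℓ)`, in colexicographic order. -/
def typeIndex {l p : ℕ} (x : Fin l → Fin p) : ℕ :=
  ∑ i : Fin l, Nat.choose ((x (Tuple.sort x i) : ℕ) + i) ((i : ℕ) + 1)

/-- The inverse Schur transform on the block `Λ = 0` (the symmetric subspace, on which the register
`p_Λ` is one-dimensional). It sends the basis state `m` of the register `q_Λ` to the uniform
superposition of the words of the `m`-th type, which is the corresponding weight vector of the
irreducible representation `Sym^ℓ(ℂ^p)`. -/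
noncomputable def symSchurInv (l p : ℕ) : Matrix (Fin l → Fin p) (Fin (symDim l p)) ℂ :=
  Matrix.of fun x m =>
    if typeIndex x = (m : ℕ) then
      (1 / Real.sqrt (Fintype.card {y : Fin l → Fin p // typeIndex y = (m : ℕ)}) : ℝ)
    else 0

/-- `U^{⊗ℓ}` on `(ℂ^p)^{⊗ℓ}`. -/
def tensorPower (l : ℕ) {p : ℕ} (U : Matrix (Fin p) (Fin p) ℂ) :
    Matrix (Fin l → Fin p) (Fin l → Fin p) ℂ :=
  Matrix.of fun x y => ∏ i, U (x i) (y i)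

/-- `Expand(U, ℓ)`: apply the inverse Schur transform on the symmetric subspace, then `U^{⊗ℓ}`, then
the Schur transform, and return the register `q_Λ`. -/
noncomputable def expand (l : ℕ) {p : ℕ} (U : Matrix (Fin p) (Fin p) ℂ) :
    Matrix (Fin (symDim l p)) (Fin (symDim l p)) ℂ :=
  (symSchurInv l p).conjTranspose * tensorPower l U * symSchurInv l p

end QExpand

namespace QExpand

/-! ## Linear algebra of circuits -/

/-! Write `V` for `symSchurInv`, the isometry onto the symmetric subspace. The columns of `U^{⊗l} V`
are permutation invariant and `V V†` fixes such vectors, so `V * expand l U = U^{⊗l} * V`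
(`symSchurInv_mul_expand`). Hence `expand l` is multiplicative and unitary; it is the representation
`Sym^l`.

Efficiency. A circuit for `V` is built from reversible word arithmetic modulo `2^w` (`AddsOn`). It
first turns an index into the sorted word of its type: the index is a number in the combinatorial
number system, so the letters are found greedily from the largest, by binary search on binomial
coefficients (`runD_unrank`). It then turns the sorted word into the uniform superposition of its
permutations: the letter for the last position is drawn with probability proportional to its
multiplicity, and the remaining sorted word is treated in the same way (`runD_symmetrize`, with the
count `card_words_erase`). Between this circuit and its inverse, each letter is moved to the first
register, the given circuit for `U` is run there, and the letter is moved back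
(`implements_expandCircuit`). Every workspace register is returned to 0. The description of the
whole circuit is a nest of loops whose bounds, wire numbers and angles are polynomial expressions,
so a closure calculus for programs that write bit strings (`Emit`, `EmitC`) yields a polynomial-time
generator (`EfficientFamily.expand`).

Security. For Haar random `U` the entries of `W = expand l U` satisfy `∫ W y m * conj (W y' m') = δ
δ / N` (`integral_expand_mul_star`), by left invariance and Schur's lemma for `Sym^l`
(`eq_smul_one_of_commute`). The average acceptance probability after the reply is therefore `1/N`
times a sum over pairs (returned basis state, message), and this sum is the same for both challenge
bits (`integral_guess_eq`). For a random key, the experiment with challenge bit 0 can be run by a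
distinguisher that queries `U` once per letter (`prob_simulate`), so its outcome is negligibly far
from the Haar average. The experiment with bit 1 is the experiment with bit 0 for an adversary that
sends `|0⟩` and keeps its message (`guess0_keepMessage`), so it is covered as well. All this gives a
negligible bound for each polynomial-size adversary family; a diagonal argument turns these bounds
into one that serves all families eventually (`exists_negligible_bound`).

Dimension. `C(l+q, l)` is a product of `l` factors `1 + q/n` with `n ≤ l`, each at least `1 + q/l`.
-/

theorem ctrlMap_single (cs : Finset ℕ) (t : ℕ) (u : Matrix (Fin 2) (Fin 2) ℂ) (S : Finset ℕ) :
    ctrlMap cs t u (Finsupp.single S 1) =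
      if cs.erase t ⊆ S then
        Finsupp.single (S.erase t) (u 0 (if t ∈ S then 1 else 0)) +
          Finsupp.single (insert t S) (u 1 (if t ∈ S then 1 else 0))
      else Finsupp.single S 1 := by
  simp [ctrlMap]

theorem qstate_hom_ext {M : Type*} [AddCommMonoid M] [Module ℂ M] {f g : QState →ₗ[ℂ] M}
    (h : ∀ S : Finset ℕ, f (Finsupp.single S 1) = g (Finsupp.single S 1)) : f = g := by
  refine Finsupp.lhom_ext fun S z => ?_
  have hz : (Finsupp.single S z : QState) = z • Finsupp.single S 1 := by simp
  rw [hz, map_smul, map_smul, h]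

theorem erase_subset_insert_iff {cs S : Finset ℕ} {t : ℕ} :
    cs.erase t ⊆ insert t S ↔ cs.erase t ⊆ S := by
  constructor
  · intro h x hx
    rcases Finset.mem_insert.mp (h hx) with rfl | h'
    · simp at hx
    · exact h'
  · exact fun h => h.trans (Finset.subset_insert _ _)

theorem erase_subset_erase_iff {cs S : Finset ℕ} {t : ℕ} :
    cs.erase t ⊆ S.erase t ↔ cs.erase t ⊆ S := by
  constructor
  · exact fun h => h.trans (Finset.erase_subset _ _)
  · intro h x hx
    exact Finset.mem_erase.mpr ⟨(Finset.mem_erase.mp hx).1, h hx⟩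

theorem insert_erase_self' (t : ℕ) (S : Finset ℕ) : insert t (S.erase t) = insert t S := by
  ext x; by_cases h : x = t <;> simp [h]

theorem ctrlMap_mul (cs : Finset ℕ) (t : ℕ) (u v : Matrix (Fin 2) (Fin 2) ℂ) :
    (ctrlMap cs t u).comp (ctrlMap cs t v) = ctrlMap cs t (u * v) := by
  refine qstate_hom_ext fun S => ?_
  rw [LinearMap.comp_apply, ctrlMap_single cs t v, ctrlMap_single cs t (u * v)]
  by_cases h : cs.erase t ⊆ S
  · rw [if_pos h, if_pos h, map_add]
    have e : ∀ (T : Finset ℕ) (z : ℂ), (Finsupp.single T z : QState) = z • Finsupp.single T 1 := by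
      intro T z; simp
    rw [e (S.erase t), e (insert t S), map_smul, map_smul, ctrlMap_single, ctrlMap_single,
      if_pos (erase_subset_erase_iff.mpr h), if_pos (erase_subset_insert_iff.mpr h)]
    have hie := insert_erase_self' t S
    simp only [Finset.mem_erase, ne_eq, not_true_eq_false, false_and, if_false,
      Finset.mem_insert, true_or, if_true, Finset.erase_idem, Finset.insert_idem,
      Finset.erase_insert_eq_erase, hie, smul_add, Finsupp.smul_single, smul_eq_mul, Matrix.mul_apply,
      Fin.sum_univ_two, Finsupp.single_add]
    by_cases ht : t ∈ S <;> simp only [ht, if_true, if_false, mul_comm (v _ _)] <;> abel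
  · rw [if_neg h, if_neg h, ctrlMap_single, if_neg h]

theorem ctrlMap_one (cs : Finset ℕ) (t : ℕ) : ctrlMap cs t 1 = LinearMap.id := by
  obtain ⟨u, hu⟩ : ∃ u : Matrix (Fin 2) (Fin 2) ℂ, u = 1 := ⟨1, rfl⟩
  rw [← hu]
  refine qstate_hom_ext fun S => ?_
  rw [ctrlMap_single]
  by_cases h : cs.erase t ⊆ S
  · rw [if_pos h]
    by_cases ht : t ∈ S
    · simp only [if_pos ht]; simp [hu, ht]
    · simp only [if_neg ht]; simp [hu, ht]
  · rw [if_neg h]; rfl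

theorem runD_append (A B : List DGate) : runD (A ++ B) = (runD B).comp (runD A) := by
  induction A with
  | nil => rfl
  | cons g A ih => simp only [List.cons_append, runD, ih, LinearMap.comp_assoc]

theorem Elem.mat_mem_unitary (e : Elem) : e.mat ∈ Matrix.unitaryGroup (Fin 2) ℂ := by
  rw [Matrix.mem_unitaryGroup_iff]
  cases e with
  | flip =>
    ext i j; fin_cases i <;> fin_cases j <;> simp [Elem.mat, Matrix.mul_apply, Fin.sum_univ_two]
  | rot a b =>
    have hq0 : 0 ≤ (a : ℝ) / ((a : ℝ) + (b : ℝ)) := by positivity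
    have hq1 : (a : ℝ) / ((a : ℝ) + (b : ℝ)) ≤ 1 := by
      apply div_le_one_of_le₀ _ (by positivity)
      have : (0 : ℝ) ≤ b := by positivity
      linarith
    set q : ℝ := (a : ℝ) / ((a : ℝ) + (b : ℝ)) with hq
    have h1 : (Real.sqrt q : ℂ) * (Real.sqrt q : ℂ) = (q : ℂ) := by
      rw [← Complex.ofReal_mul, Real.mul_self_sqrt hq0]
    have h2 : (Real.sqrt (1 - q) : ℂ) * (Real.sqrt (1 - q) : ℂ) = 1 - (q : ℂ) := by
      rw [← Complex.ofReal_mul, Real.mul_self_sqrt (by linarith)]; push_cast; rfl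
    ext i j
    fin_cases i <;> fin_cases j <;>
      simp [Elem.mat, Matrix.mul_apply, Fin.sum_univ_two, Matrix.star_apply, ← hq] <;>
      first | (ring; done) | (ring_nf; ring_nf at h1 h2; rw [h1, h2]; ring)
  | phase a b =>
    have h : ∀ x : ℝ, Complex.exp (2 * Real.pi * Complex.I * (x : ℂ)) *
        (starRingEnd ℂ) (Complex.exp (2 * Real.pi * Complex.I * (x : ℂ))) = 1 := by
      intro x
      rw [Complex.mul_conj, Complex.normSq_eq_norm_sq,
        show 2 * (Real.pi : ℂ) * Complex.I * (x : ℂ) = ((2 * Real.pi * x : ℝ) : ℂ) * Complex.I by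
          push_cast; ring, Complex.norm_exp_ofReal_mul_I]
      simp
    have h' := h ((a : ℝ) / (b : ℝ))
    push_cast at h'
    ext i j
    fin_cases i <;> fin_cases j <;>
      simp [Elem.mat, Matrix.mul_apply, Fin.sum_univ_two, Matrix.star_apply] <;> exact h'

/-- A described gate as a gate of an adversary. -/
noncomputable def DGate.toGate (g : DGate) : Gate :=
  ⟨g.controls.toFinset, g.target, ⟨g.elem.mat, g.elem.mat_mem_unitary⟩⟩

theorem runD_eq_runGates (C : List DGate) : runD C = runGates (C.map DGate.toGate) := by
  induction C with
  | nil => rfl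
  | cons g C ih => simp only [List.map_cons, runD, runGates, ih]; rfl

/-- A circuit for the inverse of a described gate. -/
def DGate.inv (g : DGate) : List DGate :=
  match g.elem with
  | .flip => [g]
  | .rot _ _ => [{ g with elem := .phase 1 2 }, g, { g with elem := .phase 1 2 }]
  | .phase a b => [{ g with elem := .phase (a * (b - 1)) b }]

/-- The inverse of a described circuit. -/
def dinv : List DGate → List DGate
  | [] => []
  | g :: gs => dinv gs ++ g.inv

theorem dinv_append (A B : List DGate) : dinv (A ++ B) = dinv B ++ dinv A := by
  induction A with
  | nil => simp [dinv]
  | cons g A ih => simp [dinv, ih]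

theorem phase_half_mat : (Elem.phase 1 2).mat = !![1, 0; 0, -1] := by
  have : 2 * (Real.pi : ℂ) * Complex.I * (((1 : ℕ) : ℂ) / ((2 : ℕ) : ℂ)) = Real.pi * Complex.I := by
    push_cast; ring
  rw [Elem.mat, this, Complex.exp_pi_mul_I]

theorem phase_mul_phase (a b : ℕ) :
    (Elem.phase (a * (b - 1)) b).mat * (Elem.phase a b).mat = 1 := by
  have h : Complex.exp (2 * Real.pi * Complex.I * (((a * (b - 1) : ℕ) : ℂ) / (b : ℂ))) *
      Complex.exp (2 * Real.pi * Complex.I * ((a : ℂ) / (b : ℂ))) = 1 := by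
    rw [← Complex.exp_add]
    -- For `b = 0` the quotient is 0 by convention and both gates are the identity; otherwise the
    -- two angles add up to `a` full turns.
    rcases Nat.eq_zero_or_pos b with rfl | hb
    · simp
    · have hb' : (b : ℂ) ≠ 0 := by exact_mod_cast hb.ne'
      rw [Nat.cast_mul, Nat.cast_sub hb,
        show 2 * (Real.pi : ℂ) * Complex.I * ((a : ℂ) * ((b : ℂ) - ((1 : ℕ) : ℂ)) / (b : ℂ)) +
          2 * (Real.pi : ℂ) * Complex.I * ((a : ℂ) / (b : ℂ)) =
          ((a : ℤ) : ℂ) * (2 * (Real.pi : ℂ) * Complex.I) by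
        push_cast; field_simp; ring, Complex.exp_int_mul_two_pi_mul_I]
  ext i j
  fin_cases i <;> fin_cases j <;> simp [Elem.mat, Matrix.mul_apply, Fin.sum_univ_two]
  simpa using h

theorem DGate.runD_inv (g : DGate) :
    (runD g.inv).comp (ctrlMap g.controls.toFinset g.target g.elem.mat) = LinearMap.id := by
  rcases g with ⟨cs, t, e⟩
  cases e with
  | flip =>
    simp only [DGate.inv, runD, LinearMap.id_comp, ctrlMap_mul]
    rw [← ctrlMap_one cs.toFinset t]
    congr 1
    ext i j; fin_cases i <;> fin_cases j <;> simp [Elem.mat, Matrix.mul_apply, Fin.sum_univ_two]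
  | rot a b =>
    simp only [DGate.inv, runD, LinearMap.id_comp, ctrlMap_mul]
    rw [← ctrlMap_one cs.toFinset t]
    congr 1
    -- `phase 1 2` is Pauli `Z`, and conjugating a real rotation by `Z` transposes it. So the
    -- inverse stays inside the describable gates.
    have hZ : (Elem.phase 1 2).mat * ((Elem.rot a b).mat * (Elem.phase 1 2).mat) =
        star (Elem.rot a b).mat := by
      rw [phase_half_mat]
      ext i j
      fin_cases i <;> fin_cases j <;>
        simp [Elem.mat, Matrix.mul_apply, Fin.sum_univ_two, Matrix.star_apply]
    rw [← Matrix.mul_assoc] at hZ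
    rw [hZ]
    exact Matrix.mem_unitaryGroup_iff'.mp (Elem.mat_mem_unitary (.rot a b))
  | phase a b =>
    simp only [DGate.inv, runD, LinearMap.id_comp, ctrlMap_mul]
    rw [← ctrlMap_one cs.toFinset t, phase_mul_phase]

theorem runD_dinv_comp (C : List DGate) : (runD (dinv C)).comp (runD C) = LinearMap.id := by
  induction C with
  | nil => rfl
  | cons g C ih =>
    rw [dinv, runD_append, runD, LinearMap.comp_assoc, ← LinearMap.comp_assoc _ (runD C), ih,
      LinearMap.id_comp, DGate.runD_inv]

/-- This is how workspace gets uncomputed throughout: a forward computation known on one state gives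
the backward computation without a second analysis. -/
theorem runD_dinv {C : List DGate} {φ ψ : QState} (h : runD C φ = ψ) : runD (dinv C) ψ = φ := by
  rw [← h, ← LinearMap.comp_apply, runD_dinv_comp]; rfl

/-- Renaming of the wires of a gate. -/
def Gate.rename (f : ℕ → ℕ) (g : Gate) : Gate := ⟨g.controls.image f, f g.target, g.mat⟩

/-- The wires of a gate. -/
def Gate.wires (g : Gate) : Finset ℕ := insert g.target g.controls

/-- Renaming the wires and adding spectators. -/
theorem runGates_rename {f : ℕ → ℕ} (hf : Function.Injective f) (R : Finset ℕ) (L : List Gate)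
    (hR : ∀ g ∈ L, ∀ i ∈ g.wires, f i ∉ R) (ψ : QState) :
    runGates (L.map (Gate.rename f)) (Finsupp.mapDomain (fun S => S.image f ∪ R) ψ) =
      Finsupp.mapDomain (fun S => S.image f ∪ R) (runGates L ψ) := by
  induction L generalizing ψ with
  | nil => rfl
  | cons g L ih =>
    rw [List.map_cons, runGates, runGates, LinearMap.comp_apply, LinearMap.comp_apply,
      ← ih fun g' hg' => hR g' (List.mem_cons_of_mem _ hg')]
    congr 1
    suffices h : (g.rename f).map.comp (Finsupp.lmapDomain ℂ ℂ fun S => S.image f ∪ R) =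
        (Finsupp.lmapDomain ℂ ℂ fun S => S.image f ∪ R).comp g.map from congrArg (fun F => F ψ) h
    have ht : f g.target ∉ R := hR g (by simp) _ (by simp [Gate.wires])
    have hc : ∀ i ∈ g.controls, f i ∉ R := fun i hi => hR g (by simp) _ (by simp [Gate.wires, hi])
    refine qstate_hom_ext fun S => ?_
    have h1 : (g.controls.image f).erase (f g.target) ⊆ S.image f ∪ R ↔
        g.controls.erase g.target ⊆ S := by
      rw [← Finset.image_erase hf]
      constructor
      · intro h x hx
        have := h (Finset.mem_image_of_mem f hx)
        rw [Finset.mem_union, hf.mem_finset_image] at this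
        exact this.resolve_right (hc x (Finset.mem_of_mem_erase hx))
      · exact fun h => (Finset.image_subset_image h).trans Finset.subset_union_left
    have h2 : f g.target ∈ S.image f ∪ R ↔ g.target ∈ S := by
      rw [Finset.mem_union, hf.mem_finset_image]; simp [ht]
    have h3 : (S.image f ∪ R).erase (f g.target) = (S.erase g.target).image f ∪ R := by
      rw [Finset.erase_union_distrib, Finset.image_erase hf, Finset.erase_eq_of_notMem ht]
    have h4 : insert (f g.target) (S.image f ∪ R) = (insert g.target S).image f ∪ R := by
      rw [Finset.image_insert, Finset.insert_union]
    simp only [LinearMap.comp_apply, Finsupp.lmapDomain_apply, Finsupp.mapDomain_single, Gate.map,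
      Gate.rename, ctrlMap_single, h1, h2, h3, h4]
    split_ifs <;> simp [Finsupp.mapDomain_add, Finsupp.mapDomain_single]

theorem Gate.rename_id (g : Gate) : g.rename id = g := by
  simp [Gate.rename]

theorem runGates_spectators (R : Finset ℕ) (L : List Gate)
    (hR : ∀ g ∈ L, ∀ i ∈ g.wires, i ∉ R) (ψ : QState) :
    runGates L (Finsupp.mapDomain (fun S => S ∪ R) ψ) =
      Finsupp.mapDomain (fun S => S ∪ R) (runGates L ψ) := by
  have := runGates_rename Function.injective_id R L hR ψ
  simpa [show Gate.rename id = id from funext Gate.rename_id] using this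

end QExpand
namespace QExpand

/-! ## Registers and word arithmetic -/

/-- Names of registers: a kind and two indices. -/
abbrev Reg : Type := Fin 4 × ℕ × ℕ

/-- The number of a register. -/
def addr (ρ : Reg) : ℕ := 4 * ((ρ.2.1 + ρ.2.2) * (ρ.2.1 + ρ.2.2) + ρ.2.1) + ρ.1

/-- With `s = b + j` the pairing is `s² + b`, and `b ≤ s` keeps it strictly below `(s+1)²`, so `s`
is determined. Being a polynomial, the pairing can be evaluated by programs that only add and
multiply. -/
theorem addr_injective : Function.Injective addr := by
  rintro ⟨t, b, j⟩ ⟨t', b', j'⟩ h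
  have hA : ((b + j) * (b + j) + b) = ((b' + j') * (b' + j') + b') ∧ (t : ℕ) = t' := by
    simp only [addr] at h
    generalize (b + j) * (b + j) + b = A at h ⊢
    generalize (b' + j') * (b' + j') + b' = B at h ⊢
    have := t.2; have := t'.2
    omega
  obtain ⟨h1, h2⟩ := hA
  have hs : b + j = b' + j' := by
    rcases lt_trichotomy (b + j) (b' + j') with hlt | heq | hlt
    · nlinarith
    · exact heq
    · nlinarith
  rw [hs] at h1
  have hb : b = b' := by omega
  have hj : j = j' := by omega
  rw [Fin.ext h2, hb, hj]

/-- The wire of bit `b` of register `ρ`, for words of `w` bits. -/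
def wire (w : ℕ) (ρ : Reg) (b : ℕ) : ℕ := addr ρ * w + b

theorem wire_inj {w : ℕ} {ρ ρ' : Reg} {b b' : ℕ} (hb : b < w) (hb' : b' < w) :
    wire w ρ b = wire w ρ' b' ↔ ρ = ρ' ∧ b = b' := by
  constructor
  · intro h
    have h1 : addr ρ = addr ρ' := by
      have := congrArg (· / w) h
      simp only [wire] at this
      rwa [mul_comm, Nat.mul_add_div (by omega), Nat.div_eq_of_lt hb, mul_comm,
        Nat.mul_add_div (by omega), Nat.div_eq_of_lt hb'] at this
    refine ⟨addr_injective h1, ?_⟩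
    simp only [wire, h1] at h
    omega
  · rintro ⟨rfl, rfl⟩; rfl

/-- A word-level state: the contents of the registers. -/
abbrev WState (w : ℕ) : Type := Reg → ZMod (2 ^ w)

/-- Bit `b` of a word. -/
def wbit {w : ℕ} (x : ZMod (2 ^ w)) (b : ℕ) : Bool := x.val.testBit b

/-- The wires that are 1 in a word-level state. -/
def wireSet {w : ℕ} (σ : WState w) : Set ℕ :=
  {i | ∃ ρ b, b < w ∧ wbit (σ ρ) b = true ∧ i = wire w ρ b}

open Classical in
/-- The ket of a word-level state. -/
noncomputable def ket {w : ℕ} (σ : WState w) : QState :=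
  if h : (wireSet σ).Finite then Finsupp.single h.toFinset 1 else 0

theorem wire_mem_wireSet {w : ℕ} (σ : WState w) (ρ : Reg) {b : ℕ} (hb : b < w) :
    wire w ρ b ∈ wireSet σ ↔ wbit (σ ρ) b = true := by
  constructor
  · rintro ⟨ρ', b', hb', h, e⟩
    obtain ⟨rfl, rfl⟩ := (wire_inj hb hb').mp e
    exact h
  · exact fun h => ⟨ρ, b, hb, h, rfl⟩

theorem ket_eq_single {w : ℕ} {σ : WState w} {S : Finset ℕ} (h : (S : Set ℕ) = wireSet σ) :
    ket σ = Finsupp.single S 1 := by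
  have hf : (wireSet σ).Finite := h ▸ S.finite_toSet
  rw [ket, dif_pos hf]
  congr 1
  ext i
  rw [Set.Finite.mem_toFinset, ← h]; simp

/-- There are infinitely many registers, so a word-level state may use infinitely many wires; its
ket then has the junk value 0. With that value the circuit identities hold for every state, and no
finiteness hypothesis has to be carried along. -/
theorem ket_cases {w : ℕ} (σ : WState w) :
    (∃ S : Finset ℕ, (S : Set ℕ) = wireSet σ ∧ ket σ = Finsupp.single S 1) ∨
      (¬ (wireSet σ).Finite ∧ ket σ = 0) := by
  by_cases h : (wireSet σ).Finite
  · exact Or.inl ⟨h.toFinset, by simp, ket_eq_single (by simp)⟩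
  · exact Or.inr ⟨h, by rw [ket, dif_neg h]⟩

theorem wireSet_finite_update {w : ℕ} {σ : WState w} {a : Reg} {x : ZMod (2 ^ w)} :
    (wireSet (Function.update σ a x)).Finite → (wireSet σ).Finite := by
  intro h
  refine (h.union ((Finset.range w).image (wire w a)).finite_toSet).subset ?_
  rintro i ⟨ρ, b, hb, h1, rfl⟩
  by_cases hρ : ρ = a
  · subst hρ
    exact Or.inr (by simpa using ⟨b, hb, rfl⟩)
  · exact Or.inl ⟨ρ, b, hb, by rwa [Function.update_of_ne hρ], rfl⟩

/-- The contents of the registers determine the ket, and different contents give different kets. -/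
theorem ket_update_zero {w : ℕ} {σ : WState w} {a : Reg} {x : ZMod (2 ^ w)}
    (h : ¬ (wireSet σ).Finite) : ket (Function.update σ a x) = 0 := by
  rw [ket, dif_neg fun h' => h (wireSet_finite_update h')]

/-- Multi-controlled `X` gate: controls are bits of registers and wires. -/
def xGate (cs : List ℕ) (t : ℕ) : DGate := ⟨cs, t, .flip⟩

open Classical in
theorem runD_xGate (cs : List ℕ) (t : ℕ) (ht : t ∉ cs) (S : Finset ℕ) :
    runD [xGate cs t] (Finsupp.single S 1) =
      Finsupp.single (if ∀ i ∈ cs, i ∈ S then (if t ∈ S then S.erase t else insert t S) else S) 1 := by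
  rw [runD, runD, LinearMap.id_comp, xGate, ctrlMap_single,
    Finset.erase_eq_of_notMem (by simpa using ht)]
  have h1 : cs.toFinset ⊆ S ↔ ∀ i ∈ cs, i ∈ S := by
    constructor
    · exact fun h i hi => h (by simpa using hi)
    · exact fun h i hi => h i (by simpa using hi)
  simp only [h1]
  by_cases h : ∀ i ∈ cs, i ∈ S
  · rw [if_pos h, if_pos h]
    by_cases h2 : t ∈ S
    · simp [h2, Elem.mat]
    · simp [h2, Elem.mat]
  · rw [if_neg h, if_neg h]

/-- Controlled addition of `2^e` to register `a`, where `v` is the number of bits from `e` on. -/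
def cadd (w : ℕ) (cs : List ℕ) (a : Reg) (e v : ℕ) : List DGate :=
  (List.range v).flatMap fun j =>
    [xGate (cs ++ (List.range (v - 1 - j)).map fun k => wire w a e + k) (wire w a e + (v - 1 - j))]

/-- The most significant bit is flipped first, controlled on all bits below it, so each carry
condition is read before the lower bits change. -/
theorem cadd_succ (w : ℕ) (cs : List ℕ) (a : Reg) (e v : ℕ) :
    cadd w cs a e (v + 1) =
      xGate (cs ++ (List.range v).map fun k => wire w a e + k) (wire w a e + v) ::
        cadd w cs a e v := by
  rw [cadd, List.range_succ_eq_map, List.flatMap_cons, List.flatMap_map]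
  simp only [Nat.add_sub_cancel, Nat.sub_zero, List.singleton_append, cadd]
  congr 1
  refine List.flatMap_congr fun j _ => ?_
  have : v - j.succ = v - 1 - j := by omega
  rw [this]

open Classical in
/-- The effect of an incrementer on the set of wires. -/
theorem runD_cadd_single (w : ℕ) (cs : List ℕ) (a : Reg) (e : ℕ) (v : ℕ) (S : Finset ℕ)
    (hcs : ∀ k < v, wire w a e + k ∉ cs) :
    ∃ S' : Finset ℕ, runD (cadd w cs a e v) (Finsupp.single S 1) = Finsupp.single S' 1 ∧
      (∀ i, (∀ k < v, i ≠ wire w a e + k) → (i ∈ S' ↔ i ∈ S)) ∧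
      ∀ k < v, (wire w a e + k ∈ S' ↔
        ¬ (wire w a e + k ∈ S ↔ ((∀ i ∈ cs, i ∈ S) ∧ ∀ k' < k, wire w a e + k' ∈ S))) := by
  induction v generalizing S with
  | zero => exact ⟨S, rfl, by simp, by simp⟩
  | succ v ih =>
    set t := wire w a e + v with ht
    set cs' := cs ++ (List.range v).map fun k => wire w a e + k with hcs'
    set S1 : Finset ℕ :=
      if ∀ i ∈ cs', i ∈ S then (if t ∈ S then S.erase t else insert t S) else S with hS1
    have htc : t ∉ cs' := by
      simp only [hcs', List.mem_append, List.mem_map, List.mem_range, not_or]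
      refine ⟨hcs v (by omega), ?_⟩
      rintro ⟨k, hk, hk'⟩
      omega
    have hmem : ∀ i, i ≠ t → (i ∈ S1 ↔ i ∈ S) := by
      intro i hi
      rw [hS1]; split_ifs <;> simp [hi]
    have ht1 : t ∈ S1 ↔ ¬ (t ∈ S ↔ ((∀ i ∈ cs, i ∈ S) ∧ ∀ k' < v, wire w a e + k' ∈ S)) := by
      have : (∀ i ∈ cs', i ∈ S) ↔ (∀ i ∈ cs, i ∈ S) ∧ ∀ k' < v, wire w a e + k' ∈ S := by
        simp only [hcs', List.mem_append, List.mem_map, List.mem_range, or_imp, forall_and]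
        refine and_congr Iff.rfl ⟨fun h k hk => h _ ⟨k, hk, rfl⟩, ?_⟩
        rintro h _ ⟨k, hk, rfl⟩
        exact h k hk
      rw [← this, hS1]
      by_cases h1 : ∀ i ∈ cs', i ∈ S
      · rw [if_pos h1, iff_true_intro h1]
        by_cases h2 : t ∈ S <;> simp [h2]
      · rw [if_neg h1, iff_false_intro h1]
        simp
    obtain ⟨S', h1, h2, h3⟩ := ih S1 fun k hk => hcs k (by omega)
    refine ⟨S', ?_, ?_, ?_⟩
    · rw [cadd_succ, ← List.singleton_append, runD_append, LinearMap.comp_apply,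
        runD_xGate _ _ htc, h1]
    · intro i hi
      rw [h2 i fun k hk => hi k (by omega), hmem i (hi v (by omega))]
    · intro k hk
      rcases Nat.lt_succ_iff_lt_or_eq.mp hk with hk | rfl
      · rw [h3 k hk, hmem _ (by omega)]
        have e1 : (∀ i ∈ cs, i ∈ S1) ↔ ∀ i ∈ cs, i ∈ S :=
          forall₂_congr fun i hi => hmem i fun h => htc (by rw [← h, hcs']; simp [hi])
        have e2 : (∀ k' < k, wire w a e + k' ∈ S1) ↔ ∀ k' < k, wire w a e + k' ∈ S :=
          forall₂_congr fun i hi => hmem _ (by omega)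
        rw [e1, e2]
      · rw [h2 _ fun k' hk' => by omega, ht1]

/-! ### Carry propagation when a power of two is added. -/

theorem testBit_succ' (h k : ℕ) :
    (h + 1).testBit k = (h.testBit k ^^ decide (∀ k' < k, h.testBit k' = true)) := by
  induction k generalizing h with
  | zero =>
    simp only [Nat.testBit_zero, Nat.not_lt_zero, IsEmpty.forall_iff, implies_true, decide_true,
      Bool.xor_true]
    rcases Nat.mod_two_eq_zero_or_one h with h0 | h0 <;> simp [Nat.add_mod, h0]
  | succ k ih =>
    have e : (∀ k' < k + 1, h.testBit k' = true) ↔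
        h % 2 = 1 ∧ ∀ k' < k, (h / 2).testBit k' = true := by
      constructor
      · refine fun H => ⟨by simpa using H 0 (by omega), fun k' hk' => ?_⟩
        rw [← Nat.testBit_succ]; exact H _ (by omega)
      · rintro ⟨H0, H⟩ k' hk'
        cases k' with
        | zero => simpa using H0
        | succ k' => rw [Nat.testBit_succ]; exact H k' (by omega)
    rw [Nat.testBit_succ, Nat.testBit_succ]
    rcases Nat.mod_two_eq_zero_or_one h with h0 | h0
    · have : (h + 1) / 2 = h / 2 := by omega
      rw [this, decide_eq_false fun H => by have := (e.mp H).1; omega, Bool.xor_false]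
    · have : (h + 1) / 2 = h / 2 + 1 := by omega
      rw [this, ih]
      congr 1
      exact decide_eq_decide.mpr (by rw [e]; simp [h0])

theorem testBit_add_two_pow (x e k : ℕ) :
    (x + 2 ^ e).testBit (e + k) =
      (x.testBit (e + k) ^^ decide (∀ k' < k, x.testBit (e + k') = true)) := by
  have h : ∀ y k, (y / 2 ^ e).testBit k = y.testBit (e + k) := by
    intro y k; rw [Nat.testBit_div_two_pow, add_comm]
  rw [← h, Nat.add_div_right _ (by positivity), testBit_succ', h]
  simp only [h]

theorem testBit_add_two_pow_lt (x : ℕ) {e b : ℕ} (hb : b < e) :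
    (x + 2 ^ e).testBit b = x.testBit b := by
  have h1 : (x + 2 ^ e) % 2 ^ e = x % 2 ^ e := by simp
  have h2 : ∀ y, y.testBit b = (y % 2 ^ e).testBit b := by
    intro y; rw [Nat.testBit_mod_two_pow]; simp [hb]
  rw [h2, h1, ← h2]

theorem wbit_add_two_pow {w : ℕ} (x : ZMod (2 ^ w)) (e : ℕ) {b : ℕ} (hb : b < w) :
    wbit (x + 2 ^ e) b = (x.val + 2 ^ e).testBit b := by
  have : NeZero (2 ^ w) := ⟨by positivity⟩
  have e1 : x + 2 ^ e = ((x.val + 2 ^ e : ℕ) : ZMod (2 ^ w)) := by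
    push_cast; rw [ZMod.natCast_zmod_val]
  rw [wbit, e1, ZMod.val_natCast, Nat.testBit_mod_two_pow]
  simp [hb]

open Classical in
/-- Controlled addition of a power of two to a register. -/
theorem runD_cadd {w : ℕ} (cs : List (Reg × ℕ)) (a : Reg) {e v : ℕ} (hev : e + v = w)
    (hcs : ∀ c ∈ cs, c.1 ≠ a ∧ c.2 < w) (σ : WState w) :
    runD (cadd w (cs.map fun c => wire w c.1 c.2) a e v) (ket σ) =
      ket (Function.update σ a
        (σ a + if ∀ c ∈ cs, wbit (σ c.1) c.2 = true then 2 ^ e else 0)) := by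
  rcases ket_cases σ with ⟨S, hS, hk⟩ | ⟨hinf, hk⟩
  swap
  · rw [hk, ket_update_zero hinf, map_zero]
  have hwire : ∀ k, wire w a e + k = wire w a (e + k) := fun k => by simp only [wire]; ring
  have hmem : ∀ ρ b, b < w → (wire w ρ b ∈ S ↔ wbit (σ ρ) b = true) := by
    intro ρ b hb
    rw [← wire_mem_wireSet σ ρ hb, ← hS]; simp
  obtain ⟨S', h1, h2, h3⟩ := runD_cadd_single w (cs.map fun c => wire w c.1 c.2) a e v S (by
    intro k hk hmem
    obtain ⟨c, hc, hcw⟩ := List.mem_map.mp hmem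
    rw [hwire] at hcw
    exact (hcs c hc).1 ((wire_inj (hcs c hc).2 (by omega)).mp hcw).1)
  rw [hk, h1]
  symm
  apply ket_eq_single
  have hctrl : (∀ i ∈ cs.map (fun c => wire w c.1 c.2), i ∈ S) ↔
      ∀ c ∈ cs, wbit (σ c.1) c.2 = true := by
    simp only [List.mem_map, forall_exists_index, and_imp, forall_apply_eq_imp_iff₂]
    exact forall₂_congr fun c hc => hmem _ _ (hcs c hc).2
  have key : ∀ ρ b, b < w → (wire w ρ b ∈ S' ↔ wbit (Function.update σ a
        (σ a + if ∀ c ∈ cs, wbit (σ c.1) c.2 = true then 2 ^ e else 0) ρ) b = true) := by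
    intro ρ b hb
    by_cases hρ : ρ = a
    · subst hρ
      rw [Function.update_self]
      by_cases hbe : b < e
      · rw [h2 _ fun k hk => by
          rw [hwire]; intro h; have := ((wire_inj hb (by omega)).mp h).2; omega, hmem _ _ hb]
        split_ifs
        · rw [wbit_add_two_pow _ _ hb, testBit_add_two_pow_lt _ hbe]; rfl
        · rw [add_zero]
      · obtain ⟨k, rfl⟩ := Nat.exists_eq_add_of_le (not_lt.mp hbe)
        have h4 := h3 k (by omega)
        rw [hctrl] at h4
        simp only [hwire] at h4
        rw [h4, hmem _ _ hb]
        have e1 : (∀ k' < k, wire w ρ (e + k') ∈ S) ↔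
            ∀ k' < k, (σ ρ).val.testBit (e + k') = true :=
          forall₂_congr fun k' hk' => hmem _ _ (by omega)
        rw [e1]
        by_cases h5 : ∀ c ∈ cs, wbit (σ c.1) c.2 = true
        · rw [if_pos h5, wbit_add_two_pow _ _ hb, testBit_add_two_pow, iff_true_intro h5, true_and,
            wbit]
          by_cases h6 : (σ ρ).val.testBit (e + k) = true <;>
            by_cases h7 : ∀ k' < k, (σ ρ).val.testBit (e + k') = true <;> simp [h6, iff_true_intro, iff_false_intro, h7]
        · rw [if_neg h5, add_zero, iff_false_intro h5, false_and]
          simp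
    · rw [Function.update_of_ne hρ, h2 _ fun k hk => by
          rw [hwire]; intro h; exact hρ ((wire_inj hb (by omega)).mp h).1, hmem _ _ hb]
  ext i
  rw [Finset.mem_coe]
  by_cases hi : ∃ ρ b, b < w ∧ i = wire w ρ b
  · obtain ⟨ρ, b, hb, rfl⟩ := hi
    rw [key ρ b hb, wire_mem_wireSet _ _ hb]
  · rw [h2 i fun k hk h => hi ⟨a, e + k, by omega, by rw [h, hwire]⟩]
    constructor
    · intro h
      have : i ∈ wireSet σ := by rw [← hS]; exact h
      obtain ⟨ρ, b, hb, -, rfl⟩ := this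
      exact absurd ⟨ρ, b, hb, rfl⟩ hi
    · rintro ⟨ρ, b, hb, -, rfl⟩
      exact absurd ⟨ρ, b, hb, rfl⟩ hi

end QExpand
namespace QExpand

/-! ## Blocks of additive updates -/

/-- Concatenation of `g i (n - 1 - i)` for `i < n`. -/
def loop {α : Type*} (n : ℕ) (g : ℕ → ℕ → List α) : List α :=
  (List.range n).flatMap fun i => g i (n - 1 - i)

theorem flatMap_range_succ {α : Type*} (n : ℕ) (f : ℕ → List α) :
    (List.range (n + 1)).flatMap f = (List.range n).flatMap f ++ f n := by
  rw [List.range_succ, List.flatMap_append]; simp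

theorem dinv_flatMap_range (n : ℕ) (f : ℕ → List DGate) :
    dinv ((List.range n).flatMap f) = (List.range n).flatMap fun i => dinv (f (n - 1 - i)) := by
  induction n generalizing f with
  | zero => rfl
  | succ n ih =>
    rw [List.range_succ_eq_map, List.flatMap_cons, List.flatMap_map, dinv_append, ih,
      ← List.range_succ_eq_map, flatMap_range_succ]
    congr 1
    · refine List.flatMap_congr fun i hi => ?_
      rw [List.mem_range] at hi
      congr 2; simp only [Nat.succ_eq_add_one]; omega
    · simp

/-- The circuit `C` adds `δ σ` to the registers; only registers in `A` change, and the increments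
depend on the other registers only. -/
structure AddsOn {w : ℕ} (C : List DGate) (A : Set Reg) (δ : WState w → WState w) : Prop where
  run : ∀ σ : WState w, runD C (ket σ) = ket (σ + δ σ)
  supp : ∀ σ ρ, ρ ∉ A → δ σ ρ = 0
  dep : ∀ σ τ, (∀ ρ, ρ ∉ A → σ ρ = τ ρ) → δ σ = δ τ

theorem AddsOn.nil {w : ℕ} (A : Set Reg) : AddsOn (w := w) [] A fun _ => 0 :=
  ⟨fun σ => by simp [runD], fun _ _ _ => rfl, fun _ _ _ => rfl⟩

theorem AddsOn.congr {w : ℕ} {C : List DGate} {A : Set Reg} {δ δ' : WState w → WState w}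
    (h : AddsOn C A δ) (e : ∀ σ, δ σ = δ' σ) : AddsOn C A δ' :=
  (funext e : δ = δ') ▸ h

/-- The increments depend only on registers outside `A`, which neither circuit changes, so the
second circuit sees the inputs of the first and the increments simply add up. -/
theorem AddsOn.append {w : ℕ} {C C' : List DGate} {A : Set Reg} {δ δ' : WState w → WState w}
    (h : AddsOn C A δ) (h' : AddsOn C' A δ') : AddsOn (C ++ C') A fun σ => δ σ + δ' σ where
  run σ := by
    rw [runD_append, LinearMap.comp_apply, h.run, h'.run,
      h'.dep (σ + δ σ) σ fun ρ hρ => by simp [h.supp σ ρ hρ], add_assoc]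
  supp σ ρ hρ := by simp [h.supp σ ρ hρ, h'.supp σ ρ hρ]
  dep σ τ hστ := by rw [h.dep σ τ hστ, h'.dep σ τ hστ]

/-- Started at `σ - δ σ`, the circuit reads the same inputs as at `σ` and adds `δ σ` back. -/
theorem AddsOn.dinv {w : ℕ} {C : List DGate} {A : Set Reg} {δ : WState w → WState w}
    (h : AddsOn C A δ) : AddsOn (dinv C) A fun σ => -δ σ where
  run σ := by
    apply runD_dinv
    rw [h.run, h.dep (σ + -δ σ) σ fun ρ hρ => by simp [h.supp σ ρ hρ]]
    congr 1; abel
  supp σ ρ hρ := by simp [h.supp σ ρ hρ]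
  dep σ τ hστ := by rw [h.dep σ τ hστ]

theorem AddsOn.loop {w : ℕ} {n : ℕ} {g : ℕ → ℕ → List DGate} {A : Set Reg}
    {δ : ℕ → WState w → WState w} (h : ∀ i < n, AddsOn (g i (n - 1 - i)) A (δ i)) :
    AddsOn (loop n g) A fun σ => ∑ i ∈ Finset.range n, δ i σ := by
  have key : ∀ (m : ℕ) (f : ℕ → List DGate), (∀ i < m, AddsOn (f i) A (δ i)) →
      AddsOn ((List.range m).flatMap f) A fun σ => ∑ i ∈ Finset.range m, δ i σ := by
    intro m f
    induction m with
    | zero => intro _; exact AddsOn.nil A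
    | succ m ih =>
      intro hf
      rw [flatMap_range_succ]
      exact ((ih fun i hi => hf i (by omega)).append (hf m (by omega))).congr fun σ => by
        rw [Finset.sum_range_succ]
  exact key n _ h

theorem AddsOn.cadd {w : ℕ} (cs : List (Reg × ℕ)) {A : Set Reg} {a : Reg} {e v : ℕ}
    (hev : e + v = w) (ha : a ∈ A) (hcs : ∀ c ∈ cs, c.1 ∉ A ∧ c.2 < w) :
    AddsOn (w := w) (cadd w (cs.map fun c => wire w c.1 c.2) a e v) A fun σ =>
      Pi.single a (if ∀ c ∈ cs, wbit (σ c.1) c.2 = true then 2 ^ e else 0) where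
  run σ := by
    rw [runD_cadd cs a hev (fun c hc => ⟨fun h => (hcs c hc).1 (h ▸ ha), (hcs c hc).2⟩)]
    congr 1
    ext ρ
    by_cases hρ : ρ = a
    · subst hρ; simp
    · simp [hρ]
  supp σ ρ hρ := Pi.single_eq_of_ne (fun h => hρ (by rw [h]; exact ha)) _
  dep σ τ h := by
    have : (∀ c ∈ cs, wbit (σ c.1) c.2 = true) ↔ ∀ c ∈ cs, wbit (τ c.1) c.2 = true :=
      forall₂_congr fun c hc => by rw [h _ (hcs c hc).1]
    simp only [this]

/-! ### Addition and multiplication of words, bit by bit. -/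

theorem sum_testBit (w n : ℕ) (h : n < 2 ^ w) :
    ∑ i ∈ Finset.range w, (if n.testBit i = true then 2 ^ i else 0) = n := by
  induction w generalizing n with
  | zero => simp at h; simp [h]
  | succ w ih =>
    rw [Finset.sum_range_succ']
    have e : ∀ i, (if n.testBit (i + 1) = true then 2 ^ (i + 1) else 0) =
        2 * (if (n / 2).testBit i = true then 2 ^ i else 0) := by
      intro i; rw [Nat.testBit_succ]; split_ifs <;> ring
    simp only [e]
    rw [← Finset.mul_sum, ih (n / 2) (by omega)]
    rcases Nat.mod_two_eq_zero_or_one n with h0 | h0 <;> simp [h0] <;> omega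

theorem word_eq_sum {w : ℕ} (x : ZMod (2 ^ w)) :
    x = ∑ i ∈ Finset.range w, (if wbit x i = true then 2 ^ i else 0) := by
  have : NeZero (2 ^ w) := ⟨by positivity⟩
  conv_lhs => rw [← ZMod.natCast_zmod_val x, ← sum_testBit w x.val (ZMod.val_lt x)]
  push_cast
  rfl

theorem pi_single_sum {ι : Type*} {w : ℕ} (a : Reg) (s : Finset ι) (f : ι → ZMod (2 ^ w)) :
    (Pi.single a (∑ i ∈ s, f i) : WState w) = ∑ i ∈ s, Pi.single a (f i) :=
  map_sum (AddMonoidHom.single (fun _ : Reg => ZMod (2 ^ w)) a) f s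

/-- `a += b` if the control bits are set. -/
def addW (w : ℕ) (cs : List (Reg × ℕ)) (a b : Reg) : List DGate :=
  loop w fun i c => cadd w (((b, i) :: cs).map fun c => wire w c.1 c.2) a i (c + 1)

/-- `a += b * c` if the control bits are set. -/
def mulW (w : ℕ) (cs : List (Reg × ℕ)) (a b c : Reg) : List DGate :=
  loop w fun i k => loop (k + 1) fun j k' =>
    cadd w (((b, i) :: (c, j) :: cs).map fun c => wire w c.1 c.2) a (i + j) (k' + 1)

/-- The value 1 if all control bits are set, and 0 otherwise. -/
def ctrlVal {w : ℕ} (cs : List (Reg × ℕ)) (σ : WState w) : ZMod (2 ^ w) :=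
  if ∀ c ∈ cs, wbit (σ c.1) c.2 = true then 1 else 0

@[simp] theorem ctrlVal_nil {w : ℕ} (σ : WState w) : ctrlVal [] σ = 1 := by simp [ctrlVal]

theorem ctrlVal_singleton {w : ℕ} (ρ : Reg) (i : ℕ) (σ : WState w) :
    ctrlVal [(ρ, i)] σ = if wbit (σ ρ) i = true then 1 else 0 := by simp [ctrlVal]

theorem AddsOn.cadd' {w : ℕ} (cs : List (Reg × ℕ)) {A : Set Reg} {a : Reg} {e v : ℕ}
    (hev : e + v = w) (ha : a ∈ A) (hcs : ∀ c ∈ cs, c.1 ∉ A ∧ c.2 < w) :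
    AddsOn (w := w) (QExpand.cadd w (cs.map fun c => wire w c.1 c.2) a e v) A fun σ =>
      Pi.single a (2 ^ e * ctrlVal cs σ) :=
  (AddsOn.cadd cs hev ha hcs).congr fun σ => by
    rw [ctrlVal]; split_ifs <;> simp

theorem AddsOn.addW {w : ℕ} (cs : List (Reg × ℕ)) {A : Set Reg} {a b : Reg}
    (ha : a ∈ A) (hb : b ∉ A) (hcs : ∀ c ∈ cs, c.1 ∉ A ∧ c.2 < w) :
    AddsOn (w := w) (QExpand.addW w cs a b) A fun σ => Pi.single a (σ b * ctrlVal cs σ) := by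
  refine (AddsOn.loop (δ := fun i σ =>
    Pi.single a (if ∀ c ∈ ((b, i) :: cs), wbit (σ c.1) c.2 = true then 2 ^ i else 0))
    fun i hi => ?_).congr fun σ => ?_
  · refine AddsOn.cadd _ (by omega) ha fun c hc => ?_
    rcases List.mem_cons.mp hc with rfl | hc
    · exact ⟨hb, hi⟩
    · exact hcs c hc
  · conv_rhs => rw [word_eq_sum (σ b)]
    rw [Finset.sum_mul, ← pi_single_sum]
    congr 1
    refine Finset.sum_congr rfl fun i _ => ?_
    simp only [List.forall_mem_cons, ctrlVal]
    split_ifs <;> simp_all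

theorem two_pow_eq_zero (w : ℕ) {k : ℕ} (h : w ≤ k) : (2 : ZMod (2 ^ w)) ^ k = 0 := by
  obtain ⟨j, rfl⟩ := Nat.exists_eq_add_of_le h
  rw [pow_add]
  have : ((2 ^ w : ℕ) : ZMod (2 ^ w)) = 0 := ZMod.natCast_self _
  push_cast at this
  rw [this, zero_mul]

theorem AddsOn.mulW {w : ℕ} (cs : List (Reg × ℕ)) {A : Set Reg} {a b c : Reg}
    (ha : a ∈ A) (hb : b ∉ A) (hc : c ∉ A) (hcs : ∀ c ∈ cs, c.1 ∉ A ∧ c.2 < w) :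
    AddsOn (w := w) (QExpand.mulW w cs a b c) A fun σ =>
      Pi.single a (σ b * σ c * ctrlVal cs σ) := by
  refine (AddsOn.loop (δ := fun i σ => ∑ j ∈ Finset.range (w - i),
    Pi.single a (if ∀ q ∈ ((b, i) :: (c, j) :: cs), wbit (σ q.1) q.2 = true
      then 2 ^ (i + j) else 0)) fun i hi => ?_).congr fun σ => ?_
  · have hn : w - 1 - i + 1 = w - i := by omega
    rw [hn]
    refine AddsOn.loop (δ := fun j σ => Pi.single a
      (if ∀ q ∈ ((b, i) :: (c, j) :: cs), wbit (σ q.1) q.2 = true then 2 ^ (i + j) else 0))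
      fun j hj => ?_
    refine AddsOn.cadd _ (by omega) ha fun q hq => ?_
    rcases List.mem_cons.mp hq with rfl | hq
    · exact ⟨hb, hi⟩
    rcases List.mem_cons.mp hq with rfl | hq
    · exact ⟨hc, by simp only; omega⟩
    · exact hcs q hq
  · conv_rhs => rw [word_eq_sum (σ b), word_eq_sum (σ c)]
    rw [Finset.sum_mul, Finset.sum_mul]
    simp only [← pi_single_sum]
    congr 1
    refine Finset.sum_congr rfl fun i hi => ?_
    rw [Finset.mul_sum, Finset.sum_mul]
    -- The circuit stops the inner loop at `w - i`: the omitted partial products carry `2^(i+j)`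
    -- with `i + j ≥ w`, which is 0 modulo `2^w`.
    rw [← Finset.sum_subset (Finset.range_mono (Nat.sub_le w i))]
    · refine Finset.sum_congr rfl fun j _ => ?_
      simp only [List.forall_mem_cons, ctrlVal, pow_add]
      split_ifs <;> simp_all
    · intro j _ hj
      simp only [Finset.mem_range, not_lt] at hj
      have : (2 : ZMod (2 ^ w)) ^ i * 2 ^ j = 0 := by
        rw [← pow_add]; exact two_pow_eq_zero w (by omega)
      split_ifs <;> simp [this]

/-- Replace `C` by `δ`-updates on kets: one step of a computation. -/
theorem AddsOn.step {w : ℕ} {C D : List DGate} {A : Set Reg} {δ : WState w → WState w}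
    (h : AddsOn C A δ) {σ τ : WState w} {ψ : QState} (e : σ + δ σ = τ)
    (h' : runD D (ket τ) = ψ) : runD (C ++ D) (ket σ) = ψ := by
  rw [runD_append, LinearMap.comp_apply, h.run, e, h']

/-! ### Comparisons and conditional swaps -/

/-- `f += 1` if `a < b` (as words with top bit 0). -/
def ltFlag (w : ℕ) (f a b : Reg) : List DGate :=
  dinv (addW w [] a b) ++ (cadd w ([(a, w - 1)].map fun c => wire w c.1 c.2) f 0 w ++ addW w [] a b)

/-- `b` is subtracted from `a`, the sign bit is added to the flag, and `a` is restored; so `a`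
changes only temporarily and may lie outside `A`. -/
theorem AddsOn.ltFlag {w : ℕ} (hw : 0 < w) {A : Set Reg} {f a b : Reg} (hf : f ∈ A) (ha : a ∉ A)
    (hb : b ∉ A) (hab : a ≠ b) :
    AddsOn (w := w) (QExpand.ltFlag w f a b) A fun σ =>
      Pi.single f (if wbit (σ a - σ b) (w - 1) = true then 1 else 0) where
  run σ := by
    have h1 := AddsOn.addW (w := w) [] (A := {a}) (a := a) (b := b) rfl (by simpa using hab.symm)
      (by simp)
    have hfa : f ≠ a := fun h => ha (h ▸ hf)
    have hfb : f ≠ b := fun h => hb (h ▸ hf)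
    have h2 := AddsOn.cadd (w := w) [(a, w - 1)] (A := {f}) (a := f) (e := 0) (v := w)
      (by omega) rfl (by simpa using ⟨hfa.symm, by omega⟩)
    refine h1.dinv.step rfl (h2.step rfl ?_)
    rw [h1.run]
    congr 1
    ext ρ
    simp [Pi.single_apply, hfa, hfb, hab, hab.symm, hfb.symm, hfa.symm]
    by_cases h3 : ρ = a <;> by_cases h4 : ρ = f <;> simp [h3, h4, hfa, hfa.symm, sub_eq_add_neg]
  supp σ ρ hρ := Pi.single_eq_of_ne (fun h => hρ (by rw [h]; exact hf)) _
  dep σ τ h := by rw [h a ha, h b hb]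

/-- Two's complement: for operands below `2^(w-1)` the difference wraps into the upper half of the
residues exactly when it is negative. -/
theorem wbit_sub_top {w : ℕ} (hw : 0 < w) {u v : ℕ} (hu : u < 2 ^ (w - 1)) (hv : v < 2 ^ (w - 1)) :
    wbit ((u : ZMod (2 ^ w)) - (v : ZMod (2 ^ w))) (w - 1) = decide (u < v) := by
  have hp : 2 ^ w = 2 * 2 ^ (w - 1) := by
    rw [← pow_succ']; congr 1; omega
  have : NeZero (2 ^ w) := ⟨by positivity⟩
  rw [wbit]
  by_cases h : u < v
  · have e : ((u : ZMod (2 ^ w)) - (v : ZMod (2 ^ w))) = ((2 ^ w - (v - u) : ℕ) : ZMod (2 ^ w)) := by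
      rw [Nat.cast_sub (by omega), Nat.cast_sub h.le, ZMod.natCast_self]; ring
    rw [e, ZMod.val_natCast_of_lt (by omega)]
    have h2 : 2 ^ w - (v - u) = 2 ^ (w - 1) + (2 ^ (w - 1) - (v - u)) := by omega
    rw [h2, Nat.testBit_two_pow_add_eq, Nat.testBit_lt_two_pow (by omega)]
    simp [h]
  · have e : ((u : ZMod (2 ^ w)) - (v : ZMod (2 ^ w))) = ((u - v : ℕ) : ZMod (2 ^ w)) := by
      rw [Nat.cast_sub (by omega)]
    rw [e, ZMod.val_natCast_of_lt (by omega), Nat.testBit_lt_two_pow (by omega)]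
    simp [h]

/-- Exchange registers `a` and `b` if the control bits are set, using a clean register `t`. -/
def swapW (w : ℕ) (cs : List (Reg × ℕ)) (t a b : Reg) : List DGate :=
  (addW w cs t a ++ dinv (addW w cs t b)) ++ (dinv (addW w [] a t) ++ (addW w [] b t ++
    (addW w cs t a ++ dinv (addW w cs t b))))

theorem ctrlVal_cases {w : ℕ} (cs : List (Reg × ℕ)) (σ : WState w) :
    ctrlVal cs σ = 0 ∨ ctrlVal cs σ = 1 := by
  rw [ctrlVal]; split_ifs <;> simp

/-- With `x ∈ {0,1}` the control value, `t` becomes `x (a - b)`, which is taken from `a` and given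
to `b`. The difference of the new contents is `(1 - 2x)(a - b)`; adding `x` times this to `t` clears
it, since `x² = x`. -/
theorem runD_swapW {w : ℕ} {cs : List (Reg × ℕ)} {t a b : Reg} (hta : t ≠ a) (htb : t ≠ b)
    (hab : a ≠ b) (hcs : ∀ c ∈ cs, c.1 ≠ t ∧ c.1 ≠ a ∧ c.1 ≠ b ∧ c.2 < w) (σ : WState w)
    (ht : σ t = 0) :
    runD (swapW w cs t a b) (ket σ) =
      ket (σ + Pi.single a (ctrlVal cs σ * (σ b - σ a)) +
        Pi.single b (ctrlVal cs σ * (σ a - σ b))) := by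
  have h1 := AddsOn.addW (w := w) cs (A := {t}) (a := t) (b := a) rfl (by simpa using hta.symm)
    (fun c hc => ⟨(hcs c hc).1, (hcs c hc).2.2.2⟩)
  have h2 := AddsOn.addW (w := w) cs (A := {t}) (a := t) (b := b) rfl (by simpa using htb.symm)
    (fun c hc => ⟨(hcs c hc).1, (hcs c hc).2.2.2⟩)
  have h3 := AddsOn.addW (w := w) [] (A := {a}) (a := a) (b := t) rfl (by simpa using hta) (by simp)
  have h4 := AddsOn.addW (w := w) [] (A := {b}) (a := b) (b := t) rfl (by simpa using htb) (by simp)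
  refine (h1.append h2.dinv).step rfl (h3.dinv.step rfl (h4.step rfl ?_))
  rw [(h1.append h2.dinv).run]
  set x := ctrlVal cs σ with hx
  have hc : ∀ τ : WState w, (∀ ρ, ρ ≠ t → ρ ≠ a → ρ ≠ b → τ ρ = σ ρ) → ctrlVal cs τ = x := by
    intro τ hτ
    rw [hx, ctrlVal, ctrlVal]
    have : (∀ c ∈ cs, wbit (τ c.1) c.2 = true) ↔ ∀ c ∈ cs, wbit (σ c.1) c.2 = true :=
      forall₂_congr fun c hc => by rw [hτ _ (hcs c hc).1 (hcs c hc).2.1 (hcs c hc).2.2.1]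
    simp only [this]
  rw [hc _ (by intro ρ h1 h2 h3; simp [h1, h2, h3])]
  congr 1
  ext ρ
  have hx2 : x * x = x := by rcases ctrlVal_cases cs σ with h | h <;> rw [hx, h] <;> ring
  by_cases h5 : ρ = t
  · subst h5
    simp [ht, hta, htb, hab, hta.symm, htb.symm, hab.symm]
    linear_combination (-2 * (σ a - σ b)) * hx2
  by_cases h6 : ρ = a
  · subst h6
    simp [ht, hta, htb, hab, hta.symm, htb.symm, hab.symm]
    ring
  by_cases h7 : ρ = b
  · subst h7
    simp [ht, hta, htb, hab, hta.symm, htb.symm, hab.symm]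
    ring
  simp [h5, h6, h7]

/-! ### Controlled rotations -/

/-- Controlled rotation of bit 0 of register `s`. -/
def rotGate (w : ℕ) (cs : List Reg) (s : Reg) (a b : ℕ) : List DGate :=
  [⟨cs.map fun ρ => wire w ρ 0, wire w s 0, .rot a b⟩]

theorem wbit_zero {w : ℕ} (b : ℕ) : wbit (0 : ZMod (2 ^ w)) b = false := by
  simp [wbit]

theorem wbit_one {w : ℕ} (hw : 0 < w) (b : ℕ) : wbit (1 : ZMod (2 ^ w)) b = decide (b = 0) := by
  have : Fact (1 < 2 ^ w) := ⟨Nat.one_lt_two_pow (by omega)⟩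
  rw [wbit, ZMod.val_one]
  cases b <;> simp [Nat.testBit_succ]

theorem runD_rotGate_of_not {w : ℕ} (hw : 0 < w) {cs : List Reg} {s : Reg} (hs : s ∉ cs) (a b : ℕ)
    (σ : WState w) (h : ¬ ∀ ρ ∈ cs, wbit (σ ρ) 0 = true) :
    runD (rotGate w cs s a b) (ket σ) = ket σ := by
  rcases ket_cases σ with ⟨S, hS, hk⟩ | ⟨hinf, hk⟩
  swap
  · rw [hk, map_zero]
  rw [hk, rotGate, runD, runD, LinearMap.id_comp, ctrlMap_single, if_neg]
  intro hsub
  apply h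
  intro ρ hρ
  rw [← wire_mem_wireSet σ ρ hw, ← hS]
  apply hsub
  rw [Finset.mem_erase]
  refine ⟨fun e => hs ?_, by simpa using ⟨_, _, _, hρ, rfl⟩⟩
  rw [← ((wire_inj hw hw).mp e).1]; exact hρ

theorem runD_rotGate {w : ℕ} (hw : 0 < w) {cs : List Reg} {s : Reg} (a b : ℕ)
    (σ : WState w) (hσ : σ s = 0) (h : ∀ ρ ∈ cs, wbit (σ ρ) 0 = true) :
    runD (rotGate w cs s a b) (ket σ) =
      (Real.sqrt ((a : ℝ) / ((a : ℝ) + (b : ℝ))) : ℂ) • ket σ +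
        (Real.sqrt (1 - (a : ℝ) / ((a : ℝ) + (b : ℝ))) : ℂ) • ket (Function.update σ s 1) := by
  rcases ket_cases σ with ⟨S, hS, hk⟩ | ⟨hinf, hk⟩
  swap
  · rw [hk, ket_update_zero hinf, map_zero]; simp
  have hmem : ∀ ρ b, b < w → (wire w ρ b ∈ S ↔ wbit (σ ρ) b = true) := by
    intro ρ b hb
    rw [← wire_mem_wireSet σ ρ hb, ← hS]; simp
  have hsS : wire w s 0 ∉ S := by rw [hmem s 0 hw, hσ, wbit_zero]; simp
  have hk' : ket (Function.update σ s 1) = Finsupp.single (insert (wire w s 0) S) 1 := by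
    apply ket_eq_single
    rw [Finset.coe_insert, hS]
    ext i
    rw [Set.mem_insert_iff]
    constructor
    · rintro (rfl | ⟨ρ, b, hb, h1, rfl⟩)
      · exact ⟨s, 0, hw, by rw [Function.update_self, wbit_one hw]; rfl, rfl⟩
      · refine ⟨ρ, b, hb, ?_, rfl⟩
        by_cases hρ : ρ = s
        · subst hρ; rw [hσ, wbit_zero] at h1; simp at h1
        · rwa [Function.update_of_ne hρ]
    · rintro ⟨ρ, b, hb, h1, rfl⟩
      by_cases hρ : ρ = s
      · subst hρ
        rw [Function.update_self, wbit_one hw] at h1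
        left; rw [of_decide_eq_true h1]
      · rw [Function.update_of_ne hρ] at h1
        exact Or.inr ⟨ρ, b, hb, h1, rfl⟩
  rw [hk, hk', rotGate, runD, runD, LinearMap.id_comp, ctrlMap_single, if_pos]
  · simp only [hsS, if_false, Finset.erase_eq_of_notMem hsS]
    simp [Elem.mat]
  · intro i hi
    obtain ⟨-, hi⟩ := Finset.mem_erase.mp hi
    obtain ⟨ρ, hρ, rfl⟩ := List.mem_map.mp (List.mem_toFinset.mp hi)
    exact (hmem ρ 0 hw).mpr (h ρ hρ)

end QExpand
namespace QExpand

/-! ## Unranking of types -/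

def rM : Reg := (0, 0, 0)
def rF : Reg := (0, 0, 1)
def rX (j : ℕ) : Reg := (1, 0, j)
def rD (b j : ℕ) : Reg := (2, b, j)
def rP (b j : ℕ) : Reg := (3, b, j)

/-- One step of the computation of binomial coefficients: `rD c` holds the row of `2^c`, and `rP c`
holds the row of the number formed by the lowest `c` bits of register `x`. -/
def binStep (w l : ℕ) (x : Reg) (c : ℕ) : List DGate :=
  loop (l + 1) fun k _ =>
    (loop (k + 1) fun j j' => mulW w [] (rD (c + 1) k) (rD c j) (rD c j')) ++
    (addW w [] (rP (c + 1) k) (rP c k) ++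
    ((loop (k + 1) fun j j' => mulW w [(x, c)] (rP (c + 1) k) (rP c j) (rD c j')) ++
    dinv (addW w [(x, c)] (rP (c + 1) k) (rP c k))))

def binTable (w l K : ℕ) (x : Reg) : List DGate :=
  (cadd w [] (rD 0 0) 0 w ++ (cadd w [] (rD 0 1) 0 w ++ cadd w [] (rP 0 0) 0 w)) ++
    loop K fun c _ => binStep w l x c

/-- Subtract a binomial coefficient of the number in `x` from `rM`. -/
def subBin (w l K : ℕ) (x : Reg) (k : ℕ) : List DGate :=
  binTable w l K x ++ (dinv (addW w [] rM (rP K k)) ++ dinv (binTable w l K x))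

/-- The registers of the tables. -/
def tab (w l y c : ℕ) : WState w := fun ρ =>
  if ρ.1 = 2 ∧ ρ.2.1 ≤ c ∧ ρ.2.2 < l + 1 then ((2 ^ ρ.2.1).choose ρ.2.2 : ℕ)
  else if ρ.1 = 3 ∧ ρ.2.1 ≤ c ∧ ρ.2.2 < l + 1 then ((y % 2 ^ ρ.2.1).choose ρ.2.2 : ℕ)
  else 0

/-! ### The tables of binomial coefficients. -/

theorem sum_single_row {w : ℕ} (t : Fin 4) (b n : ℕ) (v : ℕ → ZMod (2 ^ w)) (ρ : Reg) :
    (∑ k ∈ Finset.range n, (Pi.single ((t, b, k) : Reg) (v k) : WState w)) ρ =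
      if ρ.1 = t ∧ ρ.2.1 = b ∧ ρ.2.2 < n then v ρ.2.2 else 0 := by
  obtain ⟨t', b', j⟩ := ρ
  rw [Finset.sum_apply]
  by_cases h : t' = t ∧ b' = b
  · obtain ⟨rfl, rfl⟩ := h
    simp [Pi.single_apply, Prod.ext_iff]
  · have : ¬ (t' = t ∧ b' = b ∧ j < n) := fun h' => h ⟨h'.1, h'.2.1⟩
    simp only [this, if_false]
    refine Finset.sum_eq_zero fun k _ => ?_
    refine Pi.single_eq_of_ne (fun e => h ?_) _
    simp only [Prod.ext_iff] at e
    exact ⟨e.1, e.2.1⟩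

/-- The second index is written `k + 1 - 1 - j` because that is the remaining count supplied by
`loop (k + 1)`. -/
theorem choose_vandermonde (m n k : ℕ) :
    (m + n).choose k = ∑ j ∈ Finset.range (k + 1), m.choose j * n.choose (k + 1 - 1 - j) := by
  rw [Nat.add_choose_eq, Finset.Nat.sum_antidiagonal_eq_sum_range_succ
    (fun i j => m.choose i * n.choose j)]
  rfl

/-- Row `c + 1` is computed from row `c` and one bit of `x` only, so all increments of the step have
the fresh row as their common target set. -/
theorem AddsOn.binStep {w : ℕ} (l : ℕ) {x : Reg} (hx : x.1 = 1) {c : ℕ} (hc : c < w) :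
    AddsOn (w := w) (QExpand.binStep w l x c) {ρ | (ρ.1 = 2 ∨ ρ.1 = 3) ∧ ρ.2.1 = c + 1} fun σ =>
      ∑ k ∈ Finset.range (l + 1),
        ((∑ j ∈ Finset.range (k + 1), Pi.single (rD (c + 1) k)
          (σ (rD c j) * σ (rD c (k + 1 - 1 - j)) * ctrlVal [] σ)) +
        (Pi.single (rP (c + 1) k) (σ (rP c k) * ctrlVal [] σ) +
        ((∑ j ∈ Finset.range (k + 1), Pi.single (rP (c + 1) k)
          (σ (rP c j) * σ (rD c (k + 1 - 1 - j)) * ctrlVal [(x, c)] σ)) +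
        -Pi.single (rP (c + 1) k) (σ (rP c k) * ctrlVal [(x, c)] σ)))) := by
  have hx2 : ∀ q ∈ [(x, c)], q.1 ∉ {ρ : Reg | (ρ.1 = 2 ∨ ρ.1 = 3) ∧ ρ.2.1 = c + 1} ∧ q.2 < w := by
    simp [hx, hc]
  refine AddsOn.loop fun k _ => ?_
  refine (AddsOn.loop fun j _ => AddsOn.mulW [] (by simp [rD]) (by simp [rD]) (by simp [rD])
    (by simp)).append ((AddsOn.addW [] (by simp [rP]) (by simp [rP]) (by simp)).append
    ((AddsOn.loop fun j _ => AddsOn.mulW _ (by simp [rP]) (by simp [rP]) (by simp [rD]) hx2).append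
      (AddsOn.addW _ (by simp [rP]) (by simp [rP]) hx2).dinv))

/-- Vandermonde convolution with the row of `2^c` doubles `2^c`, and adds `2^c` to the number formed
by the lowest `c` bits. If bit `c` is set the copied row is replaced by the convolution, otherwise
it stays. Only ring operations occur (no division), so table entries that overflow are still correct
modulo `2^w`. -/
theorem binStep_value {w l y c : ℕ} {x : Reg} (hx : x.1 = 1) (hc : c < w) (σ : WState w)
    (hD : ∀ ρ : Reg, ρ.1 = 2 ∨ ρ.1 = 3 → σ ρ = 0) (hy : (σ x).val = y) :
    runD (binStep w l x c) (ket (σ + tab w l y c)) = ket (σ + tab w l y (c + 1)) := by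
  rw [(AddsOn.binStep l hx hc).run, add_assoc]
  congr 2
  have h2 : ∀ j, (σ + tab w l y c) (rD c j) = if j < l + 1 then ((2 ^ c).choose j : ℕ) else 0 := by
    intro j; simp [rD, hD, tab]
  have h3 : ∀ j, (σ + tab w l y c) (rP c j) =
      if j < l + 1 then ((y % 2 ^ c).choose j : ℕ) else 0 := by
    intro j; simp [rP, hD, tab]
  have h4 : ctrlVal [(x, c)] (σ + tab w l y c) = if y.testBit c = true then 1 else 0 := by
    have : (σ + tab w l y c) x = σ x := by simp [tab, hx]
    rw [ctrlVal_singleton, this, wbit, hy]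
  simp only [ctrlVal_nil, mul_one, h4, ← pi_single_sum, ← Pi.single_neg, Finset.sum_add_distrib]
  simp only [← pi_single_sum, rP, rD, ← Pi.single_neg, Finset.sum_add_distrib]
  have e : ∀ k < l + 1, ∀ j < k + 1, j < l + 1 ∧ k + 1 - 1 - j < l + 1 := by intros; omega
  have e1 : ∀ k < l + 1, ∑ j ∈ Finset.range (k + 1), (σ + tab w l y c) (2, c, j) *
      (σ + tab w l y c) (2, c, k + 1 - 1 - j) = ((2 ^ (c + 1)).choose k : ℕ) := by
    intro k hk
    rw [pow_succ, mul_two, choose_vandermonde, Nat.cast_sum]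
    refine Finset.sum_congr rfl fun j hj => ?_
    have := e k hk j (Finset.mem_range.mp hj)
    rw [← rD, ← rD, h2, h2, if_pos this.1, if_pos this.2]; push_cast; rfl
  have e2 : ∀ k < l + 1, ∑ j ∈ Finset.range (k + 1), (σ + tab w l y c) (3, c, j) *
      (σ + tab w l y c) (2, c, k + 1 - 1 - j) * (if y.testBit c = true then 1 else 0) =
      if y.testBit c = true then ((y % 2 ^ c + 2 ^ c).choose k : ℕ) else 0 := by
    intro k hk
    rw [← Finset.sum_mul, choose_vandermonde, mul_ite, mul_one, mul_zero, Nat.cast_ite,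
      Nat.cast_sum, Nat.cast_zero]
    congr 1
    refine Finset.sum_congr rfl fun j hj => ?_
    have := e k hk j (Finset.mem_range.mp hj)
    rw [← rD, ← rP, h2, h3, if_pos this.1, if_pos this.2]; push_cast; rfl
  have hmod : y % 2 ^ (c + 1) = if y.testBit c = true then y % 2 ^ c + 2 ^ c else y % 2 ^ c := by
    rw [Nat.mod_pow_succ, Nat.testBit_eq_decide_div_mod_eq]
    rcases Nat.mod_two_eq_zero_or_one (y / 2 ^ c) with h | h <;> simp [h]
  ext ρ
  rw [Pi.add_apply, Pi.add_apply, Pi.add_apply, Pi.add_apply, sum_single_row, sum_single_row,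
    sum_single_row, sum_single_row]
  obtain ⟨t, b, k⟩ := ρ
  simp only [tab]
  by_cases hk : k < l + 1
  swap
  · simp [hk]
  rcases lt_trichotomy b (c + 1) with hb | rfl | hb
  · have e1 : b ≤ c := by omega
    have e2 : b ≤ c + 1 := by omega
    have e3 : b ≠ c + 1 := by omega
    simp [hk, e1, e2, e3]
  · have ht : t = 0 ∨ t = 1 ∨ t = 2 ∨ t = 3 := by revert t; decide
    rcases ht with rfl | rfl | rfl | rfl
    · simp
    · simp
    · simpa [hk] using e1 k hk
    · have := e2 k hk
      have h3' := h3 k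
      simp only [rP, hk, if_true] at h3'
      simp only [show ((3 : Fin 4) = 2) = False by decide, false_and, if_false, true_and, hk,
        and_true, if_true, le_refl, show ¬ (c + 1 ≤ c) by omega, zero_add, this, h3', hmod]
      split_ifs <;> simp
  · have e1 : ¬ b ≤ c := by omega
    have e2 : ¬ b ≤ c + 1 := by omega
    have e3 : b ≠ c + 1 := by omega
    simp [e1, e2, e3]

theorem loop_succ {α : Type*} (n : ℕ) (g : ℕ → List α) :
    loop (n + 1) (fun i _ => g i) = loop n (fun i _ => g i) ++ g n := flatMap_range_succ n g

theorem runD_binTable {w l K : ℕ} (hl : 0 < l) {x : Reg} (hx : x.1 = 1) (hK : K ≤ w) (σ : WState w)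
    (hD : ∀ ρ : Reg, ρ.1 = 2 ∨ ρ.1 = 3 → σ ρ = 0) :
    runD (binTable w l K x) (ket σ) = ket (σ + tab w l (σ x).val K) := by
  -- The row of `2^0 = 1` has ones at positions 0 and 1, and the row of `y % 2^0 = 0` has a one at
  -- position 0. Position 1 lies in the table because `0 < l`.
  have h0 : runD (cadd w [] (rD 0 0) 0 w ++ (cadd w [] (rD 0 1) 0 w ++ cadd w [] (rP 0 0) 0 w))
      (ket σ) = ket (σ + tab w l (σ x).val 0) := by
    have h : ∀ a, AddsOn (w := w) (cadd w [] a 0 w) Set.univ fun σ => Pi.single a 1 := fun a =>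
      (AddsOn.cadd' [] (by omega) (Set.mem_univ a) (by simp)).congr fun σ => by simp
    rw [((h _).append ((h _).append (h _))).run]
    congr 2
    ext ⟨t, b, j⟩
    simp only [Pi.add_apply, Pi.single_apply, rD, rP, Prod.ext_iff, tab]
    fin_cases t
    · simp
    · simp
    · rcases j with _ | _ | j
      · rcases b with _ | b <;> simp
      · rcases b with _ | b <;> simp [hl]
      · rcases b with _ | b <;> simp [Nat.choose_eq_zero_of_lt]
    · rcases j with _ | j
      · rcases b with _ | b <;> simp
      · rcases b with _ | b <;> simp [Nat.mod_one]
  rw [binTable, runD_append, LinearMap.comp_apply, h0]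
  suffices h : ∀ c ≤ K, runD (loop c fun c _ => binStep w l x c) (ket (σ + tab w l (σ x).val 0)) =
      ket (σ + tab w l (σ x).val c) from h K le_rfl
  intro c
  induction c with
  | zero => intro _; rfl
  | succ c ih =>
    intro hc
    rw [loop_succ, runD_append, LinearMap.comp_apply, ih (by omega),
      binStep_value hx (by omega) σ hD rfl]

/-- Compute, use, uncompute: `rM` is not an input of the table, so the table that is erased is the
one that was built. -/
theorem runD_subBin {w l K k : ℕ} (hl : 0 < l) {x : Reg} (hx : x.1 = 1) (hK : K ≤ w) (hk : k ≤ l)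
    (σ : WState w) (hD : ∀ ρ : Reg, ρ.1 = 2 ∨ ρ.1 = 3 → σ ρ = 0) (hy : (σ x).val < 2 ^ K) :
    runD (subBin w l K x k) (ket σ) = ket (σ - Pi.single rM (((σ x).val.choose k : ℕ) : ZMod _)) := by
  have h1 := AddsOn.addW (w := w) [] (A := {rM}) (a := rM) (b := rP K k) rfl (by simp [rM, rP])
    (by simp)
  rw [subBin, runD_append, LinearMap.comp_apply, runD_binTable hl hx hK σ hD]
  refine h1.dinv.step rfl (runD_dinv ?_)
  have hxm : x ≠ rM := fun h => by rw [h] at hx; simp [rM] at hx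
  rw [runD_binTable hl hx hK]
  · congr 1
    have : (σ - Pi.single rM (((σ x).val.choose k : ℕ) : ZMod (2 ^ w)) : WState w) x = σ x := by
      simp [hxm]
    rw [this]
    have h2 : (σ + tab w l (σ x).val K) (rP K k) = ((σ x).val.choose k : ℕ) := by
      rw [Pi.add_apply, hD _ (Or.inr rfl), zero_add]
      have hk' : k < l + 1 := by omega
      simp [tab, rP, hk', Nat.mod_eq_of_lt hy]
    rw [h2, ctrlVal_nil, mul_one]
    abel
  · intro ρ hρ
    have : ρ ≠ rM := by rintro rfl; simp [rM] at hρ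
    simp [hD ρ hρ, this]

/-- Determine bit `b` of the largest number in `x` whose binomial coefficient is at most `rM`. -/
def findBit (w l K : ℕ) (x : Reg) (k b v : ℕ) : List DGate :=
  cadd w [] x b v ++ (subBin w l K x k ++
    (cadd w [wire w rM (w - 1)] rF 0 w ++
    (dinv (subBin w l K x k) ++
    (dinv (cadd w [wire w rF 0] x b v) ++
    (cadd w [wire w x b] rF 0 w ++
      dinv (cadd w [] rF 0 w))))))


theorem cadd_nil_addsOn {w : ℕ} {a : Reg} {e v : ℕ} (h : e + v = w) :
    AddsOn (w := w) (cadd w [] a e v) {a} fun _ => Pi.single a (2 ^ e) :=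
  (AddsOn.cadd' [] h (Set.mem_singleton a) (by simp)).congr fun σ => by simp

theorem cadd_bit_addsOn {w : ℕ} {a r : Reg} {i e v : ℕ} (h : e + v = w) (hr : r ≠ a) (hi : i < w) :
    AddsOn (w := w) (cadd w [wire w r i] a e v) {a} fun σ =>
      Pi.single a (if wbit (σ r) i = true then 2 ^ e else 0) :=
  (AddsOn.cadd' [(r, i)] h (Set.mem_singleton a) (by simpa using ⟨hr, hi⟩)).congr fun σ => by
    rw [ctrlVal_singleton]; split_ifs <;> simp

theorem runD_append_of {C D : List DGate} {φ χ ψ : QState} (h : runD C φ = χ) (h' : runD D χ = ψ) :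
    runD (C ++ D) φ = ψ := by
  rw [runD_append, LinearMap.comp_apply, h, h']

theorem runD_loop {n : ℕ} {g : ℕ → ℕ → List DGate} (ψ : ℕ → QState)
    (h : ∀ i < n, runD (g i (n - 1 - i)) (ψ i) = ψ (i + 1)) : runD (loop n g) (ψ 0) = ψ n := by
  suffices H : ∀ m ≤ n, runD ((List.range m).flatMap fun i => g i (n - 1 - i)) (ψ 0) = ψ m from
    H n le_rfl
  intro m
  induction m with
  | zero => intro _; rfl
  | succ m ih =>
    intro hm
    rw [flatMap_range_succ]
    exact runD_append_of (ih (by omega)) (h m (by omega))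

theorem div_mul_two_pow_succ (y b : ℕ) :
    y / 2 ^ b * 2 ^ b = y / 2 ^ (b + 1) * 2 ^ (b + 1) + if y.testBit b = true then 2 ^ b else 0 := by
  rw [pow_succ, ← Nat.div_div_eq_div_mul, Nat.testBit_eq_decide_div_mod_eq]
  set q := y / 2 ^ b
  have h := Nat.div_add_mod q 2
  rcases Nat.mod_two_eq_zero_or_one q with h0 | h0
  · simp only [h0, zero_ne_one, decide_false, Bool.false_eq_true, if_false, add_zero]
    rw [h0] at h
    conv_lhs => rw [← h]
    ring
  · simp only [h0, decide_true, if_true]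
    rw [h0] at h
    conv_lhs => rw [← h]
    ring

theorem choose_lt_of_lt_two_pow {Y K k l w : ℕ} (hY : Y ≤ 2 ^ K) (hk : k ≤ l) (hw : K * l + 1 < w) :
    Y.choose k < 2 ^ (w - 1) := by
  calc Y.choose k ≤ Y ^ k := Nat.choose_le_pow Y k
    _ ≤ (2 ^ K) ^ k := Nat.pow_le_pow_left hY k
    _ = 2 ^ (K * k) := by rw [pow_mul]
    _ ≤ 2 ^ (K * l) := Nat.pow_le_pow_right (by norm_num) (Nat.mul_le_mul_left _ hk)
    _ < 2 ^ (w - 1) := Nat.pow_lt_pow_right (by norm_num) (by omega)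

/-- `x` holds the bits of `y` above `b`, where `y` is the largest number with `C(y,k) ≤ M`. By
monotonicity of `C(·,k)`, bit `b` of `y` is set iff the trial value `Y + 2^b` has binomial at most
`M`; the sign of `M` minus that binomial goes to the flag. The flag then withdraws a failed trial.
Afterwards it is the complement of the bit that was kept, so adding this bit and subtracting 1
clears it. -/
theorem runD_findBit {w l K k b v : ℕ} (hl : 0 < l) {x : Reg} (hx : x.1 = 1) (hbv : b + v = w)
    (hb : b < K) (hw : K * l + 1 < w) (hk : k ≤ l) (σ : WState w)
    (hD : ∀ ρ : Reg, ρ.1 = 2 ∨ ρ.1 = 3 → σ ρ = 0) (hF : σ rF = 0) {M y : ℕ} (hM : σ rM = M)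
    (hy : y < 2 ^ K) (hlo : y.choose k ≤ M) (hhi : M < (y + 1).choose k)
    (hX : σ x = ((y / 2 ^ (b + 1) * 2 ^ (b + 1) : ℕ) : ZMod (2 ^ w))) :
    runD (findBit w l K x k b v) (ket σ) =
      ket (Function.update σ x ((y / 2 ^ b * 2 ^ b : ℕ) : ZMod (2 ^ w))) := by
  have hKw : K < w := by nlinarith
  have hxm : x ≠ rM := by rintro rfl; simp [rM] at hx
  have hxf : x ≠ rF := by rintro rfl; simp [rF] at hx
  have hmf : rM ≠ rF := by simp [rM, rF]
  set Y := y / 2 ^ (b + 1) * 2 ^ (b + 1) with hYdef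
  have hYle : Y ≤ y := Nat.div_mul_le_self _ _
  have hYlt : y < Y + 2 ^ (b + 1) := Nat.lt_div_mul_add (by positivity)
  have hYK : Y + 2 ^ b < 2 ^ K := by
    have h1 : y / 2 ^ (b + 1) < 2 ^ (K - (b + 1)) := by
      rw [Nat.div_lt_iff_lt_mul (by positivity), ← pow_add]
      rwa [Nat.sub_add_cancel hb]
    have h2 : (y / 2 ^ (b + 1) + 1) * 2 ^ (b + 1) ≤ 2 ^ K := by
      calc _ ≤ 2 ^ (K - (b + 1)) * 2 ^ (b + 1) := Nat.mul_le_mul_right _ h1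
        _ = 2 ^ K := by rw [← pow_add, Nat.sub_add_cancel hb]
    have h3 : 2 ^ (b + 1) = 2 * 2 ^ b := pow_succ' 2 b
    have h4 : 0 < 2 ^ b := by positivity
    rw [add_mul, one_mul] at h2
    omega
  have hyb := div_mul_two_pow_succ y b
  rw [← hYdef] at hyb
  have hpow : 2 ^ K < 2 ^ w := Nat.pow_lt_pow_right (by norm_num) hKw
  have hMw : M < 2 ^ (w - 1) := lt_trans hhi (choose_lt_of_lt_two_pow (by omega) hk hw)
  have hCw : (Y + 2 ^ b).choose k < 2 ^ (w - 1) := choose_lt_of_lt_two_pow hYK.le hk hw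
  have hcmp : (M < (Y + 2 ^ b).choose k) ↔ ¬ y.testBit b = true := by
    constructor
    · intro h hbit
      rw [if_pos hbit] at hyb
      have h1 : Y + 2 ^ b ≤ y := by rw [← hyb]; exact Nat.div_mul_le_self _ _
      exact absurd (lt_of_lt_of_le h (Nat.choose_le_choose k h1)) (not_lt.mpr hlo)
    · intro hbit
      rw [if_neg hbit, add_zero] at hyb
      have h1 : y < Y + 2 ^ b := by rw [← hyb]; exact Nat.lt_div_mul_add (by positivity)
      exact lt_of_lt_of_le hhi (Nat.choose_le_choose k h1)
  set s1 : WState w := σ + Pi.single x (2 ^ b) with hs1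
  have hs1x : s1 x = ((Y + 2 ^ b : ℕ) : ZMod (2 ^ w)) := by simp [hs1, hX]
  have hs1v : (s1 x).val = Y + 2 ^ b := by rw [hs1x, ZMod.val_natCast_of_lt (by omega)]
  have hD1 : ∀ ρ : Reg, ρ.1 = 2 ∨ ρ.1 = 3 → s1 ρ = 0 := by
    intro ρ hρ
    have : ρ ≠ x := by rintro rfl; simp [hx] at hρ
    simp [hs1, this, hD ρ hρ]
  set C := (Y + 2 ^ b).choose k
  set f : ZMod (2 ^ w) := if y.testBit b = true then 0 else 1 with hf
  set s4 : WState w := s1 + Pi.single rF f with hs4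
  have hs4x : s4 x = s1 x := by simp [hs4, hxf]
  have hD4 : ∀ ρ : Reg, ρ.1 = 2 ∨ ρ.1 = 3 → s4 ρ = 0 := by
    intro ρ hρ
    have : ρ ≠ rF := by rintro rfl; simp [rF] at hρ
    simp [hs4, this, hD1 ρ hρ]
  refine (cadd_nil_addsOn hbv).step rfl ?_
  have e2 := runD_subBin hl hx hKw.le hk s1 hD1 (by rw [hs1v]; exact hYK)
  have e4 := runD_subBin hl hx hKw.le hk s4 hD4 (by rw [hs4x, hs1v]; exact hYK)
  rw [hs1v] at e2
  rw [hs4x, hs1v] at e4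
  refine runD_append_of e2 ((cadd_bit_addsOn (by omega) hmf (by omega)).step ?_
    (runD_append_of (runD_dinv e4) ((cadd_bit_addsOn hbv hxf.symm (by omega)).dinv.step rfl
      ((cadd_bit_addsOn (by omega) hxf (by omega)).step rfl ?_))))
  · have h1 : (s1 - Pi.single rM ((C : ℕ) : ZMod (2 ^ w)) : WState w) rM = (M : ZMod (2 ^ w)) - (C : ℕ) := by
      simp [hs1, hxm.symm, hM]
    rw [h1, wbit_sub_top (by omega) hMw hCw, hs4]
    have : (if decide (M < C) = true then (2 : ZMod (2 ^ w)) ^ 0 else 0) = f := by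
      simp only [hf, decide_eq_true_eq]
      by_cases hbit : y.testBit b = true
      · rw [if_pos hbit, if_neg fun h => hcmp.mp h hbit]
      · rw [if_neg hbit, if_pos (hcmp.mpr hbit), pow_zero]
    rw [this]; abel
  · rw [(cadd_nil_addsOn (by omega)).dinv.run]
    congr 1
    have h1 : s4 rF = f := by simp [hs4, hs1, hxf.symm, hF]
    have hwpos : 0 < w := by omega
    rw [h1]
    have h2 : (s4 + -Pi.single x (if wbit f 0 = true then 2 ^ b else 0) : WState w) x =
        ((y / 2 ^ b * 2 ^ b : ℕ) : ZMod (2 ^ w)) := by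
      rw [Pi.add_apply, hs4x, hs1x, hyb, hf]
      by_cases hbit : y.testBit b = true
      · simp [hbit, wbit_zero]
      · simp [hbit, wbit_one hwpos]
    have h3 : wbit (((y / 2 ^ b * 2 ^ b : ℕ) : ZMod (2 ^ w))) b = y.testBit b := by
      have hlt : y / 2 ^ b * 2 ^ b < 2 ^ w :=
        lt_of_le_of_lt (Nat.div_mul_le_self _ _) (hy.trans hpow)
      rw [wbit, ZMod.val_natCast_of_lt hlt]
      simp [Nat.testBit_eq_decide_div_mod_eq]
    ext ρ
    by_cases hρ : ρ = x
    · subst hρ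
      rw [Function.update_self, ← h2]
      simp [hxf]
    · rw [Function.update_of_ne hρ]
      simp only [h2, h3]
      by_cases hρf : ρ = rF
      · subst hρf
        by_cases hbit : y.testBit b = true
        · simp [hs4, hs1, hρ, hbit, hf]
        · simp [hs4, hs1, hρ, hbit, hf]
      · simp [hs4, hs1, hρ, hρf]

/-- Find letter `i` and subtract its contribution to the index. -/
def unrankLetter (w l K r i : ℕ) : List DGate :=
  (loop K fun a b => findBit w l K (rX i) (i + 1) b (a + 1 + r)) ++
    (subBin w l K (rX i) (i + 1) ++ loop i fun _ _ => dinv (cadd w [] (rX i) 0 w))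

/-- The search finds `y + i`, because the combinatorial number system works with the strictly
increasing numbers `xᵢ + i`; `i` unit decrements then leave the letter itself. -/
theorem runD_unrankLetter {w l K r i : ℕ} (hi : i < l) (hr : K + r = w) (hw : K * l + 1 < w)
    (σ : WState w) (hD : ∀ ρ : Reg, ρ.1 = 2 ∨ ρ.1 = 3 → σ ρ = 0) (hF : σ rF = 0) {M y : ℕ}
    (hM : σ rM = M) (hX : σ (rX i) = 0)
    (hy : y + i < 2 ^ K) (hlo : (y + i).choose (i + 1) ≤ M) (hhi : M < (y + i + 1).choose (i + 1)) :
    runD (unrankLetter w l K r i) (ket σ) =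
      ket (σ - Pi.single rM (((y + i).choose (i + 1) : ℕ) : ZMod (2 ^ w)) +
        Pi.single (rX i) (y : ZMod (2 ^ w))) := by
  have hKw : K ≤ w := by omega
  have hxm : rX i ≠ rM := by simp [rX, rM]
  have hxf : rX i ≠ rF := by simp [rX, rF]
  have hl : 0 < l := by omega
  have hpow : 2 ^ K ≤ 2 ^ w := Nat.pow_le_pow_right (by norm_num) hKw
  have h1 : runD (loop K fun a b => findBit w l K (rX i) (i + 1) b (a + 1 + r)) (ket σ) =
      ket (Function.update σ (rX i) ((y + i : ℕ) : ZMod (2 ^ w))) := by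
    have := runD_loop (n := K) (g := fun a b => findBit w l K (rX i) (i + 1) b (a + 1 + r))
      (fun a => ket (Function.update σ (rX i)
        (((y + i) / 2 ^ (K - a) * 2 ^ (K - a) : ℕ) : ZMod (2 ^ w)))) (fun a ha => by
        -- Iteration `a` treats bit `b = K - 1 - a`; the number of register bits from `b` on is `a +
        -- 1 + r`.
        obtain ⟨b, hb⟩ : ∃ b, K - 1 - a = b := ⟨_, rfl⟩
        rw [hb, show K - a = b + 1 by omega, show K - (a + 1) = b by omega]
        rw [runD_findBit (M := M) (y := y + i) hl rfl (by omega) (by omega) hw (by omega) _ _ _ _ hy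
          hlo hhi (by rw [Function.update_self])]
        · rw [Function.update_idem]
        · intro ρ hρ
          rw [Function.update_of_ne (by rintro rfl; simp [rX] at hρ), hD ρ hρ]
        · rw [Function.update_of_ne hxf.symm, hF]
        · rw [Function.update_of_ne hxm.symm, hM])
    simp only [Nat.sub_zero, Nat.sub_self, pow_zero, Nat.div_one, mul_one,
      Nat.div_eq_of_lt hy, zero_mul, Nat.cast_zero] at this
    rw [← this]
    congr 2
    rw [← hX, Function.update_eq_self]
  refine runD_append_of h1 (runD_append_of (runD_subBin hl rfl hKw (by omega) _ ?_ ?_) ?_)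
  · intro ρ hρ
    rw [Function.update_of_ne (by rintro rfl; simp [rX] at hρ), hD ρ hρ]
  · rw [Function.update_self, ZMod.val_natCast_of_lt (by omega)]; exact hy
  · rw [(AddsOn.loop fun j _ => (cadd_nil_addsOn (by omega)).dinv).run]
    congr 1
    rw [Function.update_self, ZMod.val_natCast_of_lt (by omega)]
    ext ρ
    by_cases hρ : ρ = rX i
    · subst hρ; simp [hxm, hX]
    · by_cases hρ2 : ρ = rM
      · subst hρ2; simp [hρ, sub_eq_add_neg]
      · simp [hρ, hρ2]

/-- Convert the index of a type to the sorted word of that type. -/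
def unrank (w l K r : ℕ) : List DGate := loop l fun _ i => unrankLetter w l K r i

/-- The index `M` is in `rM`, and the letters `i, …, l - 1` of `x` are in their registers. -/
def rankState (w M : ℕ) (x : ℕ → ℕ) (i l : ℕ) : WState w := fun ρ =>
  if ρ = rM then (M : ZMod (2 ^ w))
  else if ρ.1 = 1 ∧ ρ.2.1 = 0 ∧ i ≤ ρ.2.2 ∧ ρ.2.2 < l then (x ρ.2.2 : ZMod (2 ^ w)) else 0

/-- The index of the type of a sorted word. -/
def rankOf (x : ℕ → ℕ) (l : ℕ) : ℕ := ∑ i ∈ Finset.range l, (x i + i).choose (i + 1)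

/-- Pascal's rule: by induction the lower terms sum to less than `C(x (i+1) + i + 1, i + 1)`, and
adding `C(x (i+1) + i + 1, i + 2)` stays below the next binomial. -/
theorem rankOf_lt {x : ℕ → ℕ} {i : ℕ} (hx : ∀ a b, a ≤ b → b ≤ i → x a ≤ x b) :
    rankOf x (i + 1) < (x i + i + 1).choose (i + 1) := by
  induction i with
  | zero => simp [rankOf]
  | succ i ih =>
    rw [rankOf, Finset.sum_range_succ, ← rankOf, Nat.choose_succ_succ']
    have h1 := ih fun a b h1 h2 => hx a b h1 (by omega)
    have h2 : (x i + i + 1).choose (i + 1) ≤ (x (i + 1) + (i + 1)).choose (i + 1) :=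
      Nat.choose_le_choose _ (by have := hx i (i + 1) (by omega) le_rfl; omega)
    omega

/-- Greedy decoding. Once the terms above `i` are removed, the residue lies in `[C(xᵢ+i, i+1),
C(xᵢ+i+1, i+1))` by `rankOf_lt`, which is what the search for letter `i` requires. -/
theorem runD_unrank {w l K r : ℕ} (hr : K + r = w) (hw : K * l + 1 < w) {x : ℕ → ℕ}
    (hx : ∀ a b, a ≤ b → b < l → x a ≤ x b) (hK : ∀ i < l, x i + i < 2 ^ K) :
    runD (unrank w l K r) (ket (rankState w (rankOf x l) x l l)) =
      ket (rankState w 0 x 0 l) := by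
  have := runD_loop (n := l) (g := fun _ i => unrankLetter w l K r i)
    (fun a => ket (rankState w (rankOf x (l - a)) x (l - a) l)) (fun a ha => by
      obtain ⟨i, hi⟩ : ∃ i, l - 1 - a = i := ⟨_, rfl⟩
      rw [hi, show l - a = i + 1 by omega, show l - (a + 1) = i by omega]
      rw [runD_unrankLetter (M := rankOf x (i + 1)) (y := x i) (by omega) hr hw]
      · congr 1
        have hxm : rX i ≠ rM := by simp [rX, rM]
        ext ρ
        by_cases h1 : ρ = rM
        · subst h1
          simp [rankState, hxm.symm, rankOf, Finset.sum_range_succ]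
        · by_cases h2 : ρ = rX i
          · subst h2
            simp [rankState, rX, rM, show i < l by omega]
          · simp only [Pi.add_apply, Pi.sub_apply, Pi.single_eq_of_ne h1, Pi.single_eq_of_ne h2,
              sub_zero, add_zero, rankState, if_neg h1]
            congr 1
            obtain ⟨t, c, j⟩ := ρ
            simp only [rX, Prod.ext_iff, not_and] at h2
            apply propext
            constructor
            · rintro ⟨h3, h4, h5, h6⟩; exact ⟨h3, h4, by omega, h6⟩
            · rintro ⟨h3, h4, h5, h6⟩
              have := h2 h3 h4
              exact ⟨h3, h4, by simp only at this h5 ⊢; omega, h6⟩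
      · intro ρ hρ
        have h1 : ρ ≠ rM := by rintro rfl; simp [rM] at hρ
        have h2 : ρ.1 ≠ 1 := by rcases hρ with h | h <;> simp [h]
        simp [rankState, h1, h2]
      · simp [rankState, rF, rM]
      · simp [rankState]
      · simp [rankState, rX, rM]
      · exact hK i (by omega)
      · rw [rankOf, Finset.sum_range_succ]; omega
      · exact rankOf_lt fun a b h1 h2 => hx a b h1 (by omega))
  simpa [rankOf, unrank] using this

end QExpand
namespace QExpand

/-! ## Words of a given type -/

/-- The words with a given multiset of letters. -/
def words (T : Multiset ℕ) : Finset (List ℕ) := T.lists.toFinset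

theorem mem_words {T : Multiset ℕ} {L : List ℕ} : L ∈ words T ↔ (L : Multiset ℕ) = T := by
  rw [words, Multiset.mem_toFinset, Multiset.mem_lists_iff, eq_comm]
  rfl

theorem words_zero : words 0 = {[]} := by
  ext L; rw [mem_words]; simp

theorem coe_append_singleton (L : List ℕ) (a : ℕ) :
    ((L ++ [a] : List ℕ) : Multiset ℕ) = a ::ₘ (L : Multiset ℕ) := by
  rw [Multiset.cons_coe, Multiset.coe_eq_coe]
  exact List.perm_append_singleton a L

/-- Words are split by their last letter; symmetrization builds its superposition along the same
recursion. -/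
theorem sum_words {M : Type*} [AddCommMonoid M] {T : Multiset ℕ} (hT : T ≠ 0) (f : List ℕ → M) :
    ∑ L ∈ words T, f L = ∑ a ∈ T.toFinset, ∑ L ∈ words (T.erase a), f (L ++ [a]) := by
  classical
  rw [Finset.sum_sigma']
  symm
  refine Finset.sum_bij (fun q _ => q.2 ++ [q.1]) ?_ ?_ ?_ ?_
  · rintro ⟨a, L⟩ h
    simp only [Finset.mem_sigma, Multiset.mem_toFinset, mem_words] at h
    rw [mem_words, coe_append_singleton, h.2, Multiset.cons_erase h.1]
  · rintro ⟨a, L⟩ _ ⟨a', L'⟩ _ h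
    obtain ⟨h1, h2⟩ := List.append_inj' h rfl
    simp only [List.cons.injEq, and_true] at h2
    simp only at h1
    rw [h1, h2]
  · intro L hL
    rw [mem_words] at hL
    have hne : L ≠ [] := by rintro rfl; exact hT hL.symm
    refine ⟨⟨L.getLast hne, L.dropLast⟩, ?_, List.dropLast_append_getLast hne⟩
    simp only [Finset.mem_sigma, Multiset.mem_toFinset, mem_words]
    have e : T = L.getLast hne ::ₘ (L.dropLast : Multiset ℕ) := by
      rw [← hL]
      conv_lhs => rw [← List.dropLast_append_getLast hne]
      rw [coe_append_singleton]
    constructor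
    · rw [e]; exact Multiset.mem_cons_self _ _
    · rw [e, Multiset.erase_cons_head]
  · rintro ⟨a, L⟩ _; rfl

/-- Both sides count words of type `T` with a marked occurrence of `a`: remove the marked letter, or
choose it among the `T.count a` occurrences. The proof is an induction on the length that splits off
the last letter. -/
theorem card_words_erase (n : ℕ) (T : Multiset ℕ) (hT : T.card = n) (a : ℕ) (ha : a ∈ T) :
    n * (words (T.erase a)).card = T.count a * (words T).card := by
  have hrec : ∀ T : Multiset ℕ, T ≠ 0 →
      (words T).card = ∑ a ∈ T.toFinset, (words (T.erase a)).card := by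
    intro T hT
    rw [Finset.card_eq_sum_ones, sum_words hT]
    simp
  induction n generalizing T a with
  | zero => simp [Multiset.card_eq_zero.mp hT] at ha
  | succ n ih =>
    have hT0 : T ≠ 0 := by rintro rfl; simp at ha
    have hcard : ∀ b ∈ T, (T.erase b).card = n := fun b hb => by
      rw [Multiset.card_erase_of_mem hb, hT]; rfl
    have h1 : n * (words (T.erase a)).card + (words (T.erase a)).card =
        ∑ b ∈ T.toFinset, T.count a * (words (T.erase b)).card := by
      rcases Nat.eq_zero_or_pos n with rfl | hn
      · obtain ⟨b, rfl⟩ := Multiset.card_eq_one.mp hT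
        rw [Multiset.mem_singleton] at ha
        subst ha
        simp
      have hne : T.erase a ≠ 0 := by
        intro h; have := hcard a ha; rw [h] at this; simp at this; omega
      -- Here `b` is the last letter, and induction is applied to `T - b`. For `b = a` one copy of
      -- `a` is already gone, which produces the extra summand.
      have h3 : ∀ b ∈ T.toFinset, T.count a * (words (T.erase b)).card =
          n * (words ((T.erase a).erase b)).card * (if b ∈ T.erase a then 1 else 0) +
            (if b = a then (words (T.erase a)).card else 0) := by
        intro b hb
        rw [Multiset.mem_toFinset] at hb
        by_cases hba : b = a
        · subst hba
          rw [if_pos rfl]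
          by_cases hmem : b ∈ T.erase b
          · rw [if_pos hmem, mul_one, ih (T.erase b) (hcard b hb) b hmem, Multiset.count_erase_self]
            have : 0 < T.count b := Multiset.count_pos.mpr hb
            obtain ⟨k, hk⟩ := Nat.exists_eq_succ_of_ne_zero this.ne'
            rw [hk]; simp; ring
          · have h4 : (T.erase b).count b = 0 := Multiset.count_eq_zero.mpr hmem
            rw [Multiset.count_erase_self] at h4
            have : 0 < T.count b := Multiset.count_pos.mpr hb
            rw [if_neg hmem, show T.count b = 1 by omega]; simp
        · have hmem : b ∈ T.erase a := (Multiset.mem_erase_of_ne hba).mpr hb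
          have hmem' : a ∈ T.erase b := (Multiset.mem_erase_of_ne (Ne.symm hba)).mpr ha
          rw [if_pos hmem, if_neg hba, mul_one, add_zero, Multiset.erase_comm,
            ih (T.erase b) (hcard b hb) a hmem', Multiset.count_erase_of_ne (Ne.symm hba)]
      rw [Finset.sum_congr rfl h3, Finset.sum_add_distrib]
      congr 1
      · rw [hrec _ hne, Finset.mul_sum]
        have hsub : (T.erase a).toFinset ⊆ T.toFinset :=
          Multiset.toFinset_subset.mpr (Multiset.subset_of_le (Multiset.erase_le a T))
        rw [← Finset.sum_subset hsub]
        · refine Finset.sum_congr rfl fun b hb => ?_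
          rw [if_pos (Multiset.mem_toFinset.mp hb), mul_one]
        · intro b _ hb
          rw [if_neg fun h => hb (Multiset.mem_toFinset.mpr h), mul_zero]
      · rw [Finset.sum_ite_eq' T.toFinset a, if_pos (Multiset.mem_toFinset.mpr ha)]
    rw [hrec T hT0, Finset.mul_sum, ← h1]
    ring

/-! ## Symmetrization -/

def rT : Reg := (0, 0, 2)
def rS : Reg := (0, 0, 3)
def rH : Reg := (0, 0, 4)
def rA (i : ℕ) : Reg := (0, 1, i)

/-- Letters in their registers, and a letter in `rH`. -/
def symState (w : ℕ) (L : List ℕ) (h : ℕ) : WState w := fun ρ =>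
  if ρ.1 = 1 ∧ ρ.2.1 = 0 then (L.getD ρ.2.2 0 : ZMod (2 ^ w)) else if ρ = rH then (h : ZMod (2 ^ w)) else 0

theorem symState_rX (w : ℕ) (L : List ℕ) (h j : ℕ) :
    symState w L h (rX j) = (L.getD j 0 : ZMod (2 ^ w)) := by simp [symState, rX]

theorem symState_rH (w : ℕ) (L : List ℕ) (h : ℕ) : symState w L h rH = (h : ZMod (2 ^ w)) := by
  simp [symState, rH]

theorem symState_rS (w : ℕ) (L : List ℕ) (h : ℕ) : symState w L h rS = 0 := by
  simp [symState, rH, rS]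

/-- Sort `rX j` and `rH`, recording the order in `rS`. -/
def sortPair (w j : ℕ) : List DGate :=
  ltFlag w rS rH (rX j) ++ swapW w [(rS, 0)] rT (rX j) rH

/-- The conditions under which letter `j` may be exchanged with the letter in `rH`. -/
def pairFlags (w j q₁ q₂ q₃ : ℕ) : List DGate :=
  ltFlag w (rA 1) (rX j) rH ++ ((cadd w [] (rA 2) 0 w ++ dinv (ltFlag w (rA 2) rH (rX q₁))) ++
    (ltFlag w (rA 3) rH (rX q₂) ++ (cadd w [] (rA 4) 0 w ++ dinv (ltFlag w (rA 4) (rX q₃) rH))))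

/-- Partial exchange of letter `j` and the letter in `rH`. -/
def partialSwap (w j q₁ q₂ q₃ t u : ℕ) : List DGate :=
  (sortPair w j ++ pairFlags w j q₁ q₂ q₃) ++
    (rotGate w [rA 1, rA 2, rA 3, rA 4] rS t u ++ dinv (sortPair w j ++ pairFlags w j q₁ q₂ q₃))

theorem symState_apply_scalar {w : ℕ} {L : List ℕ} {h : ℕ} {ρ : Reg} (h1 : ρ.1 = 0) (h2 : ρ ≠ rH) :
    symState w L h ρ = 0 := by
  simp [symState, h1, h2]

theorem getD_set (L : List ℕ) {j : ℕ} (hj : j < L.length) (m i : ℕ) :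
    (L.set j m).getD i 0 = if i = j then m else L.getD i 0 := by
  by_cases h : i = j
  · subst h; simp [hj]
  · simp [List.getD_eq_getElem?_getD, h, Ne.symm h]

/-- After sorting, the two arrangements of a pair of distinct letters differ only in `rS`.
Conditions computed from the sorted pair are thus the same for both arrangements. -/
theorem runD_sortPair {w j : ℕ} (hw : 0 < w) {L : List ℕ} {h : ℕ} (hj : j < L.length)
    (hL : L.getD j 0 < 2 ^ (w - 1)) (hh : h < 2 ^ (w - 1)) :
    runD (sortPair w j) (ket (symState w L h)) =
      ket (symState w (L.set j (min (L.getD j 0) h)) (max (L.getD j 0) h) +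
        Pi.single rS (if h < L.getD j 0 then 1 else 0)) := by
  have hHX : rH ≠ rX j := by simp [rH, rX]
  have hHS : rH ≠ rS := by simp [rH, rS]
  have hXS : rX j ≠ rS := by simp [rX, rS]
  have hTX : rT ≠ rX j := by simp [rT, rX]
  have hTH : rT ≠ rH := by simp [rT, rH]
  have hTS : rT ≠ rS := by simp [rT, rS]
  have hSX : rS ≠ rX j := hXS.symm
  have h1 := AddsOn.ltFlag (w := w) hw (A := {rS}) (f := rS) (a := rH) (b := rX j) rfl
    (by simpa using hHS) (by simpa using hXS) hHX
  refine h1.step rfl ?_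
  simp only [symState_rX, symState_rH, wbit_sub_top hw hh hL, decide_eq_true_eq]
  rw [runD_swapW hTX hTH hHX.symm (by simp [hTS.symm, hSX, hHS.symm, hw])]
  · congr 1
    have hb : wbit (((symState w L h + Pi.single rS (if h < L.getD j 0 then 1 else 0) : WState w)) rS) 0
        = decide (h < L.getD j 0) := by
      rw [Pi.add_apply, symState_apply_scalar rfl hHS.symm, Pi.single_eq_same, zero_add]
      split_ifs with h5
      · rw [wbit_one hw, decide_eq_true h5]; rfl
      · rw [wbit_zero, decide_eq_false h5]
    rw [ctrlVal_singleton, hb]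
    ext ρ
    by_cases hρS : ρ = rS
    · subst hρS
      simp only [Pi.add_apply, symState_rS, Pi.single_eq_of_ne hHS.symm, Pi.single_eq_of_ne hSX,
        add_zero]
    by_cases hρH : ρ = rH
    · subst hρH
      simp only [Pi.add_apply, Pi.single_eq_of_ne hHX, Pi.single_eq_of_ne hHS, Pi.single_eq_same,
        Pi.single_eq_of_ne hXS, symState_rH, symState_rX, add_zero, decide_eq_true_eq]
      split_ifs with h5
      · rw [max_eq_left h5.le]; ring
      · rw [max_eq_right (not_lt.mp h5)]; ring
    by_cases hρX : ρ = rX j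
    · subst hρX
      simp only [Pi.add_apply, Pi.single_eq_of_ne hHX.symm, Pi.single_eq_of_ne hHS,
        Pi.single_eq_same, Pi.single_eq_of_ne hXS, symState_rH, symState_rX, add_zero,
        decide_eq_true_eq, getD_set L hj, if_true]
      split_ifs with h5
      · rw [min_eq_right h5.le]; ring
      · rw [min_eq_left (not_lt.mp h5)]; ring
    · simp only [Pi.add_apply, Pi.single_eq_of_ne hρS, Pi.single_eq_of_ne hρH,
        Pi.single_eq_of_ne hρX, add_zero, symState, if_neg hρH]
      split_ifs with h6
      · rw [getD_set L hj, if_neg]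
        intro h7
        apply hρX
        rw [rX]; ext <;> simp [h6, h7]
      · rfl
  · rw [Pi.add_apply, symState_apply_scalar rfl hTH, Pi.single_eq_of_ne hTS, add_zero]

/-- The values of the four flags. -/
def flagVals (w : ℕ) (L : List ℕ) (h j q₁ q₂ q₃ : ℕ) : WState w :=
  Pi.single (rA 1) (if L.getD j 0 < h then 1 else 0) +
    ((Pi.single (rA 2) 1 + -Pi.single (rA 2) (if h < L.getD q₁ 0 then 1 else 0)) +
    (Pi.single (rA 3) (if h < L.getD q₂ 0 then 1 else 0) +
    (Pi.single (rA 4) 1 + -Pi.single (rA 4) (if L.getD q₃ 0 < h then 1 else 0))))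

theorem runD_pairFlags {w j q₁ q₂ q₃ : ℕ} (hw : 0 < w) {L : List ℕ} {h : ℕ}
    (hL : ∀ i, L.getD i 0 < 2 ^ (w - 1)) (hh : h < 2 ^ (w - 1)) (x : ZMod (2 ^ w)) :
    runD (pairFlags w j q₁ q₂ q₃) (ket (symState w L h + Pi.single rS x)) =
      ket (symState w L h + Pi.single rS x + flagVals w L h j q₁ q₂ q₃) := by
  set A : Set Reg := {ρ | ρ.1 = 0 ∧ ρ.2.1 = 1} with hA
  have hf : ∀ i, rA i ∈ A := fun i => by simp [hA, rA]
  have hX : ∀ i, rX i ∉ A := fun i => by simp [hA, rX]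
  have hH : rH ∉ A := by simp [hA, rH]
  have hHX : ∀ i, rH ≠ rX i := fun i => by simp [rH, rX]
  have hc : ∀ i, AddsOn (w := w) (cadd w [] (rA i) 0 w) A fun _ => Pi.single (rA i) 1 := fun i =>
    (AddsOn.cadd' [] (by omega) (hf i) (by simp)).congr fun σ => by simp
  rw [pairFlags, ((AddsOn.ltFlag hw (hf 1) (hX j) hH (hHX j).symm).append
    (((hc 2).append (AddsOn.ltFlag hw (hf 2) hH (hX q₁) (hHX q₁)).dinv).append
    ((AddsOn.ltFlag hw (hf 3) hH (hX q₂) (hHX q₂)).append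
    ((hc 4).append (AddsOn.ltFlag hw (hf 4) (hX q₃) hH (hHX q₃).symm).dinv)))).run]
  congr 2
  have e1 : ∀ i, (symState w L h + Pi.single rS x : WState w) (rX i) = (L.getD i 0 : ZMod (2 ^ w)) := by
    intro i; rw [Pi.add_apply, symState_rX, Pi.single_eq_of_ne (by simp [rX, rS]), add_zero]
  have e2 : (symState w L h + Pi.single rS x : WState w) rH = (h : ZMod (2 ^ w)) := by
    rw [Pi.add_apply, symState_rH, Pi.single_eq_of_ne (by simp [rH, rS]), add_zero]
  simp only [e1, e2, wbit_sub_top hw (hL _) hh, wbit_sub_top hw hh (hL _), decide_eq_true_eq,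
    flagVals]

/-- All four conditions hold. -/
def flagsOk (L : List ℕ) (h j q₁ q₂ q₃ : ℕ) : Prop :=
  L.getD j 0 < h ∧ ¬ h < L.getD q₁ 0 ∧ h < L.getD q₂ 0 ∧ ¬ L.getD q₃ 0 < h

theorem wbit_flags {w : ℕ} (hw : 0 < w) (L : List ℕ) (h j q₁ q₂ q₃ : ℕ) (x : ZMod (2 ^ w)) :
    (∀ ρ ∈ [rA 1, rA 2, rA 3, rA 4], wbit ((symState w L h + Pi.single rS x +
      flagVals w L h j q₁ q₂ q₃ : WState w) ρ) 0 = true) ↔ flagsOk L h j q₁ q₂ q₃ := by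
  have e0 : ∀ i, (symState w L h + Pi.single rS x : WState w) (rA i) = 0 := by
    intro i
    rw [Pi.add_apply, symState_apply_scalar rfl (by simp [rA, rH]),
      Pi.single_eq_of_ne (by simp [rA, rS]), add_zero]
  have b : ∀ (P : Prop) [Decidable P], wbit (if P then 1 else 0 : ZMod (2 ^ w)) 0 = true ↔ P := by
    intro P _; split_ifs with hP <;> simp [hP, wbit_one hw, wbit_zero]
  have b' : ∀ (P : Prop) [Decidable P], wbit (1 + -(if P then 1 else 0) : ZMod (2 ^ w)) 0 = true ↔ ¬ P := by
    intro P _; split_ifs with hP <;> simp [hP, wbit_one hw, wbit_zero]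
  have n : ∀ i k, i ≠ k → rA i ≠ rA k := by intro i k hik; simpa [rA] using hik
  simp only [List.forall_mem_cons, List.not_mem_nil, false_imp_iff, implies_true, and_true,
    Pi.add_apply (symState w L h + Pi.single rS x : WState w), e0, zero_add]
  simp only [flagVals, Pi.add_apply, Pi.neg_apply, Pi.single_eq_same, Pi.single_apply,
    n 1 2 (by omega), n 1 3 (by omega), n 1 4 (by omega), n 2 1 (by omega), n 2 3 (by omega),
    n 2 4 (by omega), n 3 1 (by omega), n 3 2 (by omega), n 3 4 (by omega), n 4 1 (by omega),
    n 4 2 (by omega), n 4 3 (by omega), if_false, if_true, add_zero, zero_add, neg_zero, b, b',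
    flagsOk]

/-- The circuit is a conjugation: sorting sends the two arrangements to the states `rS = 0` and `rS
= 1` over the same contents, so a rotation of `rS` becomes a rotation in the plane of the two
arrangements. Only the image of the arrangement with `rS = 0` is ever needed. -/
theorem runD_partialSwap {w j q₁ q₂ q₃ t u : ℕ} (hw : 0 < w) {L : List ℕ} {h : ℕ}
    (hj : j < L.length) (hL : ∀ i, L.getD i 0 < 2 ^ (w - 1)) (hh : h < 2 ^ (w - 1)) :
    (¬ flagsOk (L.set j (min (L.getD j 0) h)) (max (L.getD j 0) h) j q₁ q₂ q₃ →
      runD (partialSwap w j q₁ q₂ q₃ t u) (ket (symState w L h)) = ket (symState w L h)) ∧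
    (flagsOk (L.set j (min (L.getD j 0) h)) (max (L.getD j 0) h) j q₁ q₂ q₃ → L.getD j 0 < h →
      runD (partialSwap w j q₁ q₂ q₃ t u) (ket (symState w L h)) =
        (Real.sqrt ((t : ℝ) / ((t : ℝ) + (u : ℝ))) : ℂ) • ket (symState w L h) +
        (Real.sqrt (1 - (t : ℝ) / ((t : ℝ) + (u : ℝ))) : ℂ) •
          ket (symState w (L.set j h) (L.getD j 0))) := by
  have hS : rS ∉ [rA 1, rA 2, rA 3, rA 4] := by simp [rS, rA]
  have hK : ∀ (L : List ℕ) (h : ℕ), j < L.length → (∀ i, L.getD i 0 < 2 ^ (w - 1)) →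
      h < 2 ^ (w - 1) → runD (sortPair w j ++ pairFlags w j q₁ q₂ q₃) (ket (symState w L h)) =
      ket (symState w (L.set j (min (L.getD j 0) h)) (max (L.getD j 0) h) +
        Pi.single rS (if h < L.getD j 0 then 1 else 0) +
        flagVals w (L.set j (min (L.getD j 0) h)) (max (L.getD j 0) h) j q₁ q₂ q₃) := by
    intro L h hj hL hh
    refine runD_append_of (runD_sortPair hw hj (hL j) hh) (runD_pairFlags hw ?_ ?_ _)
    · intro i
      rw [getD_set L hj]
      split_ifs
      · exact lt_of_le_of_lt (min_le_right _ _) hh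
      · exact hL i
    · exact max_lt (hL j) hh
  constructor
  · intro hok
    refine runD_append_of (hK L h hj hL hh) (runD_append_of
      (runD_rotGate_of_not hw hS t u _ ?_) (runD_dinv (hK L h hj hL hh)))
    rwa [wbit_flags hw]
  · intro hok hlt
    have hK1 := hK L h hj hL hh
    -- The exchanged arrangement runs forward to the same sorted state, with `rS = 1`; undoing this
    -- run identifies the second branch.
    have hK2 := hK (L.set j h) (L.getD j 0) (by simpa using hj) (fun i => by
      rw [getD_set L hj]; split_ifs; exacts [hh, hL i]) (hL j)
    rw [getD_set L hj, if_pos rfl, if_pos hlt, List.set_set, min_comm, max_comm] at hK2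
    rw [if_neg (not_lt.mpr hlt.le)] at hK1
    refine runD_append_of hK1 ?_
    rw [runD_append, LinearMap.comp_apply, runD_rotGate hw]
    · rw [map_add, map_smul, map_smul, runD_dinv hK1]
      congr 2
      apply runD_dinv
      rw [hK2]
      congr 1
      ext ρ
      by_cases hρ : ρ = rS
      · subst hρ
        rw [Function.update_self, Pi.add_apply, Pi.add_apply, symState_rS]
        simp [rS, flagVals, rA]
      · rw [Function.update_of_ne hρ]
        simp [hρ]
    · rw [Pi.add_apply, Pi.add_apply, symState_rS]
      simp [rS, flagVals, rA]
    · rwa [wbit_flags hw]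


/-- All partial exchanges of letter `j` when the current block of letters has `c` letters left. -/
def swapStage (w c j : ℕ) : List DGate :=
  loop (c - j) fun t _ => partialSwap w j (j + t) (j + t + 1) (j + 1) (t + 1) (j + 1)

theorem runD_loop_of_id {n : ℕ} {g : ℕ → ℕ → List DGate} {ψ : QState}
    (h : ∀ i < n, runD (g i (n - 1 - i)) ψ = ψ) : runD (loop n g) ψ = ψ :=
  runD_loop (fun _ => ψ) h

theorem swapStage_of_eq {w c j : ℕ} (hw : 0 < w) {L : List ℕ} {h : ℕ}
    (hj : j < L.length) (hL : ∀ i, L.getD i 0 < 2 ^ (w - 1)) (hh : h < 2 ^ (w - 1))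
    (he : L.getD j 0 = h) :
    runD (swapStage w c j) (ket (symState w L h)) = ket (symState w L h) := by
  refine runD_loop_of_id fun t _ => (runD_partialSwap hw hj hL hh).1 fun hok => ?_
  have := hok.1
  rw [getD_set L hj, if_pos rfl, he] at this
  simp at this

/-- A branch that has kept the letter in `rH` at stage `j + 1` leaves a smaller letter at position
`j + 1`. The fourth flag detects this and freezes the branch. -/
theorem swapStage_of_lt {w c j : ℕ} (hw : 0 < w) {L : List ℕ} {h : ℕ}
    (hj : j < L.length) (hL : ∀ i, L.getD i 0 < 2 ^ (w - 1)) (hh : h < 2 ^ (w - 1))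
    (he : L.getD (j + 1) 0 < h) :
    runD (swapStage w c j) (ket (symState w L h)) = ket (symState w L h) := by
  refine runD_loop_of_id fun t _ => (runD_partialSwap hw hj hL hh).1 fun hok => ?_
  refine hok.2.2.2 ?_
  rw [getD_set L hj, if_neg (by omega)]
  exact lt_of_lt_of_le he (le_max_right _ _)

theorem getD_append_replicate (r : List ℕ) (b h k : ℕ) (r' v : List ℕ) (i : ℕ) :
    (r ++ b :: (List.replicate k h ++ (r' ++ v))).getD (r.length + 1 + i) 0 =
      if i < k then h else (r' ++ v).getD (i - k) 0 := by
  rw [List.getD_append_right _ _ _ _ (by omega), show r.length + 1 + i - r.length = i + 1 by omega,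
    List.getD_cons_succ]
  split_ifs with hi
  · rw [List.getD_append _ _ _ _ (by simpa using hi)]
    simp [hi]
  · rw [List.getD_append_right _ _ _ _ (by simpa using hi)]
    simp

/-- There are `k + 1` copies of `h` (one in `rH`, `k` right of position `j`) and `j + 1` smaller
letters, so `h` is kept with probability `(k+1)/((k+1)+(j+1))`. The angle of a described gate is a
constant, so the loop variable `t` guesses `k`: the flags compare `h` with positions `j + t` and `j
+ t + 1` and hold only for the correct guess. -/
theorem swapStage_live {w : ℕ} (hw : 0 < w) {r r' v : List ℕ} {b h k S : ℕ}
    (hL : ∀ i, (r ++ b :: (List.replicate k h ++ (r' ++ S :: v))).getD i 0 < 2 ^ (w - 1))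
    (hh : h < 2 ^ (w - 1)) (hb : b < h) (hr' : ∀ y ∈ r', h < y) (hS : h < S) :
    runD (swapStage w (r.length + 1 + k + r'.length) r.length)
        (ket (symState w (r ++ b :: (List.replicate k h ++ (r' ++ S :: v))) h)) =
      (Real.sqrt (((k + 1 : ℕ) : ℝ) / (((k + 1 : ℕ) : ℝ) + ((r.length + 1 : ℕ) : ℝ))) : ℂ) •
        ket (symState w (r ++ b :: (List.replicate k h ++ (r' ++ S :: v))) h) +
      (Real.sqrt (1 - ((k + 1 : ℕ) : ℝ) / (((k + 1 : ℕ) : ℝ) + ((r.length + 1 : ℕ) : ℝ))) : ℂ) •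
        ket (symState w (r ++ h :: (List.replicate k h ++ (r' ++ S :: v))) b) := by
  set j := r.length with hjdef
  set L := r ++ b :: (List.replicate k h ++ (r' ++ S :: v)) with hLdef
  have hj : j < L.length := by simp [hLdef, hjdef]
  have hLj : L.getD j 0 = b := by simp [hLdef, hjdef]
  have hset : ∀ x, L.set j x = r ++ x :: (List.replicate k h ++ (r' ++ S :: v)) := by
    intro x; simp [hLdef, hjdef]
  have hmore : ∀ i, i ≤ r'.length → h < (r' ++ S :: v).getD i 0 := by
    intro i hi
    rcases Nat.lt_or_eq_of_le hi with h1 | h1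
    · rw [List.getD_append _ _ _ _ h1, List.getD_eq_getElem _ _ h1]
      exact hr' _ (List.getElem_mem h1)
    · rw [List.getD_append_right _ _ _ _ (by omega)]
      simpa [h1] using hS
  have hnext : ∀ x i, (L.set j x).getD (j + 1 + i) 0 =
      if i < k then h else (r' ++ S :: v).getD (i - k) 0 := by
    intro x i; rw [hset]; exact getD_append_replicate _ _ _ _ _ _ _
  have hself : ∀ x, (L.set j x).getD j 0 = x := by intro x; rw [getD_set L hj, if_pos rfl]
  -- the conditions hold exactly for `t = k`
  have hok : ∀ t, t ≤ k + r'.length →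
      (flagsOk (L.set j b) h j (j + t) (j + t + 1) (j + 1) ↔ t = k) := by
    intro t ht
    rw [flagsOk, hself, show j + t + 1 = j + 1 + t by ring, hnext, show j + 1 = j + 1 + 0 by ring,
      hnext]
    constructor
    · rintro ⟨-, h2, h3, -⟩
      by_contra hne
      rcases lt_or_gt_of_ne hne with h4 | h4
      · rw [if_pos h4] at h3; exact lt_irrefl _ h3
      · obtain ⟨s, rfl⟩ := Nat.exists_eq_add_of_lt h4
        apply h2
        rw [show j + (k + s + 1) = j + 1 + (k + s) by ring, hnext, if_neg (by omega)]
        exact hmore _ (by omega)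
    · rintro rfl
      refine ⟨hb, ?_, ?_, ?_⟩
      -- For `t = 0` position `j + t` is `j` itself, which holds the smaller letter of the sorted
      -- pair; otherwise it holds a copy of `h`.
      · cases t with
        | zero => rw [add_zero, hself]; omega
        | succ t =>
          rw [show j + (t + 1) = j + 1 + t by ring, hnext, if_pos (by omega)]; omega
      · rw [if_neg (lt_irrefl _)]; exact hmore _ (by omega)
      · split_ifs with h5
        · omega
        · exact not_lt.mpr (hmore _ (by omega)).le
  have hLs : ∀ i, (L.set j h).getD i 0 < 2 ^ (w - 1) := by
    intro i; rw [getD_set L hj]; split_ifs; exacts [hh, hL i]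
  have hbw : b < 2 ^ (w - 1) := by rw [← hLj]; exact hL j
  have hid1 : ∀ t, t ≤ k + r'.length → t ≠ k →
      runD (partialSwap w j (j + t) (j + t + 1) (j + 1) (t + 1) (j + 1)) (ket (symState w L h)) =
        ket (symState w L h) := by
    intro t ht hne
    refine (runD_partialSwap hw hj hL hh).1 ?_
    rw [hLj, min_eq_left hb.le, max_eq_right hb.le, hok t ht]; exact hne
  -- The exchanged arrangement sorts to the same pair, so its flags also hold for `t = k` only and
  -- the later iterations do not disturb it.
  have hid2 : ∀ t, t ≤ k + r'.length → t ≠ k →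
      runD (partialSwap w j (j + t) (j + t + 1) (j + 1) (t + 1) (j + 1))
        (ket (symState w (L.set j h) b)) = ket (symState w (L.set j h) b) := by
    intro t ht hne
    refine (runD_partialSwap hw (by simpa using hj) hLs hbw).1 ?_
    rw [hself, min_eq_right hb.le, max_eq_left hb.le, List.set_set, hok t ht]; exact hne
  have hk := (runD_partialSwap (q₁ := j + k) (q₂ := j + k + 1) (q₃ := j + 1) (t := k + 1)
    (u := j + 1) hw hj hL hh).2
    (by rw [hLj, min_eq_left hb.le, max_eq_right hb.le, hok k (by omega)]) (by rw [hLj]; exact hb)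
  rw [hLj] at hk
  rw [← hset h]
  set φ := (Real.sqrt (((k + 1 : ℕ) : ℝ) / (((k + 1 : ℕ) : ℝ) + ((j + 1 : ℕ) : ℝ))) : ℂ) •
        ket (symState w L h) +
      (Real.sqrt (1 - ((k + 1 : ℕ) : ℝ) / (((k + 1 : ℕ) : ℝ) + ((j + 1 : ℕ) : ℝ))) : ℂ) •
        ket (symState w (L.set j h) b) with hφ
  have := runD_loop (n := j + 1 + k + r'.length - j)
    (g := fun t _ => partialSwap w j (j + t) (j + t + 1) (j + 1) (t + 1) (j + 1))
    (fun t => if t ≤ k then ket (symState w L h) else φ) (fun t ht => by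
      rcases lt_trichotomy t k with h1 | h1 | h1
      · rw [if_pos h1.le, if_pos (by omega), hid1 t (by omega) (by omega)]
      · subst h1
        rw [if_pos le_rfl, if_neg (by omega), hk]
      · rw [if_neg (by omega), if_neg (by omega), hφ, map_add, map_smul, map_smul,
          hid1 t (by omega) (by omega), hid2 t (by omega) (by omega)])
  rw [if_pos (Nat.zero_le _), if_neg (by omega)] at this
  exact this

/-- The stages `j - 1, …, 0`. -/
def swapStages (w c : ℕ) : ℕ → List DGate
  | 0 => []
  | j + 1 => swapStage w c j ++ swapStages w c j

theorem swapStages_dead {w c : ℕ} (hw : 0 < w) {L : List ℕ} {h : ℕ}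
    (hL : ∀ i, L.getD i 0 < 2 ^ (w - 1)) (hh : h < 2 ^ (w - 1)) (j : ℕ) (hj : j ≤ L.length)
    (hd : ∀ i < j, L.getD (i + 1) 0 < h) :
    runD (swapStages w c j) (ket (symState w L h)) = ket (symState w L h) := by
  induction j with
  | zero => rfl
  | succ j ih =>
    exact runD_append_of (swapStage_of_lt hw hj hL hh (hd j (by omega)))
      (ih (by omega) fun i hi => hd i (by omega))

theorem sorted_split {h : ℕ} {r : List ℕ} (hs : (h :: r).Pairwise (· ≤ ·)) :
    ∃ r', r = List.replicate (r.count h) h ++ r' ∧ ∀ y ∈ r', h < y := by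
  induction r with
  | nil => exact ⟨[], by simp, by simp⟩
  | cons b r ih =>
    rw [List.pairwise_cons] at hs
    have hb : h ≤ b := hs.1 b (by simp)
    rcases Nat.lt_or_eq_of_le hb with h1 | h1
    · refine ⟨b :: r, ?_, ?_⟩
      · have : (b :: r).count h = 0 := by
          rw [List.count_eq_zero]
          intro hmem
          rcases List.mem_cons.mp hmem with h2 | h2
          · omega
          · have := (List.pairwise_cons.mp hs.2).1 h h2; omega
        rw [this]; rfl
      · intro y hy
        rcases List.mem_cons.mp hy with rfl | h2
        · exact h1
        · exact lt_of_lt_of_le h1 ((List.pairwise_cons.mp hs.2).1 y h2)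
    · subst h1
      obtain ⟨r', h2, h3⟩ := ih hs.2
      refine ⟨r', ?_, h3⟩
      rw [List.count_cons_self, List.replicate_succ, List.cons_append, ← h2]

theorem getD_lt_of_forall {L : List ℕ} {B : ℕ} (hB : 0 < B) (h : ∀ y ∈ L, y < B) (i : ℕ) :
    L.getD i 0 < B := by
  rcases lt_or_ge i L.length with h1 | h1
  · rw [List.getD_eq_getElem _ _ h1]; exact h _ (List.getElem_mem h1)
  · rw [List.getD_eq_default _ _ h1]; exact hB

/-- `r₁` are the letters still to be met, `h` is in `rH`, and `r₂` are the letters already passed.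
All candidates left are the copies of `h` and the members of `r₁`, whose number is the denominator.
The sentinel `S`, larger than every letter, ends the run of equal letters in the comparisons. -/
theorem runD_swapStages {w : ℕ} (hw : 0 < w) {S : ℕ} {v : List ℕ} (c : ℕ) (r₁ : List ℕ) :
    ∀ (r₂ : List ℕ) (h : ℕ), c = r₁.length + r₂.length →
      (r₁ ++ h :: r₂).Pairwise (· ≤ ·) → (∀ y ∈ r₁ ++ h :: r₂, y < S) →
      (∀ y ∈ S :: v, y < 2 ^ (w - 1)) →
      runD (swapStages w c r₁.length) (ket (symState w (r₁ ++ (r₂ ++ S :: v)) h)) =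
        ∑ a ∈ (h :: r₁).toFinset,
          (Real.sqrt (((r₁ ++ h :: r₂).count a : ℝ) / ((r₂.count h + 1 + r₁.length : ℕ) : ℝ)) : ℂ) •
            ket (symState w ((r₁ ++ h :: r₂).erase a ++ S :: v) a) := by
  induction r₁ using List.reverseRecOn with
  | nil =>
    intro r₂ h hc hs hS hv
    have hne : ((r₂.count h : ℝ) + 1) ≠ 0 := by positivity
    simp only [List.nil_append, List.length_nil, swapStages, runD, LinearMap.id_apply,
      List.toFinset_cons, List.toFinset_nil, insert_empty_eq, Finset.sum_singleton,
      List.count_cons_self, List.erase_cons_head, add_zero]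
    push_cast
    rw [div_self hne, Real.sqrt_one, Complex.ofReal_one, one_smul]
  | append_singleton r₁ b ih =>
    intro r₂ h hc hs hS hv
    have hSw : S < 2 ^ (w - 1) := hv S (by simp)
    have hlen : (r₁ ++ [b]).length = r₁.length + 1 := by simp
    have hhS : h < S := hS h (by simp)
    have hall : ∀ y ∈ (r₁ ++ [b]) ++ (r₂ ++ S :: v), y < 2 ^ (w - 1) := by
      intro y hy
      rcases List.mem_append.mp hy with h1 | h1
      · exact (hS y (List.mem_append_left _ h1)).trans hSw
      rcases List.mem_append.mp h1 with h1 | h1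
      · exact (hS y (List.mem_append_right _ (List.mem_cons_of_mem _ h1))).trans hSw
      · exact hv y h1
    have hpos : 0 < 2 ^ (w - 1) := by positivity
    have hL := getD_lt_of_forall hpos hall
    have hs' := hs
    rw [List.append_assoc] at hs
    obtain ⟨hs1, hs2, hs3⟩ := List.pairwise_append.mp hs
    rw [List.singleton_append, List.pairwise_cons] at hs2
    have hbh : b ≤ h := hs2.1 h (by simp)
    rw [hlen, swapStages, runD_append, LinearMap.comp_apply]
    rcases Nat.lt_or_eq_of_le hbh with hlt | rfl
    · obtain ⟨r', hr', hr'2⟩ := sorted_split hs2.2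
      set k := r₂.count h with hk
      have hform : (r₁ ++ [b]) ++ (r₂ ++ S :: v) =
          r₁ ++ b :: (List.replicate k h ++ (r' ++ S :: v)) := by
        conv_lhs => rw [hr']
        simp
      have hc' : c = r₁.length + 1 + k + r'.length := by
        have : r₂.length = k + r'.length := by
          conv_lhs => rw [hr']
          simp
        rw [hc, hlen, this]; ring
      rw [hform] at hL ⊢
      have hle : ∀ y ∈ r₁ ++ [b], y < h := by
        intro y hy
        rw [List.mem_append] at hy
        rcases hy with h1 | h1
        · exact lt_of_le_of_lt (hs3 y h1 b (by simp)) hlt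
        · rw [List.mem_singleton] at h1; omega
      have hnot : h ∉ r₁ ++ [b] := fun hm => lt_irrefl _ (hle h hm)
      rw [hc', swapStage_live hw hL (hhS.trans hSw) hlt hr'2 hhS, ← hc', map_add, map_smul,
        map_smul]
      have hdead : runD (swapStages w c r₁.length)
          (ket (symState w (r₁ ++ b :: (List.replicate k h ++ (r' ++ S :: v))) h)) =
          ket (symState w (r₁ ++ b :: (List.replicate k h ++ (r' ++ S :: v))) h) := by
        refine swapStages_dead hw hL (hhS.trans hSw) _ (by simp) fun i hi => ?_
        rw [show r₁ ++ b :: (List.replicate k h ++ (r' ++ S :: v)) = (r₁ ++ [b]) ++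
          (List.replicate k h ++ (r' ++ S :: v)) by simp,
          List.getD_append _ _ _ _ (by simp; omega), List.getD_eq_getElem _ _ (by simp; omega)]
        exact hle _ (List.getElem_mem _)
      have hperm : (r₁ ++ [b]) ++ h :: r₂ = r₁ ++ b :: h :: r₂ := by simp
      have hcount0 : (h :: r₂).count b = 0 := by
        rw [List.count_eq_zero]
        intro hm
        rcases List.mem_cons.mp hm with h1 | h1
        · omega
        · have := (List.pairwise_cons.mp hs2.2).1 b h1; omega
      -- In the exchanged branch `b` is in `rH` and `h` has joined the passed letters; no passed
      -- letter equals `b`, since `b < h`.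
      have hih := ih (h :: r₂) b (by simp only [hc, hlen, List.length_cons]; omega) (by rw [← hperm]; exact hs')
        (by rw [← hperm]; exact hS) hv
      have hform2 : r₁ ++ h :: (List.replicate k h ++ (r' ++ S :: v)) =
          r₁ ++ ((h :: r₂) ++ S :: v) := by
        conv_rhs => rw [hr']
        simp
      rw [hdead, hform2, hih, hcount0, ← hform]
      have hset : (h :: (r₁ ++ [b])).toFinset = insert h (b :: r₁).toFinset := by
        ext y; simp
      rw [hset, Finset.sum_insert (by
        rw [List.mem_toFinset]
        intro hm; apply hnot; simp at hm ⊢; tauto), hperm]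
      congr 1
      · have h1 : (r₁ ++ b :: h :: r₂).count h = k + 1 := by
          rw [← hperm, List.count_append, List.count_eq_zero.mpr hnot, List.count_cons_self]; omega
        have h2 : (r₁ ++ b :: h :: r₂).erase h = (r₁ ++ [b]) ++ r₂ := by
          rw [← hperm, List.erase_append_right _ hnot, List.erase_cons_head]
        rw [h1, h2, List.append_assoc (r₁ ++ [b])]
        congr 4
        push_cast; ring
      · rw [Finset.smul_sum]
        refine Finset.sum_congr rfl fun a _ => ?_
        -- The probabilities telescope: moving on from `h` has probability `(|r₁|+1)/(k+1+|r₁|+1)`,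
        -- and the numerator cancels the denominator of the induction hypothesis.
        rw [smul_smul, ← Complex.ofReal_mul, ← Real.sqrt_mul]
        · congr 3
          have h1 : ((k : ℝ) + 1 + ((r₁.length : ℝ) + 1)) ≠ 0 := by positivity
          have h2 : ((r₁.length : ℝ) + 1) ≠ 0 := by positivity
          have h3 : (1 + (r₁.length : ℝ)) ≠ 0 := by positivity
          push_cast
          field_simp
          ring
        · have : ((k + 1 : ℕ) : ℝ) / (((k + 1 : ℕ) : ℝ) + ((r₁.length + 1 : ℕ) : ℝ)) ≤ 1 := by
            apply div_le_one_of_le₀ _ (by positivity)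
            have : (0 : ℝ) ≤ ((r₁.length + 1 : ℕ) : ℝ) := by positivity
            linarith
          linarith
    -- If the letter met equals the one in `rH`, nothing happens; the same state is reread with one
    -- more copy among the passed letters.
    · rw [swapStage_of_eq hw (by simp) hL (hhS.trans hSw) (by simp)]
      have hperm : (r₁ ++ [b]) ++ b :: r₂ = r₁ ++ b :: b :: r₂ := by simp
      have hih := ih (b :: r₂) b (by simp only [hc, hlen, List.length_cons]; omega)
        (by rw [← hperm]; exact hs') (by rw [← hperm]; exact hS) hv
      rw [show (r₁ ++ [b]) ++ (r₂ ++ S :: v) = r₁ ++ ((b :: r₂) ++ S :: v) by simp, hih, hperm]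
      have hset : (b :: (r₁ ++ [b])).toFinset = (b :: r₁).toFinset := by
        ext y; simp
      rw [hset, List.count_cons_self, show r₂.count b + 1 + 1 + r₁.length =
        r₂.count b + 1 + (r₁.length + 1) by ring]

theorem loop_desc_succ {α : Type*} (n : ℕ) (f : ℕ → List α) :
    loop (n + 1) (fun _ c => f c) = f n ++ loop n fun _ c => f c := by
  rw [loop, List.range_succ_eq_map, List.flatMap_cons, List.flatMap_map]
  simp only [Nat.add_sub_cancel, Nat.sub_zero, loop]
  congr 1
  refine List.flatMap_congr fun i _ => ?_
  congr 1; omega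

theorem loop_congr {α : Type*} {n : ℕ} {g g' : ℕ → ℕ → List α}
    (h : ∀ i < n, g i (n - 1 - i) = g' i (n - 1 - i)) : loop n g = loop n g' :=
  List.flatMap_congr fun i hi => h i (List.mem_range.mp hi)

theorem swapStages_eq_loop (w c j : ℕ) :
    swapStages w c j = loop j fun _ k => swapStage w c k := by
  induction j with
  | zero => rfl
  | succ j ih => rw [swapStages, ih, loop_desc_succ]

/-- Distributes the last of the letters `0, …, c` evenly. -/
def symStage (w c : ℕ) : List DGate :=
  swapW w [] rT (rX c) rH ++ (loop c (fun i j => loop (i + 1) fun t _ =>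
    partialSwap w j (j + t) (j + t + 1) (j + 1) (t + 1) (j + 1)) ++ swapW w [] rT (rX c) rH)

theorem symStage_eq (w c : ℕ) : symStage w c =
    swapW w [] rT (rX c) rH ++ (swapStages w c c ++ swapW w [] rT (rX c) rH) := by
  rw [symStage, swapStages_eq_loop]
  congr 2
  refine loop_congr fun i hi => ?_
  rw [swapStage]
  congr 1
  omega

/-- Sends a sorted word to the uniform superposition of its permutations. -/
def symmetrize (w l K r : ℕ) : List DGate :=
  cadd w [] rH K r ++ (loop l (fun _ c => symStage w c) ++ dinv (cadd w [] rH K r))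

theorem runD_swap_symState {w : ℕ} (L v : List ℕ) (a h : ℕ) :
    runD (swapW w [] rT (rX L.length) rH) (ket (symState w (L ++ a :: v) h)) =
      ket (symState w (L ++ h :: v) a) := by
  have hHX : rH ≠ rX L.length := by simp [rH, rX]
  rw [runD_swapW (by simp [rT, rX]) (by simp [rT, rH]) hHX.symm (by simp) _
    (symState_apply_scalar rfl (by simp [rT, rH]))]
  congr 1
  have e : ∀ x, (L ++ x :: v).getD L.length 0 = x := by intro x; simp
  ext ρ
  by_cases hρH : ρ = rH
  · subst hρH
    simp only [Pi.add_apply, Pi.single_eq_of_ne hHX, Pi.single_eq_same, symState_rH, symState_rX,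
      ctrlVal_nil, e]
    ring
  by_cases hρX : ρ = rX L.length
  · subst hρX
    simp only [Pi.add_apply, Pi.single_eq_of_ne hHX.symm, Pi.single_eq_same, symState_rH,
      symState_rX, ctrlVal_nil, e]
    ring
  · simp only [Pi.add_apply, Pi.single_eq_of_ne hρH, Pi.single_eq_of_ne hρX, add_zero, symState,
      if_neg hρH]
    split_ifs with h6
    · have h7 : ρ.2.2 ≠ L.length := by
        intro h7; apply hρX; rw [rX]; ext <;> simp [h6, h7]
      have : L ++ h :: v = (L ++ a :: v).set L.length h := by simp
      rw [this, getD_set _ (by simp), if_neg h7]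
    · rfl

/-- The letter at the end of `u` and the sentinel change places, a letter `a` is drawn into `rH`
with amplitude `√(count a / (n+1))`, and it is then put at the end in place of the sentinel; `v`
collects the positions already filled. By `card_words_erase` the product with the uniform amplitude
for the remaining letters is again uniform. -/
theorem runD_symStages {w S : ℕ} (hw : 0 < w) (n : ℕ) : ∀ (u v : List ℕ), u.length = n →
    u.Pairwise (· ≤ ·) → (∀ y ∈ u, y < S) → (∀ y ∈ S :: v, y < 2 ^ (w - 1)) →
    runD (loop n fun _ c => symStage w c) (ket (symState w (u ++ v) S)) =
      ∑ L ∈ words u, (((Real.sqrt (words u).card)⁻¹ : ℝ) : ℂ) • ket (symState w (L ++ v) S) := by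
  induction n with
  | zero =>
    intro u v hu _ _ _
    rw [List.length_eq_zero_iff] at hu
    subst hu
    rw [Multiset.coe_nil, words_zero]
    simp [loop, runD]
  | succ n ih =>
    intro u v hu hs hS hv
    obtain ⟨r, h, rfl⟩ : ∃ r h, u = r ++ [h] := by
      refine ⟨u.dropLast, u.getLast (by rintro rfl; simp at hu), ?_⟩
      rw [List.dropLast_append_getLast]
    have hr : r.length = n := by simpa using hu
    have hhS : h < S := hS h (by simp)
    have hSw := hv S (by simp)
    rw [loop_desc_succ, runD_append, LinearMap.comp_apply, symStage_eq, runD_append,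
      LinearMap.comp_apply, runD_append, LinearMap.comp_apply, List.append_assoc,
      List.singleton_append, ← hr, runD_swap_symState]
    have h1 := runD_swapStages hw (S := S) (v := v) r.length r [] h (by simp) hs hS hv
    rw [List.nil_append] at h1
    rw [h1, map_sum, map_sum]
    set u := r ++ [h] with hudef
    have hu0 : (u : Multiset ℕ) ≠ 0 := by
      rw [hudef, Ne, Multiset.coe_eq_zero]; simp
    rw [sum_words hu0]
    have hset : (h :: r).toFinset = (u : Multiset ℕ).toFinset := by
      ext y; simp [hudef]
    rw [hset]
    refine Finset.sum_congr rfl fun a ha => ?_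
    have hau : a ∈ u := by simpa using ha
    have hlen : (u.erase a).length = r.length := by
      rw [List.length_erase_of_mem hau, hudef]; simp
    have hlt : ∀ y ∈ S :: a :: v, y < 2 ^ (w - 1) := by
      intro y hy
      rcases List.mem_cons.mp hy with rfl | hy
      · exact hSw
      rcases List.mem_cons.mp hy with rfl | hy
      · exact (hS _ hau).trans hSw
      · exact hv y (List.mem_cons_of_mem _ hy)
    rw [map_smul, map_smul, ← hlen, runD_swap_symState, hlen, hr,
      ih (u.erase a) (a :: v) (hlen.trans hr) (hs.sublist List.erase_sublist)
        (fun y hy => hS y (List.mem_of_mem_erase hy)) hlt, Finset.smul_sum, ← Multiset.coe_erase]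
    refine Finset.sum_congr rfl fun L _ => ?_
    rw [smul_smul, List.append_assoc, List.singleton_append, ← Complex.ofReal_mul]
    congr 2
    have hc := card_words_erase (n + 1) (u : Multiset ℕ) (by simpa using hu) a hau
    have hpos : 0 < (words (u : Multiset ℕ)).card :=
      Finset.card_pos.mpr ⟨u, mem_words.mpr rfl⟩
    have hpos' : 0 < (words ((u : Multiset ℕ).erase a)).card :=
      Finset.card_pos.mpr ⟨u.erase a, mem_words.mpr (by simp)⟩
    have hq : ((n : ℝ) + 1) * (words ((u : Multiset ℕ).erase a)).card =
        u.count a * (words (u : Multiset ℕ)).card := by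
      have := congrArg (Nat.cast : ℕ → ℝ) hc
      push_cast at this
      rw [this, Multiset.coe_count]
    have hpos1 : (0 : ℝ) < (words (u : Multiset ℕ)).card := by exact_mod_cast hpos
    have hpos1' : (0 : ℝ) < (words ((u : Multiset ℕ).erase a)).card := by exact_mod_cast hpos'
    rw [← Real.sqrt_inv, ← Real.sqrt_inv, ← Real.sqrt_mul (by positivity)]
    congr 1
    rw [List.count_nil]
    push_cast
    field_simp
    linear_combination -hq

/-- The sentinel is `2^K`, above every letter; `1 < r` keeps it below `2^(w-1)`, where comparisons
by sign bit are valid. -/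
theorem runD_symmetrize {w K r : ℕ} (hK : K + r = w) (hr : 1 < r) {u : List ℕ}
    (hs : u.Pairwise (· ≤ ·)) (hu : ∀ y ∈ u, y < 2 ^ K) :
    runD (symmetrize w u.length K r) (ket (symState w u 0)) =
      ∑ L ∈ words u, (((Real.sqrt (words u).card)⁻¹ : ℝ) : ℂ) • ket (symState w L 0) := by
  have hc : ∀ L : List ℕ,
      runD (cadd w [] rH K r) (ket (symState w L 0)) = ket (symState w L (2 ^ K)) := by
    intro L
    have := runD_cadd (w := w) [] rH hK (by simp) (symState w L 0)
    rw [List.map_nil] at this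
    rw [this]
    congr 1
    ext ρ
    by_cases hρ : ρ = rH
    · subst hρ; simp [symState_rH]
    · rw [Function.update_of_ne hρ]; simp [symState, hρ]
  have hlt : 2 ^ K < 2 ^ (w - 1) := Nat.pow_lt_pow_right (by norm_num) (by omega)
  refine runD_append_of (hc u) ?_
  have h1 := runD_symStages (w := w) (by omega) u.length u [] rfl hs hu (by simpa using hlt)
  rw [List.append_nil] at h1
  rw [runD_append, LinearMap.comp_apply, h1, map_sum]
  refine Finset.sum_congr rfl fun L _ => ?_
  rw [map_smul, List.append_nil, runD_dinv (hc L)]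

end QExpand
namespace QExpand

/-! ## Types of words -/

/-- By `rankOf_lt` the rank with the larger top letter is larger, so the top letters agree and can
be removed. -/
theorem rankOf_inj {x y : ℕ → ℕ} (l : ℕ) (hx : ∀ a b, a ≤ b → b < l → x a ≤ x b)
    (hy : ∀ a b, a ≤ b → b < l → y a ≤ y b) (h : rankOf x l = rankOf y l) : ∀ i < l, x i = y i := by
  induction l with
  | zero => intro i hi; omega
  | succ l ih =>
    have key : ∀ x y : ℕ → ℕ, (∀ a b, a ≤ b → b < l + 1 → x a ≤ x b) → x l < y l →
        rankOf x (l + 1) < rankOf y (l + 1) := by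
      intro x y hx hlt
      calc rankOf x (l + 1) < (x l + l + 1).choose (l + 1) :=
            rankOf_lt fun a b h1 h2 => hx a b h1 (by omega)
        _ ≤ (y l + l).choose (l + 1) := Nat.choose_le_choose _ (by omega)
        _ ≤ rankOf y (l + 1) := by rw [rankOf, Finset.sum_range_succ]; omega
    have hl : x l = y l := by
      rcases lt_trichotomy (x l) (y l) with h1 | h1 | h1
      · have := key x y hx h1; omega
      · exact h1
      · have := key y x hy h1; omega
    rw [rankOf, rankOf, Finset.sum_range_succ, Finset.sum_range_succ, hl] at h
    have := ih (fun a b h1 h2 => hx a b h1 (by omega)) (fun a b h1 h2 => hy a b h1 (by omega))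
      (Nat.add_right_cancel h)
    intro i hi
    rcases Nat.lt_or_eq_of_le (Nat.lt_succ_iff.mp hi) with h1 | rfl
    · exact this i h1
    · exact hl

variable {l p : ℕ}

/-- The letters of a word. -/
def letters (x : Fin l → Fin p) : List ℕ := List.ofFn fun i => (x i : ℕ)

/-- The letters of a word in increasing order. -/
def sortedLetters (x : Fin l → Fin p) : List ℕ := letters (x ∘ Tuple.sort x)

theorem length_letters (x : Fin l → Fin p) : (letters x).length = l := by simp [letters]

theorem letters_injective : Function.Injective (letters : (Fin l → Fin p) → List ℕ) := by
  intro x y h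
  have := List.ofFn_injective h
  ext i
  exact congrFun this i

theorem getD_letters (x : Fin l → Fin p) (i : Fin l) : (letters x).getD i 0 = x i := by
  rw [List.getD_eq_getElem _ _ (by rw [length_letters]; exact i.2)]
  simp [letters]

theorem coe_letters (x : Fin l → Fin p) :
    (letters x : Multiset ℕ) = Finset.univ.val.map fun i => (x i : ℕ) := by
  rw [letters, Fin.univ_val_map]

theorem coe_letters_comp (x : Fin l → Fin p) (σ : Equiv.Perm (Fin l)) :
    (letters (x ∘ σ) : Multiset ℕ) = letters x := by
  rw [coe_letters, coe_letters]
  have h : (Finset.univ : Finset (Fin l)).val.map σ = Finset.univ.val := by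
    have := congrArg Finset.val (Finset.map_univ_equiv σ)
    simpa [Finset.map_val] using this
  conv_rhs => rw [← h, Multiset.map_map]
  rfl

theorem sortedLetters_pairwise (x : Fin l → Fin p) : (sortedLetters x).Pairwise (· ≤ ·) := by
  rw [sortedLetters, letters, List.pairwise_ofFn]
  intro i j hij
  exact Tuple.monotone_sort x hij.le

theorem typeIndex_eq_rankOf (x : Fin l → Fin p) :
    typeIndex x = rankOf (fun i => (sortedLetters x).getD i 0) l := by
  rw [typeIndex, rankOf, Finset.sum_range]
  refine Finset.sum_congr rfl fun i _ => ?_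
  simp only [sortedLetters]
  rw [getD_letters]; rfl

theorem length_sortedLetters (x : Fin l → Fin p) : (sortedLetters x).length = l :=
  length_letters _

theorem sortedLetters_mono (x : Fin l → Fin p) (a b : ℕ) (hab : a ≤ b) (hb : b < l) :
    (sortedLetters x).getD a 0 ≤ (sortedLetters x).getD b 0 := by
  have h1 := getD_letters (x ∘ Tuple.sort x) ⟨a, by omega⟩
  have h2 := getD_letters (x ∘ Tuple.sort x) ⟨b, hb⟩
  simp only at h1 h2
  rw [sortedLetters, h1, h2]
  exact Tuple.monotone_sort x (show (⟨a, by omega⟩ : Fin l) ≤ ⟨b, hb⟩ from hab)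

theorem coe_sortedLetters (x : Fin l → Fin p) : (sortedLetters x : Multiset ℕ) = letters x :=
  coe_letters_comp x _

theorem typeIndex_eq_iff {x y : Fin l → Fin p} :
    typeIndex x = typeIndex y ↔ (letters x : Multiset ℕ) = letters y := by
  constructor
  · intro h
    rw [typeIndex_eq_rankOf, typeIndex_eq_rankOf] at h
    have := rankOf_inj l (sortedLetters_mono x) (sortedLetters_mono y) h
    rw [← coe_sortedLetters x, ← coe_sortedLetters y]
    congr 1
    refine List.ext_getElem (by simp [length_sortedLetters]) fun i h1 h2 => ?_
    have h3 := this i (by rwa [length_sortedLetters] at h1)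
    rwa [List.getD_eq_getElem _ _ h1, List.getD_eq_getElem _ _ h2] at h3
  · intro h
    have : sortedLetters x = sortedLetters y := by
      refine List.Perm.eq_of_pairwise' (r := (· ≤ ·)) (sortedLetters_pairwise x)
        (sortedLetters_pairwise y) ?_
      rw [← Multiset.coe_eq_coe, coe_sortedLetters, coe_sortedLetters, h]
    rw [typeIndex_eq_rankOf, typeIndex_eq_rankOf, this]

theorem typeIndex_comp (x : Fin l → Fin p) (σ : Equiv.Perm (Fin l)) :
    typeIndex (x ∘ σ) = typeIndex x := typeIndex_eq_iff.mpr (coe_letters_comp x σ)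

theorem exists_perm_of_typeIndex_eq {x y : Fin l → Fin p} (h : typeIndex x = typeIndex y) :
    ∃ σ : Equiv.Perm (Fin l), y = x ∘ σ := by
  have h1 : sortedLetters x = sortedLetters y := by
    refine List.Perm.eq_of_pairwise' (r := (· ≤ ·)) (sortedLetters_pairwise x)
      (sortedLetters_pairwise y) ?_
    rw [← Multiset.coe_eq_coe, coe_sortedLetters, coe_sortedLetters, typeIndex_eq_iff.mp h]
  have h2 := letters_injective h1
  refine ⟨(Tuple.sort y).symm.trans (Tuple.sort x), ?_⟩
  ext i
  have := congrFun h2 ((Tuple.sort y).symm i)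
  simp only [Function.comp_apply, Equiv.apply_symm_apply] at this
  simp [this]

theorem typeIndex_lt (hl : 0 < l) (x : Fin l → Fin p) : typeIndex x < symDim l p := by
  obtain ⟨i, rfl⟩ := Nat.exists_eq_succ_of_ne_zero hl.ne'
  rw [typeIndex_eq_rankOf, symDim]
  refine lt_of_lt_of_le (rankOf_lt fun a b h1 h2 => sortedLetters_mono x a b h1 (by omega)) ?_
  refine Nat.choose_le_choose _ ?_
  have h := getD_letters (x ∘ Tuple.sort x) ⟨i, by omega⟩
  simp only at h
  rw [sortedLetters, h]
  have := ((x ∘ Tuple.sort x) ⟨i, by omega⟩).2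
  omega

/-- Multisets of size `l` map injectively to indices below `symDim l p`, and there are exactly that
many multisets, so every index is attained. -/
theorem exists_typeIndex_eq (hl : 0 < l) (m : Fin (symDim l p)) :
    ∃ x : Fin l → Fin p, typeIndex x = m := by
  classical
  have hword : ∀ s : Sym (Fin p) l, ∃ x : Fin l → Fin p,
      (Finset.univ.val.map x : Multiset (Fin p)) = s := by
    intro s
    have hlen : (s : Multiset (Fin p)).toList.length = l := by simp
    refine ⟨fun i => (s : Multiset (Fin p)).toList.get (i.cast hlen.symm), ?_⟩
    rw [Fin.univ_val_map]
    conv_rhs => rw [← Multiset.coe_toList (s : Multiset (Fin p))]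
    congr 1
    refine List.ext_getElem (by simp) fun i h1 h2 => by simp
  choose word hword using hword
  have hinj : Function.Injective fun s : Sym (Fin p) l =>
      (⟨typeIndex (word s), typeIndex_lt hl _⟩ : Fin (symDim l p)) := by
    intro s t h
    simp only [Fin.mk.injEq] at h
    rw [typeIndex_eq_iff, coe_letters, coe_letters] at h
    have e : ∀ x : Fin l → Fin p, (Finset.univ.val.map fun i => (x i : ℕ)) =
        (Finset.univ.val.map x).map Fin.val := by intro x; rw [Multiset.map_map]; rfl
    rw [e, e] at h
    have := Multiset.map_injective Fin.val_injective h
    rw [hword, hword] at this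
    exact Sym.coe_injective this
  have hbij := (Fintype.bijective_iff_injective_and_card _).mpr ⟨hinj, by
    rw [Sym.card_sym_eq_choose, Fintype.card_fin, Fintype.card_fin, symDim, add_comm p l]⟩
  obtain ⟨s, hs⟩ := hbij.2 m
  exact ⟨word s, congrArg Fin.val hs⟩

theorem letters_lt (x : Fin l → Fin p) : ∀ y ∈ letters x, y < p := by
  intro y hy
  rw [letters, List.mem_ofFn] at hy
  obtain ⟨i, rfl⟩ := hy
  exact (x i).2

theorem exists_letters_eq {L : List ℕ} (hL : L.length = l) (hp : ∀ y ∈ L, y < p) :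
    ∃ x : Fin l → Fin p, letters x = L := by
  subst hL
  refine ⟨fun i => ⟨L.get i, hp _ (List.get_mem _ _)⟩, ?_⟩
  simp [letters]

theorem sum_words_letters {M : Type*} [AddCommMonoid M] (x₀ : Fin l → Fin p) (f : List ℕ → M) :
    ∑ L ∈ words (letters x₀ : Multiset ℕ), f L =
      ∑ x : Fin l → Fin p, if typeIndex x = typeIndex x₀ then f (letters x) else 0 := by
  rw [← Finset.sum_filter]
  symm
  refine Finset.sum_bij (fun x _ => letters x) ?_ ?_ ?_ ?_
  · intro x hx
    rw [Finset.mem_filter, typeIndex_eq_iff] at hx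
    exact mem_words.mpr hx.2
  · intro x _ y _ h; exact letters_injective h
  · intro L hL
    rw [mem_words, Multiset.coe_eq_coe] at hL
    obtain ⟨x, rfl⟩ := exists_letters_eq (l := l) (p := p) (by rw [hL.length_eq, length_letters])
      (fun y hy => letters_lt x₀ y (hL.mem_iff.mp hy))
    refine ⟨x, ?_, rfl⟩
    rw [Finset.mem_filter, typeIndex_eq_iff]
    exact ⟨Finset.mem_univ _, Multiset.coe_eq_coe.mpr hL⟩
  · intro x _; rfl

theorem card_type_eq (x₀ : Fin l → Fin p) :
    Fintype.card {y : Fin l → Fin p // typeIndex y = typeIndex x₀} =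
      (words (letters x₀ : Multiset ℕ)).card := by
  rw [Finset.card_eq_sum_ones, sum_words_letters, Fintype.card_subtype, Finset.card_filter]

/-! ## The circuit for the inverse Schur transform -/

/-- The inverse Schur transform for words of `l` letters of `K` bits. -/
def schurCircuit (w l K r : ℕ) : List DGate := unrank w l K r ++ symmetrize w l K r

/-- `rM` has address 0, hence its wires are `0, …, w - 1` and its contents are the binary code of
the message register, without relocation. -/
theorem coe_code_eq_wireSet {w M : ℕ} (hM : M < 2 ^ w) {σ : WState w} (h0 : σ rM = M)
    (hσ : ∀ ρ, ρ ≠ rM → σ ρ = 0) : ((code M : Finset ℕ) : Set ℕ) = wireSet σ := by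
  have hv : (σ rM).val = M := by rw [h0, ZMod.val_natCast_of_lt hM]
  have hw : ∀ b, wire w rM b = b := by intro b; simp [wire, addr, rM]
  ext i
  simp only [code, Finset.mem_coe, List.mem_toFinset, Nat.mem_bitIndices]
  constructor
  · intro hi
    have hiw : i < w := by
      by_contra hge
      rw [Nat.testBit_lt_two_pow (lt_of_lt_of_le hM (Nat.pow_le_pow_right (by norm_num)
        (not_lt.mp hge)))] at hi
      simp at hi
    exact ⟨rM, i, hiw, by rw [wbit, hv]; exact hi, (hw i).symm⟩
  · rintro ⟨ρ, b, hb, h1, rfl⟩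
    by_cases hρ : ρ = rM
    · subst hρ
      rw [wbit, hv] at h1
      rwa [hw]
    · rw [hσ ρ hρ, wbit_zero] at h1; simp at h1

theorem symDim_le_two_pow {K : ℕ} (hl : 0 < l) (hK : p + l ≤ 2 ^ K) : symDim l p ≤ 2 ^ (K * l) := by
  calc symDim l p ≤ (l + p - 1) ^ l := Nat.choose_le_pow _ _
    _ ≤ (2 ^ K) ^ l := Nat.pow_le_pow_left (by omega) _
    _ = 2 ^ (K * l) := (pow_mul _ _ _).symm

theorem runD_schurCircuit {w K r : ℕ} (hl : 0 < l) (hr : K + r = w) (hw : K * l + 1 < w)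
    (hK : p + l ≤ 2 ^ K) (m : Fin (symDim l p)) :
    runD (schurCircuit w l K r) (Finsupp.single (code m) 1) =
      ∑ x : Fin l → Fin p, symSchurInv l p x m • ket (symState w (letters x) 0) := by
  obtain ⟨x₀, hx₀⟩ := exists_typeIndex_eq hl m
  have hKw : K + 1 < w := by nlinarith
  set u := sortedLetters x₀ with hu
  have hup : ∀ y ∈ u, y < p := letters_lt _
  have hlen : u.length = l := length_sortedLetters x₀
  have hsub : ∀ i < l, u.getD i 0 + i < 2 ^ K := by
    intro i hi
    have : u.getD i 0 < p := by
      rw [List.getD_eq_getElem _ _ (by omega)]; exact hup _ (List.getElem_mem _)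
    omega
  have h1 := runD_unrank (r := r) hr hw (x := fun i => u.getD i 0) (sortedLetters_mono x₀) hsub
  rw [← typeIndex_eq_rankOf, hx₀] at h1
  have h2 : ket (rankState w (m : ℕ) (fun i => u.getD i 0) l l) = Finsupp.single (code m) 1 := by
    refine ket_eq_single (coe_code_eq_wireSet ?_ (by simp [rankState]) ?_)
    · calc (m : ℕ) < symDim l p := m.2
        _ ≤ 2 ^ (K * l) := symDim_le_two_pow hl hK
        _ ≤ 2 ^ w := Nat.pow_le_pow_right (by norm_num) (by omega)
    · intro ρ hρ
      rw [rankState, if_neg hρ, if_neg]; omega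
  -- With the index used up, only the letter registers are occupied; positions from `l` on read as
  -- the default letter 0, that is, as clean registers.
  have h3 : rankState w 0 (fun i => u.getD i 0) 0 l = symState w u 0 := by
    ext ρ
    simp only [rankState, symState, Nat.cast_zero, ite_self, Nat.zero_le, true_and]
    by_cases hρ : ρ = rM
    · subst hρ; simp [rM]
    · rw [if_neg hρ]
      by_cases h4 : ρ.1 = 1 ∧ ρ.2.1 = 0
      · by_cases h5 : ρ.2.2 < l
        · rw [if_pos ⟨h4.1, h4.2, h5⟩, if_pos h4]
        · rw [if_neg (by tauto), if_pos h4, List.getD_eq_default _ _ (by omega)]; simp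
      · rw [if_neg (by tauto), if_neg h4]
  rw [h2, h3] at h1
  have h4 := runD_symmetrize (w := w) hr (by omega) (sortedLetters_pairwise x₀)
    (fun y hy => lt_of_lt_of_le (hup y hy) (by omega : p ≤ 2 ^ K))
  rw [← hu, hlen] at h4
  rw [schurCircuit, runD_append_of h1 h4, hu, coe_sortedLetters, sum_words_letters]
  refine Finset.sum_congr rfl fun x _ => ?_
  rw [symSchurInv, Matrix.of_apply, ← hx₀, card_type_eq]
  split_ifs
  · rw [one_div]
  · rw [zero_smul]

end QExpand
namespace QExpand

/-! ## The symmetric subspace -/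

variable {l p : ℕ}

/-- Tensor product of matrices. -/
def tens (A : Fin l → Matrix (Fin p) (Fin p) ℂ) : Matrix (Fin l → Fin p) (Fin l → Fin p) ℂ :=
  Matrix.of fun x y => ∏ i, A i (x i) (y i)

theorem tens_mul (A B : Fin l → Matrix (Fin p) (Fin p) ℂ) :
    tens A * tens B = tens fun i => A i * B i := by
  ext x y
  simp only [Matrix.mul_apply, tens, Matrix.of_apply]
  rw [Finset.prod_univ_sum, Fintype.piFinset_univ]
  simp only [Finset.prod_mul_distrib]

theorem tens_one : tens (fun _ : Fin l => (1 : Matrix (Fin p) (Fin p) ℂ)) = 1 := by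
  ext x y
  simp only [tens, Matrix.of_apply, Matrix.one_apply]
  by_cases h : x = y
  · subst h; simp
  · rw [if_neg h]
    obtain ⟨i, hi⟩ := Function.ne_iff.mp h
    exact Finset.prod_eq_zero (Finset.mem_univ i) (if_neg hi)

theorem tensorPower_eq_tens (U : Matrix (Fin p) (Fin p) ℂ) :
    tensorPower l U = tens fun _ => U := rfl

theorem tens_conjTranspose (A : Fin l → Matrix (Fin p) (Fin p) ℂ) :
    (tens A).conjTranspose = tens fun i => (A i).conjTranspose := by
  ext x y
  simp [tens, Matrix.conjTranspose_apply]

theorem conjTranspose_tensorPower_mul {U : Matrix (Fin p) (Fin p) ℂ}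
    (hU : U ∈ Matrix.unitaryGroup (Fin p) ℂ) :
    (tensorPower l U).conjTranspose * tensorPower l U = 1 := by
  have h : U.conjTranspose * U = 1 := Matrix.mem_unitaryGroup_iff'.mp hU
  rw [tensorPower_eq_tens, tens_conjTranspose, tens_mul, h, tens_one]

theorem typeCount_pos (x : Fin l → Fin p) :
    0 < Fintype.card {y : Fin l → Fin p // typeIndex y = typeIndex x} :=
  Fintype.card_pos_iff.mpr ⟨⟨x, rfl⟩⟩

theorem star_symSchurInv (x : Fin l → Fin p) (m : Fin (symDim l p)) :
    star (symSchurInv l p x m) = symSchurInv l p x m := by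
  rw [symSchurInv, Matrix.of_apply]
  split_ifs
  · exact Complex.conj_ofReal _
  · simp

theorem symSchurInv_mul_self (x y : Fin l → Fin p) (m : Fin (symDim l p))
    (hx : typeIndex x = m) (hy : typeIndex y = m) :
    symSchurInv l p x m * symSchurInv l p y m =
      ((Fintype.card {y : Fin l → Fin p // typeIndex y = (m : ℕ)} : ℝ)⁻¹ : ℝ) := by
  simp only [symSchurInv, Matrix.of_apply, if_pos hx, if_pos hy]
  rw [← Complex.ofReal_mul]
  congr 1
  rw [one_div, ← mul_inv, Real.mul_self_sqrt (by positivity)]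

theorem symSchurInv_isometry (hl : 0 < l) :
    (symSchurInv l p).conjTranspose * symSchurInv l p = 1 := by
  ext m m'
  simp only [Matrix.mul_apply, Matrix.conjTranspose_apply, star_symSchurInv, Matrix.one_apply]
  split_ifs with h
  · subst h
    have h1 : ∀ x : Fin l → Fin p, symSchurInv l p x m * symSchurInv l p x m =
        if typeIndex x = (m : ℕ) then
          (((Fintype.card {y : Fin l → Fin p // typeIndex y = (m : ℕ)} : ℝ)⁻¹ : ℝ) : ℂ) else 0 := by
      intro x
      split_ifs with hx
      · exact symSchurInv_mul_self x x m hx hx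
      · simp [symSchurInv, hx]
    simp only [h1]
    rw [← Finset.sum_filter, Finset.sum_const, ← Fintype.card_subtype, nsmul_eq_mul]
    obtain ⟨x, hx⟩ := exists_typeIndex_eq hl m
    have := typeCount_pos x
    rw [hx] at this
    rw [Complex.ofReal_inv, Complex.ofReal_natCast, mul_inv_cancel₀]
    exact_mod_cast this.ne'
  · refine Finset.sum_eq_zero fun x _ => ?_
    simp only [symSchurInv, Matrix.of_apply]
    split_ifs with h1 h2
    · exact absurd (Fin.ext (h1.symm.trans h2)) h
    · simp
    · simp
    · simp

/-- The range of `V` consists of the vectors constant on types, and on a type `V V†` averages. -/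
theorem symSchurInv_proj (hl : 0 < l) {v : (Fin l → Fin p) → ℂ}
    (hv : ∀ x y, typeIndex x = typeIndex y → v x = v y) :
    (symSchurInv l p).mulVec ((symSchurInv l p).conjTranspose.mulVec v) = v := by
  ext x
  simp only [Matrix.mulVec, dotProduct, Matrix.conjTranspose_apply, star_symSchurInv]
  set m : Fin (symDim l p) := ⟨typeIndex x, typeIndex_lt hl x⟩ with hm
  rw [Finset.sum_eq_single m]
  · rw [Finset.mul_sum]
    have h1 : ∀ y : Fin l → Fin p, symSchurInv l p x m * (symSchurInv l p y m * v y) =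
        if typeIndex y = typeIndex x then
          (((Fintype.card {y : Fin l → Fin p // typeIndex y = (m : ℕ)} : ℝ)⁻¹ : ℝ) : ℂ) * v x
        else 0 := by
      intro y
      split_ifs with hy
      · rw [← mul_assoc, symSchurInv_mul_self x y m rfl hy, hv y x hy]
      · simp [symSchurInv, hm, hy]
    simp only [h1]
    rw [← Finset.sum_filter, Finset.sum_const, ← Fintype.card_subtype, nsmul_eq_mul, ← mul_assoc,
      Complex.ofReal_inv, Complex.ofReal_natCast, mul_inv_cancel₀, one_mul]
    exact_mod_cast (typeCount_pos x).ne'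
  · intro m' _ hne
    have : typeIndex x ≠ (m' : ℕ) := fun h => hne (Fin.ext h.symm)
    simp [symSchurInv, this]
  · simp

/-- `U^{⊗l}` commutes with permutations of the factors and the columns of `V` are invariant, so the
columns of `U^{⊗l} V` are fixed by the projection `V V†`. -/
theorem symSchurInv_mul_expand (hl : 0 < l) (U : Matrix (Fin p) (Fin p) ℂ) :
    symSchurInv l p * expand l U = tensorPower l U * symSchurInv l p := by
  ext x m
  rw [expand, Matrix.mul_assoc, ← Matrix.mul_assoc (symSchurInv l p)]
  have := symSchurInv_proj hl (v := fun x => (tensorPower l U * symSchurInv l p) x m) (by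
    intro x y hxy
    obtain ⟨σ, rfl⟩ := exists_perm_of_typeIndex_eq hxy
    simp only [Matrix.mul_apply, tensorPower, Matrix.of_apply]
    refine Fintype.sum_equiv (σ.arrowCongr (Equiv.refl _)).symm _ _ fun z => ?_
    have h1 : ((σ.arrowCongr (Equiv.refl (Fin p))).symm z) = z ∘ σ := by ext; simp
    rw [h1]
    congr 1
    · exact (Equiv.prod_comp σ fun i => U (x i) (z i)).symm
    · simp only [symSchurInv, Matrix.of_apply, typeIndex_comp])
  have h2 := congrFun this x
  rw [Matrix.mulVec_mulVec] at h2
  rw [← h2]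
  rfl

theorem expand_mem_unitaryGroup (hl : 0 < l) {U : Matrix (Fin p) (Fin p) ℂ}
    (hU : U ∈ Matrix.unitaryGroup (Fin p) ℂ) :
    expand l U ∈ Matrix.unitaryGroup (Fin (symDim l p)) ℂ := by
  rw [Matrix.mem_unitaryGroup_iff', Matrix.star_eq_conjTranspose]
  set V := symSchurInv l p with hV
  have h1 : (V * expand l U).conjTranspose * (V * expand l U) = 1 := by
    rw [symSchurInv_mul_expand hl, Matrix.conjTranspose_mul, Matrix.mul_assoc,
      ← Matrix.mul_assoc _ (tensorPower l U), conjTranspose_tensorPower_mul hU, Matrix.one_mul,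
      symSchurInv_isometry hl]
  rwa [Matrix.conjTranspose_mul, Matrix.mul_assoc, ← Matrix.mul_assoc _ V,
    symSchurInv_isometry hl, Matrix.one_mul] at h1

/-! ## Applying a unitary to every letter -/

theorem sum_tens_update {M : Type*} [AddCommGroup M] [Module ℂ M] (U : Matrix (Fin p) (Fin p) ℂ)
    (j : Fin l) (x : Fin l → Fin p) (e : (Fin l → Fin p) → M) :
    ∑ y, tens (fun i => if i = j then U else 1) y x • e y =
      ∑ a, U a (x j) • e (Function.update x j a) := by
  symm
  refine Finset.sum_of_injOn (fun a => Function.update x j a) ?_ (by simp) ?_ ?_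
  · intro a _ b _ h
    simpa using congrFun h j
  · intro y _ hy
    have : ∃ i, i ≠ j ∧ y i ≠ x i := by
      by_contra hcon
      push Not at hcon
      apply hy
      refine ⟨y j, by simp, ?_⟩
      ext i
      by_cases h : i = j
      · subst h; simp
      · simp [h, hcon i h]
    obtain ⟨i, hij, hi⟩ := this
    rw [tens, Matrix.of_apply, Finset.prod_eq_zero (Finset.mem_univ i), zero_smul]
    rw [if_neg hij, Matrix.one_apply_ne hi]
  · intro a _
    congr 1
    rw [tens, Matrix.of_apply, Finset.prod_eq_single j]
    · simp
    · intro i _ hij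
      simp only [if_neg hij, Function.update_of_ne hij, Matrix.one_apply_eq]
    · simp

theorem tens_step (U : Matrix (Fin p) (Fin p) ℂ) (j : ℕ) (hj : j < l) :
    tens (fun i : Fin l => if i = ⟨j, hj⟩ then U else 1) *
      tens (fun i : Fin l => if (i : ℕ) < j then U else 1) =
        tens (fun i : Fin l => if (i : ℕ) < j + 1 then U else 1) := by
  rw [tens_mul]
  congr 1
  ext1 i
  rcases lt_trichotomy (i : ℕ) j with h | h | h
  · have : i ≠ ⟨j, hj⟩ := fun e => by rw [e] at h; simp at h
    rw [if_neg this, if_pos h, if_pos (by omega), Matrix.one_mul]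
  · rw [if_pos (Fin.ext h), if_neg (by omega), if_pos (by omega), Matrix.mul_one]
  · have : i ≠ ⟨j, hj⟩ := fun e => by rw [e] at h; simp at h
    rw [if_neg this, if_neg (by omega), if_neg (by omega), Matrix.one_mul]

/-- If `G j` applies `U` to letter `j`, then `G 0, …, G (l - 1)` together apply `U^{⊗l}`. -/
theorem apply_letters {M : Type*} [AddCommGroup M] [Module ℂ M] (U : Matrix (Fin p) (Fin p) ℂ)
    (e : (Fin l → Fin p) → M) (G : ℕ → M →ₗ[ℂ] M) (ψ : ℕ → M)
    (hG : ∀ (j : ℕ) (hj : j < l) x, G j (e x) =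
      ∑ a, U a (x ⟨j, hj⟩) • e (Function.update x ⟨j, hj⟩ a))
    {v : (Fin l → Fin p) → ℂ} (h0 : ψ 0 = ∑ x, v x • e x)
    (hψ : ∀ j < l, ψ (j + 1) = G j (ψ j)) :
    ψ l = ∑ x, (tensorPower l U).mulVec v x • e x := by
  suffices H : ∀ j ≤ l, ψ j =
      ∑ x, (tens (fun i : Fin l => if (i : ℕ) < j then U else 1)).mulVec v x • e x by
    have h1 : (fun i : Fin l => if (i : ℕ) < l then U else 1) = fun _ => U := by
      ext1 i; rw [if_pos i.2]
    rw [H l le_rfl, h1, tensorPower_eq_tens]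
  intro j
  induction j with
  | zero =>
    intro _
    simp only [Nat.not_lt_zero, if_false]
    rw [h0, tens_one, Matrix.one_mulVec]
  | succ j ih =>
    intro hj
    have hj' : j < l := hj
    rw [hψ j hj', ih hj'.le, map_sum, ← tens_step U j hj', ← Matrix.mulVec_mulVec]
    set u := (tens (fun i : Fin l => if (i : ℕ) < j then U else 1)).mulVec v
    simp only [map_smul, hG j hj', ← sum_tens_update]
    simp only [Finset.smul_sum, Matrix.mulVec, dotProduct, Finset.sum_smul, smul_smul]
    rw [Finset.sum_comm]
    refine Finset.sum_congr rfl fun x _ => Finset.sum_congr rfl fun y _ => ?_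
    rw [mul_comm]

/-- The column `m` of the inverse Schur transform, after `U^{⊗l}`. -/
theorem sum_tensorPower_symSchurInv {M : Type*} [AddCommGroup M] [Module ℂ M] (hl : 0 < l)
    (U : Matrix (Fin p) (Fin p) ℂ) (e : (Fin l → Fin p) → M) (m : Fin (symDim l p)) :
    ∑ x, (tensorPower l U).mulVec (fun x => symSchurInv l p x m) x • e x =
      ∑ y, expand l U y m • ∑ x, symSchurInv l p x y • e x := by
  have h : ∀ x, (tensorPower l U).mulVec (fun x => symSchurInv l p x m) x =
      ∑ y, symSchurInv l p x y * expand l U y m := by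
    intro x
    have := congrFun (congrFun (symSchurInv_mul_expand hl U) x) m
    rw [Matrix.mul_apply, Matrix.mul_apply] at this
    rw [this]; rfl
  simp only [h, Finset.sum_smul, Finset.smul_sum, smul_smul]
  rw [Finset.sum_comm]
  refine Finset.sum_congr rfl fun x _ => Finset.sum_congr rfl fun y _ => ?_
  rw [mul_comm]

/-- `N ≥ (1 + (p - 1) / l) ^ l`. -/
theorem pow_le_symDim (hl : 0 < l) (hp : 0 < p) :
    (1 + ((p : ℝ) - 1) / (l : ℝ)) ^ l ≤ (((l + p - 1).choose l : ℕ) : ℝ) := by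
  obtain ⟨q, rfl⟩ : ∃ q, p = q + 1 := ⟨p - 1, by omega⟩
  have hl' : (0 : ℝ) < l := by exact_mod_cast hl
  -- Induction on `n` with `l` fixed in the base: passing from `n` to `n + 1` multiplies the
  -- binomial by `1 + q/(n+1)`, which is at least `1 + q/l` as long as `n + 1 ≤ l`.
  have key : ∀ n ≤ l, (1 + (q : ℝ) / (l : ℝ)) ^ n ≤ ((n + q).choose n : ℕ) := by
    intro n
    induction n with
    | zero => simp
    | succ n ih =>
      intro hn
      have h1 := Nat.add_one_mul_choose_eq (n + q) n
      have h2 : ((n : ℝ) + q + 1) * ((n + q).choose n : ℕ) =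
          ((n + 1 + q).choose (n + 1) : ℕ) * ((n : ℝ) + 1) := by
        rw [show n + 1 + q = n + q + 1 by ring]; exact_mod_cast h1
      have hn' : (n : ℝ) + 1 ≤ l := by exact_mod_cast hn
      have hn0 : (0 : ℝ) < (n : ℝ) + 1 := by positivity
      have h3 : 1 + (q : ℝ) / l ≤ ((n : ℝ) + q + 1) / (n + 1) := by
        rw [show ((n : ℝ) + q + 1) / (n + 1) = 1 + q / (n + 1) by field_simp; ring]
        gcongr
      calc (1 + (q : ℝ) / (l : ℝ)) ^ (n + 1) = (1 + (q : ℝ) / (l : ℝ)) ^ n * (1 + (q : ℝ) / l) :=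
            pow_succ _ _
        _ ≤ ((n + q).choose n : ℕ) * (((n : ℝ) + q + 1) / (n + 1)) := by
            gcongr
            exact ih (by omega)
        _ = ((n + 1 + q).choose (n + 1) : ℕ) := by
            rw [← mul_div_assoc, mul_comm, h2]; field_simp
  have h := key l le_rfl
  rw [show l + (q + 1) - 1 = l + q by omega]
  push_cast
  rw [add_sub_cancel_right]
  exact h

end QExpand
namespace QExpand

/-! ## The circuit for the expansion of a unitary -/

variable {l p : ℕ}

/-- Move letter `j` to `rM`. -/
def moveLetter (w j : ℕ) : List DGate := addW w [] rM (rX j) ++ dinv (addW w [] (rX j) rM)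

/-- Apply the circuit `c` to letter `j`. -/
def applyLetter (w : ℕ) (c : List DGate) (j : ℕ) : List DGate :=
  moveLetter w j ++ (c ++ dinv (moveLetter w j))

/-- The circuit for the expansion of the unitary with circuit `c`. -/
def expandCircuit (w l K r : ℕ) (c : List DGate) : List DGate :=
  schurCircuit w l K r ++ (loop l (fun j _ => applyLetter w c j) ++ dinv (schurCircuit w l K r))

/-- Two additions suffice because `rM` is clean: it first receives a copy of the letter, and the
copy then cancels the original. -/
theorem runD_moveLetter {w j : ℕ} (σ : WState w) (hσ : σ rM = 0) :
    runD (moveLetter w j) (ket σ) =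
      ket (Function.update (Function.update σ (rX j) 0) rM (σ (rX j))) := by
  have hmx : rM ≠ rX j := by simp [rM, rX]
  have h1 := AddsOn.addW (w := w) [] (A := {rM}) (a := rM) (b := rX j) rfl hmx.symm (by simp)
  have h2 := AddsOn.addW (w := w) [] (A := {rX j}) (a := rX j) (b := rM) rfl hmx (by simp)
  rw [moveLetter, runD_append_of (h1.run σ) (h2.dinv.run _)]
  congr 1
  ext ρ
  by_cases h3 : ρ = rM
  · subst h3; simp [hσ, hmx]
  · by_cases h4 : ρ = rX j
    · subst h4; simp [hσ, hmx.symm]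
    · simp [h3, h4]

/-- The wires of a described circuit. -/
def wiresBelow (w : ℕ) (c : List DGate) : Prop := ∀ g ∈ c, g.target < w ∧ ∀ i ∈ g.controls, i < w

theorem runD_spectators {w : ℕ} {c : List DGate} (hc : wiresBelow w c) {R : Finset ℕ}
    (hR : ∀ i ∈ R, w ≤ i) (ψ : QState) :
    runD c (Finsupp.mapDomain (fun S => S ∪ R) ψ) =
      Finsupp.mapDomain (fun S => S ∪ R) (runD c ψ) := by
  rw [runD_eq_runGates]
  refine runGates_spectators R _ ?_ ψ
  intro g hg i hi hiR
  obtain ⟨g', hg', rfl⟩ := List.mem_map.mp hg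
  have h1 := hc g' hg'
  have h2 := hR i hiR
  simp only [DGate.toGate, Gate.wires, Finset.mem_insert, List.mem_toFinset] at hi
  rcases hi with rfl | hi
  · omega
  · have := h1.2 i hi; omega

theorem le_of_mem_wireSet {w : ℕ} {σ : WState w} (hσ : σ rM = 0) {i : ℕ} (hi : i ∈ wireSet σ) :
    w ≤ i := by
  obtain ⟨ρ, b, hb, h1, rfl⟩ := hi
  have hρ : ρ ≠ rM := by rintro rfl; rw [hσ, wbit_zero] at h1; simp at h1
  have : 1 ≤ addr ρ := by
    rcases Nat.eq_zero_or_pos (addr ρ) with h | h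
    · exact absurd (addr_injective (h.trans (by simp [addr, rM] : 0 = addr rM))) hρ
    · exact h
  rw [wire]; nlinarith

theorem ket_update_rM {w a : ℕ} (ha : a < 2 ^ w) {σ : WState w} (hσ : σ rM = 0) {R : Finset ℕ}
    (hR : (R : Set ℕ) = wireSet σ) :
    ket (Function.update σ rM (a : ZMod (2 ^ w))) = Finsupp.single (code a ∪ R) 1 := by
  apply ket_eq_single
  have h := coe_code_eq_wireSet ha (σ := (Function.update 0 rM (a : ZMod (2 ^ w)) : WState w))
    (by simp) (fun ρ hρ => by simp [hρ])
  rw [Finset.coe_union, h, hR]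
  ext i
  constructor
  · rintro (⟨ρ, b, hb, h1, rfl⟩ | ⟨ρ, b, hb, h1, rfl⟩)
    · rw [wire_mem_wireSet _ _ hb]
      by_cases hρ : ρ = rM
      · subst hρ; simpa using h1
      · simp [hρ, wbit_zero] at h1
    · rw [wire_mem_wireSet _ _ hb]
      have hρ : ρ ≠ rM := by rintro rfl; rw [hσ, wbit_zero] at h1; simp at h1
      simpa [hρ] using h1
  · rintro ⟨ρ, b, hb, h1, rfl⟩
    by_cases hρ : ρ = rM
    · subst hρ
      left
      rw [wire_mem_wireSet _ _ hb]; simpa using h1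
    · right
      rw [wire_mem_wireSet _ _ hb]; simpa [hρ] using h1

/-- The circuit `c` stays on wires below `w`, which are exactly those of `rM`; its ancillas are the
upper bits of `rM`. All other registers are spectators. -/
theorem runD_of_implements {w : ℕ} {c : List DGate} (hc : wiresBelow w c)
    {U : Matrix (Fin p) (Fin p) ℂ} (hU : Implements c U) (hp : p ≤ 2 ^ w) {σ : WState w}
    (hσ : σ rM = 0) (x : Fin p) :
    runD c (ket (Function.update σ rM ((x : ℕ) : ZMod (2 ^ w)))) =
      ∑ a, U a x • ket (Function.update σ rM ((a : ℕ) : ZMod (2 ^ w))) := by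
  rcases ket_cases σ with ⟨R, hR, -⟩ | ⟨hinf, -⟩
  · have hlt : ∀ a : Fin p, (a : ℕ) < 2 ^ w := fun a => a.2.trans_le hp
    have h1 := runD_spectators hc (R := R) (fun i hi => le_of_mem_wireSet hσ (by rw [← hR]; exact hi))
      (Finsupp.single (code x) 1)
    rw [Finsupp.mapDomain_single, hU x, Finsupp.mapDomain_finsetSum] at h1
    rw [ket_update_rM (hlt x) hσ hR, h1]
    refine Finset.sum_congr rfl fun a _ => ?_
    rw [ket_update_rM (hlt a) hσ hR, Finsupp.mapDomain_single, Finsupp.smul_single, smul_eq_mul,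
      mul_one]
  · simp [ket_update_zero hinf]

theorem symState_update {w : ℕ} (x : Fin l → Fin p) (j : Fin l) (a : Fin p) :
    symState w (letters (Function.update x j a)) 0 =
      Function.update (symState w (letters x) 0) (rX j) ((a : ℕ) : ZMod (2 ^ w)) := by
  have h1 : letters (Function.update x j a) = (letters x).set j a := by
    refine List.ext_getElem (by simp [letters]) fun i h1 h2 => ?_
    simp only [letters, List.getElem_ofFn, List.getElem_set]
    by_cases h : (j : ℕ) = i
    · subst h; simp
    · have : (⟨i, by simpa [letters] using h1⟩ : Fin l) ≠ j := fun e => h (by rw [← e])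
      simp [h, this]
  have hj : (j : ℕ) < (letters x).length := by rw [length_letters]; exact j.2
  ext ρ
  by_cases hρ : ρ = rX j
  · subst hρ
    rw [h1, symState_rX, getD_set _ hj]; simp
  · rw [Function.update_of_ne hρ, h1]
    simp only [symState]
    split_ifs with h6
    · rw [getD_set _ hj, if_neg]
      intro h7; apply hρ; rw [rX]; ext <;> simp [h6, h7]
    · rfl
    · rfl

theorem runD_applyLetter {w : ℕ} {c : List DGate} (hc : wiresBelow w c)
    {U : Matrix (Fin p) (Fin p) ℂ} (hU : Implements c U) (hp : p ≤ 2 ^ w) (j : Fin l)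
    (x : Fin l → Fin p) :
    runD (applyLetter w c j) (ket (symState w (letters x) 0)) =
      ∑ a, U a (x j) • ket (symState w (letters (Function.update x j a)) 0) := by
  have hmx : rM ≠ rX j := by simp [rM, rX]
  have h0 : ∀ x : Fin l → Fin p, symState w (letters x) 0 rM = 0 := fun x =>
    symState_apply_scalar rfl (by simp [rM, rH])
  set σ := Function.update (symState w (letters x) 0) (rX j) 0 with hσ
  have hσ0 : σ rM = 0 := by rw [hσ, Function.update_of_ne hmx, h0]
  have h1 : ∀ a : Fin p, runD (moveLetter w j)
      (ket (symState w (letters (Function.update x j a)) 0)) =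
        ket (Function.update σ rM ((a : ℕ) : ZMod (2 ^ w))) := by
    intro a
    rw [runD_moveLetter _ (h0 _), symState_update, Function.update_self, Function.update_idem]
  have h2 := h1 (x j)
  rw [Function.update_eq_self] at h2
  rw [applyLetter, runD_append, LinearMap.comp_apply, h2, runD_append, LinearMap.comp_apply,
    runD_of_implements hc hU hp hσ0, map_sum]
  refine Finset.sum_congr rfl fun a _ => ?_
  rw [map_smul, runD_dinv (h1 a)]

/-- After `U^{⊗l}` the state still lies in the range of `V`, with coefficients given by `expand l
U`, so running the Schur circuit backwards returns exactly to codes of indices with clean workspace.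
-/
theorem implements_expandCircuit {w K r : ℕ} (hl : 0 < l) (hr : K + r = w) (hw : K * l + 1 < w)
    (hK : p + l ≤ 2 ^ K) {c : List DGate} (hc : wiresBelow w c) {U : Matrix (Fin p) (Fin p) ℂ}
    (hU : Implements c U) : Implements (expandCircuit w l K r c) (expand l U) := by
  intro m
  have hp : p ≤ 2 ^ w := by
    have := Nat.pow_le_pow_right (n := 2) (by norm_num) (show K ≤ w by omega)
    omega
  rw [expandCircuit, runD_append, LinearMap.comp_apply, runD_schurCircuit hl hr hw hK, runD_append,
    LinearMap.comp_apply]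
  have h1 := apply_letters U (fun x : Fin l → Fin p => ket (symState w (letters x) 0))
    (fun j => runD (applyLetter w c j))
    (fun j => runD ((List.range j).flatMap fun j => applyLetter w c j)
      (∑ x : Fin l → Fin p, symSchurInv l p x m • ket (symState w (letters x) 0)))
    (v := fun x => symSchurInv l p x m)
    (fun j hj x => runD_applyLetter hc hU hp ⟨j, hj⟩ x) (by simp [runD])
    (fun j _ => by rw [flatMap_range_succ, runD_append, LinearMap.comp_apply])
  beta_reduce at h1
  rw [loop, h1, sum_tensorPower_symSchurInv hl, map_sum]
  refine Finset.sum_congr rfl fun y _ => ?_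
  rw [map_smul, runD_dinv (runD_schurCircuit hl hr hw hK y), Finsupp.smul_single, smul_eq_mul,
    mul_one]

end QExpand
namespace QExpand

/-! ## Running times of programs -/

/-- `P` goes from `s` to `s'` within `T` steps. -/
def RunsLe (P : Prog) (s s' : Store) (T : ℕ) : Prop := ∃ t ≤ T, Runs P s s' t

theorem RunsLe.mono {P : Prog} {s s' : Store} {T T' : ℕ} (h : RunsLe P s s' T) (hT : T ≤ T') :
    RunsLe P s s' T' := by
  obtain ⟨t, ht, h⟩ := h
  exact ⟨t, ht.trans hT, h⟩

theorem RunsLe.seq {P Q : Prog} {s s' s'' : Store} {T T' : ℕ} (h : RunsLe P s s' T)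
    (h' : RunsLe Q s' s'' T') : RunsLe (P.seq Q) s s'' (T + T') := by
  obtain ⟨t, ht, h⟩ := h
  obtain ⟨t', ht', h'⟩ := h'
  exact ⟨t + t', by omega, .seq h h'⟩

theorem RunsLe.push {s s' : Store} {r : ℕ} {b : Bool}
    (h : Function.update s r (b :: s r) = s') : RunsLe (.push r b) s s' 1 :=
  ⟨1, le_rfl, h ▸ .push s r b⟩

theorem RunsLe.pop {s s' : Store} {r : ℕ} (h : Function.update s r (s r).tail = s') :
    RunsLe (.pop r) s s' 1 :=
  ⟨1, le_rfl, h ▸ .pop s r⟩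

theorem RunsLe.ite_pos {P Q : Prog} {s s' : Store} {r : ℕ} {c : Option Bool} {T : ℕ}
    (hc : (s r).head? = c) (h : RunsLe P s s' T) : RunsLe (.ite r c P Q) s s' (T + 1) := by
  obtain ⟨t, ht, h⟩ := h
  exact ⟨t + 1, by omega, .iteTrue hc h⟩

theorem RunsLe.ite_neg {P Q : Prog} {s s' : Store} {r : ℕ} {c : Option Bool} {T : ℕ}
    (hc : (s r).head? ≠ c) (h : RunsLe Q s s' T) : RunsLe (.ite r c P Q) s s' (T + 1) := by
  obtain ⟨t, ht, h⟩ := h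
  exact ⟨t + 1, by omega, .iteFalse hc h⟩

theorem RunsLe.loop {P : Prog} {r : ℕ} {c : Option Bool} {B : ℕ} (n : ℕ) (ψ : ℕ → Store)
    (hc : ∀ i < n, (ψ i r).head? ≠ c) (hend : (ψ n r).head? = c)
    (h : ∀ i < n, RunsLe P (ψ i) (ψ (i + 1)) B) :
    RunsLe (.loop r c P) (ψ 0) (ψ n) (n * (B + 1) + 1) := by
  induction n generalizing ψ with
  | zero => exact ⟨1, by omega, .loopStop hend⟩
  | succ n ih =>
    obtain ⟨t, ht, h1⟩ := h 0 (by omega)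
    obtain ⟨t', ht', h2⟩ := ih (fun i => ψ (i + 1)) (fun i hi => hc (i + 1) (by omega)) hend
      (fun i hi => h (i + 1) (by omega))
    refine ⟨t + t' + 1, ?_, .loopStep (hc 0 (by omega)) h1 h2⟩
    have : (n + 1) * (B + 1) = n * (B + 1) + (B + 1) := by ring
    omega

/-- Move a stack to another one, in reverse order. -/
def moveStack (a b : ℕ) : Prog :=
  .loop a none (.ite a (some true) ((Prog.push b true).seq (.pop a))
    ((Prog.push b false).seq (.pop a)))

theorem runsLe_moveStack {a b : ℕ} (hab : a ≠ b) (s : Store) :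
    RunsLe (moveStack a b) s
      (Function.update (Function.update s b ((s a).reverse ++ s b)) a []) (5 * (s a).length + 1) := by
  generalize hL : s a = L
  induction L generalizing s with
  | nil =>
    refine ⟨1, by simp, ?_⟩
    have : Function.update (Function.update s b (([] : List Bool).reverse ++ s b)) a [] = s := by
      rw [List.reverse_nil, List.nil_append, Function.update_eq_self, ← hL,
        Function.update_eq_self]
    rw [this]
    exact .loopStop (by simp [hL])
  | cons x L ih =>
    set s' := Function.update (Function.update s b (x :: s b)) a L with hs'
    have h1 : RunsLe (.ite a (some true) ((Prog.push b true).seq (.pop a))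
        ((Prog.push b false).seq (.pop a))) s s' 3 := by
      have hp : ∀ x', x = x' → RunsLe ((Prog.push b x').seq (.pop a)) s s' 2 := by
        rintro _ rfl
        exact (RunsLe.push rfl).seq (RunsLe.pop (by rw [hs']; simp [hab, hL]))
      cases x with
      | true => exact RunsLe.ite_pos (by simp [hL]) (hp _ rfl)
      | false => exact RunsLe.ite_neg (by simp [hL]) (hp _ rfl)
    obtain ⟨t, ht, h1⟩ := h1
    obtain ⟨t', ht', h2⟩ := ih s' (by simp [hs'])
    refine ⟨t + t' + 1, by simp only [List.length_cons]; omega, .loopStep (by simp [hL]) h1 ?_⟩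
    have e : Function.update (Function.update s b ((x :: L).reverse ++ s b)) a [] =
        Function.update (Function.update s' b (L.reverse ++ s' b)) a [] := ?_
    · rw [e]; exact h2
    rw [hs']
    ext1 r
    by_cases hr : r = a
    · subst hr; simp
    · by_cases hr' : r = b
      · subst hr'; simp [hr]
      · simp [hr, hr']

/-- A step pushes at most one bit. Time bounds thereby also bound the values and circuit sizes that
a program outputs. -/
theorem Runs.length_le {P : Prog} {s s' : Store} {t : ℕ} (h : Runs P s s' t) (r : ℕ) :
    (s' r).length ≤ (s r).length + t := by
  induction h with
  | skip => omega
  | push s q b =>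
    by_cases hr : r = q
    · subst hr; simp
    · simp [hr]
  | pop s q =>
    by_cases hr : r = q
    · subst hr; simp only [Function.update_self, List.length_tail]; omega
    · simp [hr]
  | seq _ _ ih ih' => omega
  | iteTrue _ _ ih => omega
  | iteFalse _ _ ih => omega
  | loopStop => omega
  | loopStep _ _ _ ih ih' => omega

/-- Renaming of the stacks of a program. -/
def Prog.rename (f : ℕ → ℕ) : Prog → Prog
  | .skip => .skip
  | .push r b => .push (f r) b
  | .pop r => .pop (f r)
  | .seq P Q => .seq (P.rename f) (Q.rename f)
  | .ite r c P Q => .ite (f r) c (P.rename f) (Q.rename f)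
  | .loop r c P => .loop (f r) c (P.rename f)

/-- Lets several programs run in one machine on disjoint families of stacks. -/
theorem Runs.rename {f : ℕ → ℕ} (hf : Function.Injective f) {P : Prog} {s s' : Store} {t : ℕ}
    (h : Runs P s s' t) : ∀ S : Store, (∀ r, S (f r) = s r) →
      ∃ S' : Store, Runs (P.rename f) S S' t ∧ (∀ r, S' (f r) = s' r) ∧
        ∀ r, (∀ q, f q ≠ r) → S' r = S r := by
  have upd : ∀ (S : Store) (s : Store) (q : ℕ) (L : List Bool), (∀ r, S (f r) = s r) →
      (∀ r, Function.update S (f q) L (f r) = Function.update s q L r) ∧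
        ∀ r, (∀ q, f q ≠ r) → Function.update S (f q) L r = S r := by
    intro S s q L hS
    constructor
    · intro r
      by_cases hr : r = q
      · subst hr; simp
      · rw [Function.update_of_ne (fun e => hr (hf e)), Function.update_of_ne hr, hS]
    · intro r hr
      rw [Function.update_of_ne (hr q).symm]
  induction h with
  | skip s => exact fun S hS => ⟨S, .skip S, hS, fun _ _ => rfl⟩
  | push s q b =>
    intro S hS
    have := upd S s q (b :: s q) hS
    exact ⟨_, .push S (f q) b, by rw [hS]; exact this.1, by rw [hS]; exact this.2⟩
  | pop s q =>
    intro S hS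
    have := upd S s q (s q).tail hS
    exact ⟨_, .pop S (f q), by rw [hS]; exact this.1, by rw [hS]; exact this.2⟩
  | seq _ _ ih ih' =>
    intro S hS
    obtain ⟨S₁, h1, h2, h3⟩ := ih S hS
    obtain ⟨S₂, h4, h5, h6⟩ := ih' S₁ h2
    exact ⟨S₂, .seq h1 h4, h5, fun r hr => (h6 r hr).trans (h3 r hr)⟩
  | iteTrue hc _ ih =>
    intro S hS
    obtain ⟨S₁, h1, h2, h3⟩ := ih S hS
    exact ⟨S₁, .iteTrue (by rw [hS]; exact hc) h1, h2, h3⟩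
  | iteFalse hc _ ih =>
    intro S hS
    obtain ⟨S₁, h1, h2, h3⟩ := ih S hS
    exact ⟨S₁, .iteFalse (by rw [hS]; exact hc) h1, h2, h3⟩
  | loopStop hc => exact fun S hS => ⟨S, .loopStop (by rw [hS]; exact hc), hS, fun _ _ => rfl⟩
  | loopStep hc _ _ ih ih' =>
    intro S hS
    obtain ⟨S₁, h1, h2, h3⟩ := ih S hS
    obtain ⟨S₂, h4, h5, h6⟩ := ih' S₁ h2
    exact ⟨S₂, .loopStep (by rw [hS]; exact hc) h1 h4, h5, fun r hr => (h6 r hr).trans (h3 r hr)⟩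

/-! ## Programs that write bit strings -/

/-- The store with output `o` (reversed), data `d`, two auxiliary stacks, and numbers in unary. -/
def st (o d x y : List Bool) (L : List ℕ) : Store
  | 0 => o
  | 1 => d
  | 2 => x
  | 3 => y
  | k + 4 => List.replicate (L.getD k 0) true

theorem st_update_zero (o d x y o' : List Bool) (L : List ℕ) :
    Function.update (st o d x y L) 0 o' = st o' d x y L := by
  ext1 r; rcases r with _ | _ | _ | _ | k <;> rfl

theorem st_update_one (o d x y d' : List Bool) (L : List ℕ) :
    Function.update (st o d x y L) 1 d' = st o d' x y L := by
  ext1 r; rcases r with _ | _ | _ | _ | k <;> rfl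

theorem st_update_two (o d x y x' : List Bool) (L : List ℕ) :
    Function.update (st o d x y L) 2 x' = st o d x' y L := by
  ext1 r; rcases r with _ | _ | _ | _ | k <;> rfl

theorem st_update_three (o d x y y' : List Bool) (L : List ℕ) :
    Function.update (st o d x y L) 3 y' = st o d x y' L := by
  ext1 r; rcases r with _ | _ | _ | _ | k <;> rfl

/-- Numbers that are not listed count as 0, that is, as empty stacks; entering or leaving a loop
scope with cleared counters therefore does not change the store. -/
theorem st_append_zero (o d x y : List Bool) (L : List ℕ) :
    st o d x y (L ++ [0, 0]) = st o d x y L := by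
  ext1 r
  rcases r with _ | _ | _ | _ | k
  iterate 4 rfl
  simp only [st]
  congr 1
  rcases lt_or_ge k L.length with h | h
  · rw [List.getD_append _ _ _ _ h]
  · rw [List.getD_append_right _ _ _ _ h, List.getD_eq_default _ _ h]
    rcases k - L.length with _ | _ | m <;> rfl

theorem st_apply_fst (o d x y : List Bool) (L : List ℕ) (i c : ℕ) :
    st o d x y (L ++ [i, c]) (L.length + 4) = List.replicate i true := by
  simp [st]

theorem st_apply_snd (o d x y : List Bool) (L : List ℕ) (i c : ℕ) :
    st o d x y (L ++ [i, c]) (L.length + 5) = List.replicate c true := by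
  simp [st]

theorem st_update_fst (o d x y : List Bool) (L : List ℕ) (i c i' : ℕ) :
    Function.update (st o d x y (L ++ [i, c])) (L.length + 4) (List.replicate i' true) =
      st o d x y (L ++ [i', c]) := by
  ext1 r
  by_cases hr : r = L.length + 4
  · subst hr; rw [Function.update_self, st_apply_fst]
  · rw [Function.update_of_ne hr]
    rcases r with _ | _ | _ | _ | k
    iterate 4 rfl
    simp only [st]
    congr 1
    rcases lt_or_ge k L.length with h | h
    · rw [List.getD_append _ _ _ _ h, List.getD_append _ _ _ _ h]
    · obtain ⟨m, rfl⟩ := Nat.exists_eq_add_of_le h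
      rw [List.getD_append_right _ _ _ _ h, List.getD_append_right _ _ _ _ h,
        Nat.add_sub_cancel_left]
      cases m with
      | zero => simp at hr
      | succ m => rfl

theorem st_update_snd (o d x y : List Bool) (L : List ℕ) (i c c' : ℕ) :
    Function.update (st o d x y (L ++ [i, c])) (L.length + 5) (List.replicate c' true) =
      st o d x y (L ++ [i, c']) := by
  ext1 r
  by_cases hr : r = L.length + 5
  · subst hr; rw [Function.update_self, st_apply_snd]
  · rw [Function.update_of_ne hr]
    rcases r with _ | _ | _ | _ | k
    iterate 4 rfl
    simp only [st]
    congr 1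
    rcases lt_or_ge k L.length with h | h
    · rw [List.getD_append _ _ _ _ h, List.getD_append _ _ _ _ h]
    · obtain ⟨m, rfl⟩ := Nat.exists_eq_add_of_le h
      rw [List.getD_append_right _ _ _ _ h, List.getD_append_right _ _ _ _ h,
        Nat.add_sub_cancel_left]
      rcases m with _ | _ | m
      · rfl
      · simp at hr
      · rfl

/-- The counters of an upward or a downward loop, after `i` iterations with `c` to come. -/
def counters (up : Bool) (i c : ℕ) : List ℕ := if up then [i, c] else [c, i]

theorem st_append_counters (up : Bool) (o d x y : List Bool) (L : List ℕ) :
    st o d x y (L ++ counters up 0 0) = st o d x y L := by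
  cases up <;> exact st_append_zero o d x y L

theorem st_apply_done (up : Bool) (o d x y : List Bool) (L : List ℕ) (i c : ℕ) :
    st o d x y (L ++ counters up i c) (L.length + (bif up then 4 else 5)) =
      List.replicate i true := by
  cases up
  · exact st_apply_snd o d x y L c i
  · exact st_apply_fst o d x y L i c

theorem st_apply_todo (up : Bool) (o d x y : List Bool) (L : List ℕ) (i c : ℕ) :
    st o d x y (L ++ counters up i c) (L.length + (bif up then 5 else 4)) =
      List.replicate c true := by
  cases up
  · exact st_apply_fst o d x y L c i
  · exact st_apply_snd o d x y L i c

theorem st_update_done (up : Bool) (o d x y : List Bool) (L : List ℕ) (i c i' : ℕ) :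
    Function.update (st o d x y (L ++ counters up i c)) (L.length + (bif up then 4 else 5))
      (List.replicate i' true) = st o d x y (L ++ counters up i' c) := by
  cases up
  · exact st_update_snd o d x y L c i i'
  · exact st_update_fst o d x y L i c i'

theorem st_update_todo (up : Bool) (o d x y : List Bool) (L : List ℕ) (i c c' : ℕ) :
    Function.update (st o d x y (L ++ counters up i c)) (L.length + (bif up then 5 else 4))
      (List.replicate c' true) = st o d x y (L ++ counters up i c') := by
  cases up
  · exact st_update_fst o d x y L c i c'
  · exact st_update_snd o d x y L i c c'

/-- The numbers and the data that a program can use, depending on parameters in `Γ`. -/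
structure Scope (Γ : Type) where
  depth : ℕ
  env : Γ → List ℕ
  dat : Γ → List Bool
  length_env : ∀ γ, (env γ).length = depth

/-- The scope inside a loop: a counter and the number of remaining iterations are added. -/
def Scope.ext {Γ : Type} (σ : Scope Γ) : Scope (Γ × ℕ × ℕ) where
  depth := σ.depth + 2
  env γ := σ.env γ.1 ++ [γ.2.1, γ.2.2]
  dat γ := σ.dat γ.1
  length_env γ := by simp [σ.length_env]

/-- Some program writes `f γ` in polynomial time. -/
def Emit {Γ : Type} (σ : Scope Γ) (f : Γ → List Bool) : Prop :=
  ∃ (P : Prog) (q : Polynomial ℕ), ∀ (γ : Γ) (o : List Bool) (M : ℕ), (∀ x ∈ σ.env γ, x ≤ M) →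
    (σ.dat γ).length ≤ M →
    RunsLe P (st o (σ.dat γ) [] [] (σ.env γ)) (st ((f γ).reverse ++ o) (σ.dat γ) [] [] (σ.env γ))
      (q.eval M)

/-- Arithmetic expressions. -/
inductive Ex : Type
  | var : ℕ → Ex
  | const : ℕ → Ex
  | add : Ex → Ex → Ex
  | mul : Ex → Ex → Ex

def Ex.eval (L : List ℕ) : Ex → ℕ
  | .var k => L.getD k 0
  | .const n => n
  | .add a b => a.eval L + b.eval L
  | .mul a b => a.eval L * b.eval L

theorem Ex.eval_le (E : Ex) : ∃ b : Polynomial ℕ, ∀ (L : List ℕ) (M : ℕ), (∀ x ∈ L, x ≤ M) →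
    E.eval L ≤ b.eval M := by
  induction E with
  | var k =>
    refine ⟨Polynomial.X, fun L M h => ?_⟩
    rw [Polynomial.eval_X, Ex.eval]
    rcases lt_or_ge k L.length with hk | hk
    · rw [List.getD_eq_getElem _ _ hk]; exact h _ (List.getElem_mem hk)
    · rw [List.getD_eq_default _ _ hk]; omega
  | const n => exact ⟨Polynomial.C n, fun L M h => by simp [Ex.eval]⟩
  | add a b iha ihb =>
    obtain ⟨p, hp⟩ := iha
    obtain ⟨q, hq⟩ := ihb
    exact ⟨p + q, fun L M h => by
      rw [Polynomial.eval_add]; exact Nat.add_le_add (hp L M h) (hq L M h)⟩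
  | mul a b iha ihb =>
    obtain ⟨p, hp⟩ := iha
    obtain ⟨q, hq⟩ := ihb
    exact ⟨p * q, fun L M h => by
      rw [Polynomial.eval_mul]; exact Nat.mul_le_mul (hp L M h) (hq L M h)⟩

variable {Γ : Type} {σ : Scope Γ}

theorem Emit.congr {f g : Γ → List Bool} (h : Emit σ f) (e : ∀ γ, f γ = g γ) : Emit σ g :=
  (funext e : f = g) ▸ h

theorem Emit.nil : Emit σ fun _ => [] :=
  ⟨.skip, 1, fun γ o M _ _ => ⟨1, by simp, .skip _⟩⟩

theorem Emit.append {f g : Γ → List Bool} (hf : Emit σ f) (hg : Emit σ g) :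
    Emit σ fun γ => f γ ++ g γ := by
  obtain ⟨P, q, hP⟩ := hf
  obtain ⟨P', q', hP'⟩ := hg
  refine ⟨P.seq P', q + q', fun γ o M h1 h2 => ?_⟩
  have := (hP γ o M h1 h2).seq (hP' γ ((f γ).reverse ++ o) M h1 h2)
  rw [Polynomial.eval_add, List.reverse_append, List.append_assoc]
  exact this

theorem Emit.bit (b : Bool) : Emit σ fun _ => [b] :=
  ⟨.push 0 b, 1, fun γ o M _ _ => by
    rw [Polynomial.eval_one]
    exact RunsLe.push (st_update_zero _ _ _ _ _ _)⟩

theorem Emit.lit (L : List Bool) : Emit σ fun _ => L := by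
  induction L with
  | nil => exact Emit.nil
  | cons b L ih => exact (Emit.bit b).append ih

/-- The data are copied to the output and, reversed, to an auxiliary stack, from which they are
restored for later use. -/
theorem Emit.dat : Emit σ fun γ => σ.dat γ := by
  set B : Prog := .ite 1 (some true) ((Prog.push 0 true).seq ((Prog.push 2 true).seq (.pop 1)))
    ((Prog.push 0 false).seq ((Prog.push 2 false).seq (.pop 1))) with hB
  refine ⟨(Prog.loop 1 none B).seq (moveStack 2 1), 10 * Polynomial.X + 2, fun γ o M _ h => ?_⟩
  have h1 : ∀ (d x o : List Bool), RunsLe (Prog.loop 1 none B) (st o d x [] (σ.env γ))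
      (st (d.reverse ++ o) [] (d.reverse ++ x) [] (σ.env γ)) (5 * d.length + 1) := by
    intro d
    induction d with
    | nil => exact fun x o => ⟨1, by simp, .loopStop rfl⟩
    | cons b d ih =>
      intro x o
      have h2 : RunsLe B (st o (b :: d) x [] (σ.env γ)) (st (b :: o) d (b :: x) [] (σ.env γ)) 4 := by
        have hp : ∀ b', b = b' → RunsLe ((Prog.push 0 b').seq ((Prog.push 2 b').seq (.pop 1)))
            (st o (b :: d) x [] (σ.env γ)) (st (b :: o) d (b :: x) [] (σ.env γ)) 3 := by
          rintro _ rfl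
          exact (RunsLe.push (st_update_zero _ _ _ _ _ _)).seq
            ((RunsLe.push (st_update_two _ _ _ _ _ _)).seq (RunsLe.pop (st_update_one _ _ _ _ _ _)))
        cases b with
        | true => exact RunsLe.ite_pos rfl (hp _ rfl)
        | false => exact RunsLe.ite_neg (by simp [st]) (hp _ rfl)
      obtain ⟨t, ht, h2⟩ := h2
      obtain ⟨t', ht', h3⟩ := ih (b :: x) (b :: o)
      refine ⟨t + t' + 1, by simp only [List.length_cons]; omega, .loopStep (by simp [st]) h2 ?_⟩
      simpa using h3
  have h2 := (h1 (σ.dat γ) [] o).seq (runsLe_moveStack (a := 2) (b := 1) (by norm_num) _)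
  rw [st_update_one, st_update_two] at h2
  simp only [st, List.append_nil, List.reverse_reverse, List.length_reverse] at h2
  refine h2.mono ?_
  simp only [Polynomial.eval_add, Polynomial.eval_mul, Polynomial.eval_X, Polynomial.eval_ofNat]
  omega

/-- The iterations of a loop in upward or downward order. -/
def loopDir {α : Type*} (up : Bool) (n : ℕ) (g : ℕ → ℕ → List α) : List α :=
  (List.range n).flatMap fun i => bif up then g i (n - 1 - i) else g (n - 1 - i) i

/-- Numbers that a program can compute in unary. -/
def IsExpr (σ : Scope Γ) (e : Γ → ℕ) : Prop := ∃ E : Ex, ∀ γ δ, E.eval (σ.env γ ++ δ) = e γ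

/-- The iteration count is first written in unary on the output stack, above a separating `false`,
and transferred to a counter stack. Each iteration then moves one unit from the "to do" counter to
the "done" counter, so the body always sees both; the exchanged roles of the two counters give the
downward loop. -/
theorem Emit.loop_of_unary (up : Bool) {e : Γ → ℕ} {g : Γ → ℕ → ℕ → List Bool}
    (he : Emit σ fun γ => List.replicate (e γ) true) {b : Polynomial ℕ}
    (hb : ∀ γ M, (∀ x ∈ σ.env γ, x ≤ M) → e γ ≤ b.eval M)
    (hg : Emit σ.ext fun γ => g γ.1 γ.2.1 γ.2.2) : Emit σ fun γ => loopDir up (e γ) (g γ) := by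
  obtain ⟨P, q, hP⟩ := he
  obtain ⟨P', q', hP'⟩ := hg
  set D := σ.depth
  set A := D + (bif up then 4 else 5) with hA
  set B := D + (bif up then 5 else 4) with hB
  refine ⟨(Prog.push 0 false).seq (P.seq ((Prog.loop 0 (some false)
    ((Prog.pop 0).seq (.push B true))).seq ((Prog.pop 0).seq ((Prog.loop B none
      ((Prog.pop B).seq (P'.seq (.push A true)))).seq
        (.loop A none (.pop A)))))),
    -- Inside the loop the counters can be as large as `b(M)`, so the body is charged at `M + b(M)`.
    1 + (q + (b * 3 + 1 + (1 + (b * (q'.comp (Polynomial.X + b) + 3) + 1 + (b * 2 + 1))))),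
    fun γ o M hM hd => ?_⟩
  set n := e γ with hn
  have hD : (σ.env γ).length = D := σ.length_env γ
  have hnb := hb γ M hM
  set d := σ.dat γ
  set L := σ.env γ
  have h1 : RunsLe (.push 0 false) (st o d [] [] L) (st (false :: o) d [] [] L) 1 :=
    RunsLe.push (st_update_zero _ _ _ _ _ _)
  have h2 := hP γ (false :: o) M hM hd
  rw [List.reverse_replicate, ← hn] at h2
  have h3 : RunsLe (.loop 0 (some false) ((Prog.pop 0).seq (.push B true)))
      (st (List.replicate n true ++ false :: o) d [] [] L)
      (st (false :: o) d [] [] (L ++ counters up (0) (n))) (n * 3 + 1) := by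
    have := RunsLe.loop (P := (Prog.pop 0).seq (.push B true)) (r := 0) (c := some false)
      (B := 2) n (fun i => st (List.replicate (n - i) true ++ false :: o) d [] [] (L ++ counters up (0) (i)))
      (fun i hi => by
        obtain ⟨m, hm⟩ := Nat.exists_eq_succ_of_ne_zero (show n - i ≠ 0 by omega)
        simp [st, hm, List.replicate_succ]) (by simp [st])
      (fun i hi => by
        obtain ⟨m, hm⟩ := Nat.exists_eq_succ_of_ne_zero (show n - i ≠ 0 by omega)
        rw [hm, show n - (i + 1) = m by omega]
        refine (RunsLe.pop (st_update_zero _ _ _ _ _ _)).seq (T := 1) (T' := 1) ?_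
        refine RunsLe.push ?_
        rw [hB, ← hD, st_apply_todo, ← List.replicate_succ, st_update_todo]
        rfl)
    simp only [Nat.sub_zero, st_append_counters, Nat.sub_self, List.replicate_zero,
      List.nil_append] at this
    exact this
  have h4 : RunsLe (.pop 0) (st (false :: o) d [] [] (L ++ counters up (0) (n)))
      (st o d [] [] (L ++ counters up (0) (n))) 1 := RunsLe.pop (st_update_zero _ _ _ _ _ _)
  have h5 : RunsLe (.loop B none ((Prog.pop B).seq (P'.seq (.push A true))))
      (st o d [] [] (L ++ counters up (0) (n)))
      (st ((loopDir up n (g γ)).reverse ++ o) d [] [] (L ++ counters up (n) (0)))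
      (n * (q'.eval (M + b.eval M) + 3) + 1) := by
    have := RunsLe.loop (P := (Prog.pop B).seq (P'.seq (.push A true)))
      (r := B) (c := none) (B := q'.eval (M + b.eval M) + 2) n
      (fun i => st (((List.range i).flatMap fun i =>
        bif up then g γ i (n - 1 - i) else g γ (n - 1 - i) i).reverse ++ o) d [] []
        (L ++ counters up (i) (n - i)))
      (fun i hi => by
        obtain ⟨m, hm⟩ := Nat.exists_eq_succ_of_ne_zero (show n - i ≠ 0 by omega)
        rw [hB, ← hD, st_apply_todo, hm]; simp [List.replicate_succ])
      (by rw [hB, ← hD, st_apply_todo]; simp)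
      (fun i hi => by
        obtain ⟨m, hm⟩ := Nat.exists_eq_succ_of_ne_zero (show n - i ≠ 0 by omega)
        have e1 : n - 1 - i = m := by omega
        rw [hm, show n - (i + 1) = m by omega, flatMap_range_succ, e1]
        have h6 := hP' (γ, bif up then i else m, bif up then m else i)
          (((List.range i).flatMap fun i =>
            bif up then g γ i (n - 1 - i) else g γ (n - 1 - i) i).reverse ++ o) (M + b.eval M)
          (by
            intro x hx
            simp only [Scope.ext, List.mem_append, List.mem_cons, List.not_mem_nil, or_false] at hx
            rcases hx with hx | rfl | rfl
            · have := hM x hx; omega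
            · cases up <;> simp only [cond_true, cond_false] <;> omega
            · cases up <;> simp only [cond_true, cond_false] <;> omega)
          (by simp only [Scope.ext]; exact Nat.le_add_right_of_le hd)
        have e2 : (σ.ext).env (γ, bif up then i else m, bif up then m else i) =
            L ++ counters up i m := by cases up <;> rfl
        have e3 : g γ (bif up then i else m) (bif up then m else i) =
            bif up then g γ i m else g γ m i := by cases up <;> rfl
        rw [e2] at h6
        simp only [Scope.ext, e3] at h6
        refine ((RunsLe.pop ?_).seq (h6.seq (RunsLe.push ?_))).mono (T := 1 + (_ + 1)) (by omega)
        · rw [hB, ← hD, st_apply_todo, List.replicate_succ, List.tail_cons, st_update_todo]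
        · rw [hA, ← hD, st_apply_done, ← List.replicate_succ, st_update_done, List.reverse_append,
            List.append_assoc])
    simp only [Nat.sub_zero, Nat.sub_self] at this
    exact this
  have h6 : ∀ o', RunsLe (.loop A none (.pop A)) (st o' d [] [] (L ++ counters up (n) (0)))
      (st o' d [] [] L) (n * 2 + 1) := by
    intro o'
    have := RunsLe.loop (P := Prog.pop A) (r := A) (c := none)
      (B := 1) n (fun i => st o' d [] [] (L ++ counters up (n - i) (0)))
      (fun i hi => by
        obtain ⟨m, hm⟩ := Nat.exists_eq_succ_of_ne_zero (show n - i ≠ 0 by omega)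
        rw [hA, ← hD, st_apply_done, hm]; simp [List.replicate_succ])
      (by rw [hA, ← hD, st_apply_done]; simp)
      (fun i hi => by
        obtain ⟨m, hm⟩ := Nat.exists_eq_succ_of_ne_zero (show n - i ≠ 0 by omega)
        refine RunsLe.pop ?_
        rw [hm, show n - (i + 1) = m by omega, hA, ← hD, st_apply_done, List.replicate_succ,
          List.tail_cons, st_update_done])
    simp only [Nat.sub_zero, Nat.sub_self, st_append_counters] at this
    exact this
  refine (h1.seq (h2.seq (h3.seq (h4.seq (h5.seq (h6 _)))))).mono ?_
  simp only [Polynomial.eval_add, Polynomial.eval_mul, Polynomial.eval_one, Polynomial.eval_comp,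
    Polynomial.eval_X, Polynomial.eval_ofNat]
  gcongr

/-- A product is written by a loop over one factor, inside which the environment is longer.
Evaluating in the first `k` entries keeps the other factor from seeing the loop counters. -/
theorem Emit.unary_of_ex (E : Ex) : ∀ {Γ : Type} (σ : Scope Γ) (k : ℕ), k ≤ σ.depth →
    Emit σ fun γ => List.replicate (E.eval ((σ.env γ).take k)) true := by
  induction E with
  | var m =>
    intro Γ σ k hk
    change Emit σ fun γ => List.replicate (((σ.env γ).take k).getD m 0) true
    set B : Prog := (Prog.push 0 true).seq ((Prog.push 2 true).seq (.pop (m + 4))) with hB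
    by_cases hmk : m < k
    swap
    · refine Emit.nil.congr fun γ => ?_
      rw [List.getD_eq_default _ _ (by simp; omega)]; rfl
    refine ⟨(Prog.loop (m + 4) none B).seq (Prog.loop 2 none
      ((Prog.pop 2).seq (.push (m + 4) true))), 7 * Polynomial.X + 2, fun γ o M hM _ => ?_⟩
    have hD := σ.length_env γ
    have hm : m < (σ.env γ).length := by omega
    set L := σ.env γ
    set d := σ.dat γ
    have hE : (L.take k).getD m 0 = L.getD m 0 := by
      rw [List.getD_eq_getElem _ _ (by simp; omega), List.getD_eq_getElem _ _ hm,
        List.getElem_take]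
    have hnM : L.getD m 0 ≤ M := by
      rw [List.getD_eq_getElem _ _ hm]; exact hM _ (List.getElem_mem hm)
    have hE' : ((σ.env γ).take k).getD m 0 = L.getD m 0 := hE
    beta_reduce
    rw [hE', List.reverse_replicate]
    have hself : L.set m (L.getD m 0) = L := by
      rw [List.getD_eq_getElem _ _ hm, List.set_getElem_self]
    set n := L.getD m 0
    have hget : ∀ o x i, st o d x [] (L.set m i) (m + 4) = List.replicate i true := by
      intro o x i
      simp only [st]
      rw [getD_set L hm, if_pos rfl]
    have hset : ∀ o x i i', Function.update (st o d x [] (L.set m i)) (m + 4)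
        (List.replicate i' true) = st o d x [] (L.set m i') := by
      intro o x i i'
      ext1 r
      rcases r with _ | _ | _ | _ | r
      iterate 4 rfl
      by_cases hr : r = m
      · subst hr; rw [Function.update_self, hget]
      · rw [Function.update_of_ne (by omega)]
        simp only [st]
        rw [getD_set L hm, getD_set L hm, if_neg hr, if_neg hr]
    have h1 := RunsLe.loop (P := B) (r := m + 4) (c := none) (B := 3) n
      (fun i => st (List.replicate i true ++ o) d (List.replicate i true) [] (L.set m (n - i)))
      (fun i hi => by
        obtain ⟨j, hj⟩ := Nat.exists_eq_succ_of_ne_zero (show n - i ≠ 0 by omega)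
        rw [hget, hj]; simp [List.replicate_succ]) (by rw [hget]; simp)
      (fun i hi => by
        obtain ⟨j, hj⟩ := Nat.exists_eq_succ_of_ne_zero (show n - i ≠ 0 by omega)
        rw [hj, show n - (i + 1) = j by omega]
        refine (RunsLe.push (st_update_zero _ _ _ _ _ _)).seq (T := 1) (T' := 2)
          ((RunsLe.push (st_update_two _ _ _ _ _ _)).seq (T := 1) (T' := 1) (RunsLe.pop ?_))
        rw [hget, List.replicate_succ, List.tail_cons, hset]
        rfl)
    have h2 := RunsLe.loop (P := (Prog.pop 2).seq (.push (m + 4) true)) (r := 2) (c := none)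
      (B := 2) n
      (fun i => st (List.replicate n true ++ o) d (List.replicate (n - i) true) [] (L.set m i))
      (fun i hi => by
        obtain ⟨j, hj⟩ := Nat.exists_eq_succ_of_ne_zero (show n - i ≠ 0 by omega)
        simp [st, hj, List.replicate_succ]) (by simp [st])
      (fun i hi => by
        obtain ⟨j, hj⟩ := Nat.exists_eq_succ_of_ne_zero (show n - i ≠ 0 by omega)
        rw [hj, show n - (i + 1) = j by omega]
        refine (RunsLe.pop (st_update_two _ _ _ _ _ _)).seq (T := 1) (T' := 1) (RunsLe.push ?_)
        rw [hget, ← List.replicate_succ, hset]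
        rfl)
    simp only [Nat.sub_self, Nat.sub_zero, List.replicate_zero, hself, List.nil_append] at h1 h2
    refine (h1.seq h2).mono ?_
    simp only [Polynomial.eval_add, Polynomial.eval_mul, Polynomial.eval_X, Polynomial.eval_ofNat]
    omega
  | const n => exact fun σ k _ => Emit.lit (List.replicate n true)
  | add a b iha ihb =>
    intro Γ σ k hk
    refine ((iha σ k hk).append (ihb σ k hk)).congr fun γ => ?_
    rw [← List.replicate_add]; rfl
  | mul a b iha ihb =>
    intro Γ σ k hk
    obtain ⟨q, hq⟩ := a.eval_le
    have hb := (ihb σ.ext k (Nat.le_add_right_of_le hk)).congr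
      (g := fun γ => List.replicate (b.eval ((σ.env γ.1).take k)) true) fun γ => by
        rw [Scope.ext, List.take_append_of_le_length]
        rw [σ.length_env]; exact hk
    refine (Emit.loop_of_unary true (g := fun γ _ _ => List.replicate (b.eval ((σ.env γ).take k)) true)
      (iha σ k hk) (fun γ M h => hq _ M fun x hx =>
      h x (List.mem_of_mem_take hx)) hb).congr fun γ => ?_
    simp only [loopDir, cond_true]
    rw [List.flatMap_def, List.map_const', List.length_range, List.flatten_replicate_replicate]
    rfl

theorem Emit.unary {e : Γ → ℕ} (he : IsExpr σ e) : Emit σ fun γ => List.replicate (e γ) true := by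
  obtain ⟨E, hE⟩ := he
  refine (Emit.unary_of_ex E σ σ.depth le_rfl).congr fun γ => ?_
  have := hE γ []
  rw [List.append_nil] at this
  rw [← σ.length_env γ, List.take_length, this]

theorem Emit.loopDir (up : Bool) {e : Γ → ℕ} {g : Γ → ℕ → ℕ → List Bool} (he : IsExpr σ e)
    (hg : Emit σ.ext fun γ => g γ.1 γ.2.1 γ.2.2) :
    Emit σ fun γ => QExpand.loopDir up (e γ) (g γ) := by
  have h := Emit.unary he
  obtain ⟨E, hE⟩ := he
  obtain ⟨b, hb⟩ := E.eval_le
  refine Emit.loop_of_unary up h (b := b) (fun γ M hM => ?_) hg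
  have := hE γ []
  rw [List.append_nil] at this
  rw [← this]
  exact hb _ M hM

end QExpand
namespace QExpand

/-! ## Expressions -/

variable {Γ : Type} {σ : Scope Γ}

theorem IsExpr.const (n : ℕ) : IsExpr σ fun _ => n := ⟨.const n, fun _ _ => rfl⟩

theorem IsExpr.add {e f : Γ → ℕ} (he : IsExpr σ e) (hf : IsExpr σ f) :
    IsExpr σ fun γ => e γ + f γ := by
  obtain ⟨E, hE⟩ := he
  obtain ⟨F, hF⟩ := hf
  exact ⟨.add E F, fun γ δ => by rw [Ex.eval, hE, hF]⟩

theorem IsExpr.mul {e f : Γ → ℕ} (he : IsExpr σ e) (hf : IsExpr σ f) :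
    IsExpr σ fun γ => e γ * f γ := by
  obtain ⟨E, hE⟩ := he
  obtain ⟨F, hF⟩ := hf
  exact ⟨.mul E F, fun γ δ => by rw [Ex.eval, hE, hF]⟩

theorem IsExpr.succ {e : Γ → ℕ} (he : IsExpr σ e) : IsExpr σ fun γ => e γ + 1 := he.add (.const 1)

theorem IsExpr.poly (q : Polynomial ℕ) {e : Γ → ℕ} (he : IsExpr σ e) :
    IsExpr σ fun γ => q.eval (e γ) := by
  induction q using Polynomial.induction_on' with
  | add p q hp hq => simpa only [Polynomial.eval_add] using hp.add hq
  | monomial n a =>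
    simp only [Polynomial.eval_monomial]
    refine (IsExpr.const a).mul ?_
    induction n with
    | zero => simpa using IsExpr.const 1
    | succ n ih => simpa only [pow_succ] using ih.mul he

/-- The expression ignores entries appended to the environment by the quantifier over `δ` in
`IsExpr`, so the same one works in the inner scope. -/
theorem IsExpr.ext {e : Γ → ℕ} (he : IsExpr σ e) : IsExpr σ.ext fun γ => e γ.1 := by
  obtain ⟨E, hE⟩ := he
  exact ⟨E, fun γ δ => by rw [Scope.ext, List.append_assoc, hE]⟩

theorem IsExpr.counter : IsExpr σ.ext fun γ => γ.2.1 :=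
  ⟨.var σ.depth, fun γ δ => by
    rw [Scope.ext, Ex.eval, List.append_assoc, List.getD_append_right _ _ _ _ (σ.length_env _).le,
      σ.length_env, Nat.sub_self]; rfl⟩

theorem IsExpr.rest : IsExpr σ.ext fun γ => γ.2.2 :=
  ⟨.var (σ.depth + 1), fun γ δ => by
    rw [Scope.ext, Ex.eval, List.append_assoc,
      List.getD_append_right _ _ _ _ ((σ.length_env _).le.trans (Nat.le_succ _)),
      σ.length_env, show σ.depth.succ - σ.depth = 1 by omega]; rfl⟩

/-! ## Writing numbers -/

theorem Emit.encUnary {e : Γ → ℕ} (he : IsExpr σ e) : Emit σ fun γ => QExpand.encUnary (e γ) :=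
  (Emit.unary he).append (Emit.lit [false])

/-- Halve the number on stack 2; a bit on stack 3 records the remainder 1. -/
def halve : Prog :=
  .loop 2 none ((Prog.pop 2).seq (.ite 2 none (.push 3 false) ((Prog.pop 2).seq (.push 3 true))))

theorem runsLe_halve (o d : List Bool) (L : List ℕ) (n j : ℕ) :
    RunsLe halve (st o d (List.replicate n true) (List.replicate j true) L)
      (st o d [] ((if n % 2 = 1 then [false] else []) ++ List.replicate (j + n / 2) true) L)
      (5 * n + 1) := by
  induction n using Nat.strong_induction_on generalizing j with
  | _ n ih =>
    match n, ih with
    | 0, _ => exact ⟨1, by omega, .loopStop rfl⟩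
    | 1, _ =>
      have h1 := (RunsLe.pop (r := 2) (st_update_two o d [true] (List.replicate j true) [] L)).seq
        (T := 1) (T' := 2) (RunsLe.ite_pos (r := 2) (c := none) (Q := (Prog.pop 2).seq (.push 3 true)) rfl
          (RunsLe.push (r := 3) (b := false) (st_update_three _ _ _ _ _ _)))
      obtain ⟨t, ht, h1⟩ := h1
      exact ⟨t + 1 + 1, by omega, .loopStep (by simp [st]) h1 (.loopStop rfl)⟩
    | n + 2, ih =>
      have h1 := (RunsLe.pop (r := 2) (st_update_two o d (List.replicate (n + 2) true)
        (List.replicate j true) (List.replicate (n + 1) true) L)).seq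
        (T := 1) (T' := 3) (RunsLe.ite_neg (P := .push 3 false) (c := none) (r := 2)
          (by simp [st, List.replicate_succ])
          ((RunsLe.pop (r := 2) (s' := st o d (List.replicate n true) (List.replicate j true) L)
            (st_update_two _ _ _ _ _ _)).seq
            (RunsLe.push (r := 3) (b := true) (st_update_three _ _ _ _ _ _))))
      obtain ⟨t, ht, h1⟩ := h1
      obtain ⟨t', ht', h2⟩ := ih n (by omega) (j + 1)
      refine ⟨t + t' + 1, by omega, .loopStep (by simp [st, List.replicate_succ]) h1 ?_⟩
      rw [show (n + 2) % 2 = n % 2 by omega, show j + (n + 2) / 2 = j + 1 + n / 2 by omega]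
      exact h2

/-- Write the bits of the number on stack 2. -/
def writeBits : Prog :=
  .loop 2 none (halve.seq ((Prog.push 0 true).seq ((Prog.ite 3 (some false)
    ((Prog.pop 3).seq (.push 0 true)) (.push 0 false)).seq (moveStack 3 2))))

/-- Each round halves the number on stack 2, and the remainder mark left on top of stack 3 is the
bit to be written, least significant first. -/
theorem runsLe_writeBits (d : List Bool) (L : List ℕ) (n : ℕ) (o : List Bool) :
    RunsLe writeBits (st o d (List.replicate n true) [] L)
      (st ((n.bits.flatMap fun b => [true, b]).reverse ++ o) d [] [] L) (n * (10 * n + 7) + 1) := by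
  induction n using Nat.strong_induction_on generalizing o with
  | _ n ih =>
    rcases Nat.eq_zero_or_pos n with rfl | hn
    · exact ⟨1, by omega, .loopStop rfl⟩
    have h1 := runsLe_halve o d L n 0
    rw [zero_add] at h1
    set y := (if n % 2 = 1 then [false] else []) ++ List.replicate (n / 2) true with hy
    have h2 : RunsLe (.push 0 true) (st o d [] y L) (st (true :: o) d [] y L) 1 :=
      RunsLe.push (st_update_zero _ _ _ _ _ _)
    have h3 : RunsLe (.ite 3 (some false) ((Prog.pop 3).seq (.push 0 true)) (.push 0 false))
        (st (true :: o) d [] y L)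
        (st (n.bodd :: true :: o) d [] (List.replicate (n / 2) true) L) 3 := by
      rcases Nat.mod_two_eq_zero_or_one n with h | h
      · have hb : n.bodd = false := by rw [Nat.mod_two_of_bodd] at h; simpa using h
        have hy' : y = List.replicate (n / 2) true := by rw [hy, h]; simp
        rw [hb, hy']
        refine (RunsLe.ite_neg (T := 1) ?_ (RunsLe.push (st_update_zero _ _ _ _ _ _))).mono (by omega)
        simp only [st]
        rcases n / 2 with _ | m <;> simp [List.replicate_succ]
      · have hb : n.bodd = true := by rw [Nat.mod_two_of_bodd] at h; simpa using h
        have hy' : y = false :: List.replicate (n / 2) true := by rw [hy, h]; simp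
        rw [hb, hy']
        exact RunsLe.ite_pos rfl ((RunsLe.pop (st_update_three _ _ _ _ _ _)).seq
          (RunsLe.push (st_update_zero _ _ _ _ _ _)))
    have h4 := runsLe_moveStack (a := 3) (b := 2) (by norm_num)
      (st (n.bodd :: true :: o) d [] (List.replicate (n / 2) true) L)
    rw [st_update_two, st_update_three] at h4
    simp only [st, List.append_nil, List.reverse_replicate, List.length_replicate] at h4
    obtain ⟨t, ht, h5⟩ := h1.seq (h2.seq (h3.seq h4))
    obtain ⟨t', ht', h6⟩ := ih (n / 2) (by omega) (n.bodd :: true :: o)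
    have hbits : n.bits = n.bodd :: (n / 2).bits := by
      conv_lhs => rw [← Nat.bit_bodd_div2 n]
      rw [Nat.bits_append_bit, Nat.div2_val]
      intro h7
      rw [Nat.div2_val] at h7
      have : n = 1 := by omega
      subst this; rfl
    refine ⟨t + t' + 1, ?_, .loopStep ?_ h5 ?_⟩
    -- The crude estimate `n / 2 ≤ n - 1` is enough for a polynomial bound.
    · have h7 : n / 2 * (10 * (n / 2) + 7) ≤ (n - 1) * (10 * n + 7) :=
        Nat.mul_le_mul (by omega) (by omega)
      have h8 : n * (10 * n + 7) = (n - 1) * (10 * n + 7) + (10 * n + 7) := by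
        obtain ⟨m, rfl⟩ := Nat.exists_eq_succ_of_ne_zero hn.ne'
        simp only [Nat.succ_eq_add_one, Nat.add_sub_cancel]; ring
      omega
    · obtain ⟨m, rfl⟩ := Nat.exists_eq_succ_of_ne_zero hn.ne'
      simp [st, List.replicate_succ]
    · rw [hbits]
      change Runs writeBits _ _ _
      simpa using h6

theorem Emit.encBinary {e : Γ → ℕ} (he : IsExpr σ e) : Emit σ fun γ => QExpand.encBinary (e γ) := by
  obtain ⟨P, q, hP⟩ := Emit.unary he
  obtain ⟨E, hE⟩ := he
  obtain ⟨b, hb⟩ := E.eval_le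
  refine ⟨(Prog.push 0 false).seq (P.seq ((Prog.loop 0 (some false)
    ((Prog.pop 0).seq (.push 2 true))).seq ((Prog.pop 0).seq (writeBits.seq (.push 0 false))))),
    1 + (q + (b * 3 + 1 + (1 + (b * (10 * b + 7) + 1 + 1)))), fun γ o M hM hd => ?_⟩
  set n := e γ with hn
  have hnb : n ≤ b.eval M := by
    have := hE γ []
    rw [List.append_nil] at this
    rw [hn, ← this]
    exact hb _ M hM
  set d := σ.dat γ
  set L := σ.env γ
  have h1 : RunsLe (.push 0 false) (st o d [] [] L) (st (false :: o) d [] [] L) 1 :=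
    RunsLe.push (st_update_zero _ _ _ _ _ _)
  have h2 := hP γ (false :: o) M hM hd
  rw [List.reverse_replicate, ← hn] at h2
  have h3 := RunsLe.loop (P := (Prog.pop 0).seq (.push 2 true)) (r := 0) (c := some false)
      (B := 2) n (fun i => st (List.replicate (n - i) true ++ false :: o) d
        (List.replicate i true) [] L)
      (fun i hi => by
        obtain ⟨m, hm⟩ := Nat.exists_eq_succ_of_ne_zero (show n - i ≠ 0 by omega)
        simp [st, hm, List.replicate_succ]) (by simp [st])
      (fun i hi => by
        obtain ⟨m, hm⟩ := Nat.exists_eq_succ_of_ne_zero (show n - i ≠ 0 by omega)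
        rw [hm, show n - (i + 1) = m by omega]
        exact (RunsLe.pop (st_update_zero _ _ _ _ _ _)).seq (T := 1) (T' := 1)
          (RunsLe.push (st_update_two _ _ _ _ _ _)))
  simp only [Nat.sub_zero, Nat.sub_self, List.replicate_zero, List.nil_append] at h3
  have h4 : RunsLe (.pop 0) (st (false :: o) d (List.replicate n true) [] L)
      (st o d (List.replicate n true) [] L) 1 := RunsLe.pop (st_update_zero _ _ _ _ _ _)
  have h5 := runsLe_writeBits d L n o
  have h6 : RunsLe (.push 0 false) (st ((n.bits.flatMap fun b => [true, b]).reverse ++ o) d [] [] L)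
      (st ((QExpand.encBinary n).reverse ++ o) d [] [] L) 1 := by
    refine RunsLe.push ?_
    rw [st_update_zero, QExpand.encBinary]
    simp [st]
  refine (h1.seq (h2.seq (h3.seq (h4.seq (h5.seq h6))))).mono ?_
  simp only [Polynomial.eval_add, Polynomial.eval_mul, Polynomial.eval_one, Polynomial.eval_ofNat]
  have h7 : n * (10 * n + 7) ≤ b.eval M * (10 * b.eval M + 7) := Nat.mul_le_mul hnb (by omega)
  omega

/-! ## Writing circuits -/

/-- The description of a circuit without the end mark. -/
def encGates (c : List DGate) : List Bool := c.flatMap fun g => true :: encDGate g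

/-- Some program writes the circuits `f γ` in polynomial time, and also the iterated inverses. -/
def EmitC (σ : Scope Γ) (f : Γ → List DGate) : Prop :=
  ∀ k, Emit σ fun γ => encGates (dinv^[k] (f γ))

theorem EmitC.enc {f : Γ → List DGate} (h : EmitC σ f) : Emit σ fun γ => encGates (f γ) := h 0

theorem EmitC.dinv {f : Γ → List DGate} (h : EmitC σ f) : EmitC σ fun γ => dinv (f γ) :=
  fun k => (h (k + 1)).congr fun _ => by rw [Function.iterate_succ_apply]

theorem dinv_iterate_append (k : ℕ) (A B : List DGate) :
    dinv^[k] (A ++ B) = if k % 2 = 0 then dinv^[k] A ++ dinv^[k] B else dinv^[k] B ++ dinv^[k] A := by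
  induction k with
  | zero => rfl
  | succ k ih =>
    simp only [Function.iterate_succ_apply', ih]
    split_ifs with h1 h2 h2
    · omega
    · rw [dinv_append]
    · rw [dinv_append]
    · omega

theorem encGates_append (A B : List DGate) : encGates (A ++ B) = encGates A ++ encGates B :=
  List.flatMap_append

theorem EmitC.append {f g : Γ → List DGate} (hf : EmitC σ f) (hg : EmitC σ g) :
    EmitC σ fun γ => f γ ++ g γ := by
  intro k
  simp only [dinv_iterate_append]
  split_ifs
  · exact ((hf k).append (hg k)).congr fun γ => (encGates_append _ _).symm
  · exact ((hg k).append (hf k)).congr fun γ => (encGates_append _ _).symm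

/-- The inverse runs the iterations backwards, which exchanges the counter and the number of
remaining iterations. Since loop bodies receive both, no subtraction has to be computed. -/
theorem dinv_loopDir (up : Bool) (n : ℕ) (g : ℕ → ℕ → List DGate) :
    dinv (loopDir up n g) = loopDir (!up) n fun i c => dinv (g i c) := by
  rw [loopDir, dinv_flatMap_range, loopDir]
  refine List.flatMap_congr fun i hi => ?_
  rw [List.mem_range] at hi
  have h : n - 1 - (n - 1 - i) = i := by omega
  cases up <;> simp [h]

theorem dinv_iterate_loop (k n : ℕ) (g : ℕ → ℕ → List DGate) :
    dinv^[k] (loop n g) = loopDir (decide (k % 2 = 0)) n fun i c => dinv^[k] (g i c) := by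
  induction k with
  | zero => rfl
  | succ k ih =>
    simp only [Function.iterate_succ_apply', ih, dinv_loopDir]
    congr 1
    rw [← decide_not]
    congr 1
    rw [eq_iff_iff]; omega

theorem EmitC.loop {e : Γ → ℕ} {g : Γ → ℕ → ℕ → List DGate} (he : IsExpr σ e)
    (hg : EmitC σ.ext fun γ => g γ.1 γ.2.1 γ.2.2) : EmitC σ fun γ => loop (e γ) (g γ) := by
  intro k
  refine (Emit.loopDir (decide (k % 2 = 0)) (g := fun γ i c => encGates (QExpand.dinv^[k] (g γ i c))) he
    (hg k)).congr fun γ => ?_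
  rw [dinv_iterate_loop, encGates, QExpand.loopDir, QExpand.loopDir, List.flatMap_assoc]
  refine List.flatMap_congr fun i _ => ?_
  cases (decide (k % 2 = 0)) <;> rfl

theorem EmitC.congr {f g : Γ → List DGate} (h : EmitC σ f) (e : ∀ γ, f γ = g γ) : EmitC σ g :=
  (funext e : f = g) ▸ h

/-- Writing the list of control wires of a gate. -/
def EmitCtrls (σ : Scope Γ) (cs : Γ → List ℕ) : Prop :=
  Emit σ fun γ => (cs γ).flatMap fun i => true :: encUnary i

theorem EmitCtrls.nil : EmitCtrls σ fun _ => [] := Emit.nil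

theorem EmitCtrls.cons {e : Γ → ℕ} {cs : Γ → List ℕ} (he : IsExpr σ e) (hcs : EmitCtrls σ cs) :
    EmitCtrls σ fun γ => e γ :: cs γ :=
  ((Emit.bit true).append (Emit.encUnary he)).append hcs

theorem EmitCtrls.append {cs ds : Γ → List ℕ} (hcs : EmitCtrls σ cs) (hds : EmitCtrls σ ds) :
    EmitCtrls σ fun γ => cs γ ++ ds γ :=
  (Emit.append hcs hds).congr fun _ => List.flatMap_append.symm

theorem EmitCtrls.range {e f : Γ → ℕ} (he : IsExpr σ e) (hf : IsExpr σ f) :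
    EmitCtrls σ fun γ => (List.range (e γ)).map fun k => f γ + k := by
  refine (Emit.loopDir true (g := fun γ i _ => true :: QExpand.encUnary (f γ + i)) he
    ((Emit.bit true).append (Emit.encUnary (hf.ext.add .counter)))).congr fun γ => ?_
  rw [List.flatMap_map]; rfl

theorem Emit.gate {cs : Γ → List ℕ} {t : Γ → ℕ} {el : Γ → Elem} (hcs : EmitCtrls σ cs)
    (ht : IsExpr σ t) (hel : Emit σ fun γ => encElem (el γ)) :
    Emit σ fun γ => encGates [⟨cs γ, t γ, el γ⟩] :=
  ((Emit.bit true).append (((Emit.append hcs (Emit.lit [false])).append (Emit.encUnary ht)).append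
    hel)).congr fun γ => by simp [encGates, encDGate]

theorem EmitC.xGate {cs : Γ → List ℕ} {t : Γ → ℕ} (hcs : EmitCtrls σ cs) (ht : IsExpr σ t) :
    EmitC σ fun γ => [xGate (cs γ) (t γ)] := by
  intro k
  refine (Emit.gate hcs ht (el := fun _ => .flip) (Emit.lit [false])).congr fun γ => ?_
  rw [Function.iterate_fixed (by rfl : QExpand.dinv [QExpand.xGate (cs γ) (t γ)] = _)]
  rfl

/-- `dinv` is not an involution on gate lists, since the inverse of a rotation consists of three
gates; closure of `EmitC` under inverses thus needs all iterates. Each iterate is a fixed pattern of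
the rotation and Pauli `Z` gates that does not depend on the parameters. -/
theorem dinv_iterate_rot (k : ℕ) : ∃ W : List Bool, ∀ (cs : List ℕ) (t a b : ℕ),
    dinv^[k] [⟨cs, t, .rot a b⟩] =
      W.map fun x => (⟨cs, t, bif x then .rot a b else .phase 1 2⟩ : DGate) := by
  induction k with
  | zero => exact ⟨[true], fun _ _ _ _ => rfl⟩
  | succ k ih =>
    obtain ⟨W, hW⟩ := ih
    have key : ∀ W : List Bool, ∃ W' : List Bool, ∀ (cs : List ℕ) (t a b : ℕ),
        dinv (W.map fun x => (⟨cs, t, bif x then .rot a b else .phase 1 2⟩ : DGate)) =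
          W'.map fun x => (⟨cs, t, bif x then .rot a b else .phase 1 2⟩ : DGate) := by
      intro W
      induction W with
      | nil => exact ⟨[], fun _ _ _ _ => rfl⟩
      | cons x W ih =>
        obtain ⟨W', hW'⟩ := ih
        refine ⟨W' ++ (bif x then [false, true, false] else [false]), fun cs t a b => ?_⟩
        rw [List.map_cons, QExpand.dinv, hW', List.map_append]
        cases x <;> rfl
    obtain ⟨W', hW'⟩ := key W
    exact ⟨W', fun cs t a b => by rw [Function.iterate_succ_apply', hW, hW']⟩

theorem EmitC.rot {cs : Γ → List ℕ} {t a b : Γ → ℕ} (hcs : EmitCtrls σ cs) (ht : IsExpr σ t)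
    (ha : IsExpr σ a) (hb : IsExpr σ b) :
    EmitC σ fun γ => [⟨cs γ, t γ, .rot (a γ) (b γ)⟩] := by
  intro k
  obtain ⟨W, hW⟩ := dinv_iterate_rot k
  simp only [hW]
  clear hW
  induction W with
  | nil => exact Emit.nil
  | cons x W ih =>
    cases x
    · exact ((Emit.gate hcs ht (el := fun _ => .phase 1 2) (Emit.lit _)).append ih).congr fun γ =>
        (encGates_append [_] _).symm
    · exact ((Emit.gate hcs ht (el := fun γ => .rot (a γ) (b γ))
        (((Emit.lit [true, false]).append (Emit.encBinary ha)).append (Emit.encBinary hb))).append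
          ih).congr fun γ => (encGates_append [_] _).symm

end QExpand
namespace QExpand

/-! ## Writing the circuit for the expansion -/

variable {Γ : Type} {σ : Scope Γ}

/-- Registers whose number a program can compute. -/
def IsReg (σ : Scope Γ) (a : Γ → Reg) : Prop := IsExpr σ fun γ => addr (a γ)

theorem IsReg.ext {a : Γ → Reg} (h : IsReg σ a) : IsReg σ.ext fun γ => a γ.1 := IsExpr.ext h

/-- Register addresses are polynomial in the indices. -/
theorem IsReg.mk (t : Fin 4) {x y : Γ → ℕ} (hx : IsExpr σ x) (hy : IsExpr σ y) :
    IsReg σ fun γ => (t, x γ, y γ) :=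
  ((IsExpr.const 4).mul (((hx.add hy).mul (hx.add hy)).add hx)).add (.const t)

theorem IsReg.const (ρ : Reg) : IsReg σ fun _ => ρ := IsExpr.const _

theorem IsReg.rX {j : Γ → ℕ} (hj : IsExpr σ j) : IsReg σ fun γ => rX (j γ) := .mk 1 (.const 0) hj

theorem IsReg.rD {b j : Γ → ℕ} (hb : IsExpr σ b) (hj : IsExpr σ j) :
    IsReg σ fun γ => rD (b γ) (j γ) := .mk 2 hb hj

theorem IsReg.rP {b j : Γ → ℕ} (hb : IsExpr σ b) (hj : IsExpr σ j) :
    IsReg σ fun γ => rP (b γ) (j γ) := .mk 3 hb hj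

theorem IsReg.wire {w b : Γ → ℕ} {a : Γ → Reg} (ha : IsReg σ a) (hw : IsExpr σ w)
    (hb : IsExpr σ b) : IsExpr σ fun γ => wire (w γ) (a γ) (b γ) :=
  (IsExpr.mul ha hw).add hb

/-- Control bits whose wires a program can compute. -/
def AreCtrls (σ : Scope Γ) (cs : List (Γ → Reg × ℕ)) : Prop :=
  ∀ c ∈ cs, IsReg σ (fun γ => (c γ).1) ∧ IsExpr σ fun γ => (c γ).2

theorem AreCtrls.nil : AreCtrls σ [] := by simp [AreCtrls]

theorem AreCtrls.cons {a : Γ → Reg} {b : Γ → ℕ} {cs : List (Γ → Reg × ℕ)} (ha : IsReg σ a)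
    (hb : IsExpr σ b) (hcs : AreCtrls σ cs) : AreCtrls σ ((fun γ => (a γ, b γ)) :: cs) := by
  intro c hc
  rcases List.mem_cons.mp hc with rfl | hc
  · exact ⟨ha, hb⟩
  · exact hcs c hc

theorem AreCtrls.ext {cs : List (Γ → Reg × ℕ)} (hcs : AreCtrls σ cs) :
    AreCtrls σ.ext (cs.map fun c γ => c γ.1) := by
  intro c hc
  obtain ⟨c', hc', rfl⟩ := List.mem_map.mp hc
  exact ⟨(hcs c' hc').1.ext, (hcs c' hc').2.ext⟩

theorem AreCtrls.emit {w : Γ → ℕ} (hw : IsExpr σ w) {cs : List (Γ → Reg × ℕ)}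
    (hcs : AreCtrls σ cs) :
    EmitCtrls σ fun γ => (cs.map fun c => c γ).map fun c => wire (w γ) c.1 c.2 := by
  induction cs with
  | nil => exact EmitCtrls.nil
  | cons c cs ih =>
    have hc := hcs c (by simp)
    exact EmitCtrls.cons (hc.1.wire hw hc.2) (ih fun c hc => hcs c (List.mem_cons_of_mem _ hc))

theorem EmitC.cadd {w e v : Γ → ℕ} {a : Γ → Reg} (cs : List (Γ → Reg × ℕ)) (hw : IsExpr σ w)
    (hcs : AreCtrls σ cs) (ha : IsReg σ a) (he : IsExpr σ e) (hv : IsExpr σ v) :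
    EmitC σ fun γ => cadd (w γ) ((cs.map fun c => c γ).map fun c => wire (w γ) c.1 c.2) (a γ) (e γ)
      (v γ) := by
  refine EmitC.loop (g := fun γ _ c => [QExpand.xGate (((cs.map fun c => c γ).map fun c =>
    wire (w γ) c.1 c.2) ++ (List.range c).map fun k => wire (w γ) (a γ) (e γ) + k)
      (wire (w γ) (a γ) (e γ) + c)]) hv (EmitC.xGate (EmitCtrls.append ?_ (.range .rest
        (ha.ext.wire hw.ext he.ext))) ((ha.ext.wire hw.ext he.ext).add .rest))
  have := hcs.ext.emit hw.ext
  simpa only [List.map_map, Function.comp_def] using this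

theorem EmitC.addW {w : Γ → ℕ} {a b : Γ → Reg} (cs : List (Γ → Reg × ℕ)) (hw : IsExpr σ w)
    (hcs : AreCtrls σ cs) (ha : IsReg σ a) (hb : IsReg σ b) :
    EmitC σ fun γ => addW (w γ) (cs.map fun c => c γ) (a γ) (b γ) := by
  refine EmitC.loop hw ?_
  refine (EmitC.cadd _ hw.ext (AreCtrls.cons hb.ext .counter hcs.ext) ha.ext .counter
    IsExpr.rest.succ).congr fun γ => ?_
  simp only [List.map_cons, List.map_map, Function.comp_def]

theorem EmitC.mulW {w : Γ → ℕ} {a b c : Γ → Reg} (cs : List (Γ → Reg × ℕ)) (hw : IsExpr σ w)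
    (hcs : AreCtrls σ cs) (ha : IsReg σ a) (hb : IsReg σ b) (hc : IsReg σ c) :
    EmitC σ fun γ => mulW (w γ) (cs.map fun c => c γ) (a γ) (b γ) (c γ) := by
  refine EmitC.loop hw (EmitC.loop IsExpr.rest.succ ?_)
  refine (EmitC.cadd _ hw.ext.ext (AreCtrls.cons hb.ext.ext IsExpr.counter.ext
    (AreCtrls.cons hc.ext.ext .counter hcs.ext.ext)) ha.ext.ext (IsExpr.counter.ext.add .counter)
    IsExpr.rest.succ).congr fun γ => ?_
  simp only [List.map_cons, List.map_map, Function.comp_def]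

theorem EmitC.ltFlag {w : Γ → ℕ} {f a b : Γ → Reg} (hw : IsExpr σ w)
    (hw' : IsExpr σ fun γ => w γ - 1) (hf : IsReg σ f) (ha : IsReg σ a) (hb : IsReg σ b) :
    EmitC σ fun γ => ltFlag (w γ) (f γ) (a γ) (b γ) :=
  (EmitC.addW [] hw .nil ha hb).dinv.append
    ((EmitC.cadd _ hw (.cons ha hw' .nil) hf (.const 0) hw).append (EmitC.addW [] hw .nil ha hb))

theorem EmitC.swapW {w : Γ → ℕ} {t a b : Γ → Reg} (cs : List (Γ → Reg × ℕ)) (hw : IsExpr σ w)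
    (hcs : AreCtrls σ cs) (ht : IsReg σ t) (ha : IsReg σ a) (hb : IsReg σ b) :
    EmitC σ fun γ => swapW (w γ) (cs.map fun c => c γ) (t γ) (a γ) (b γ) :=
  ((EmitC.addW cs hw hcs ht ha).append (EmitC.addW cs hw hcs ht hb).dinv).append
    ((EmitC.addW [] hw .nil ha ht).dinv.append ((EmitC.addW [] hw .nil hb ht).append
      ((EmitC.addW cs hw hcs ht ha).append (EmitC.addW cs hw hcs ht hb).dinv)))

theorem EmitC.binStep {w l c : Γ → ℕ} {x : Γ → Reg} (hw : IsExpr σ w) (hl : IsExpr σ l)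
    (hx : IsReg σ x) (hc : IsExpr σ c) : EmitC σ fun γ => binStep (w γ) (l γ) (x γ) (c γ) := by
  have hctrl : AreCtrls σ.ext [fun γ => (x γ.1, c γ.1)] := .cons hx.ext hc.ext .nil
  have hadd : ∀ cs : List (Γ × ℕ × ℕ → Reg × ℕ), AreCtrls σ.ext cs → EmitC σ.ext fun γ =>
      QExpand.addW (w γ.1) (cs.map fun c => c γ) (rP (c γ.1 + 1) γ.2.1) (rP (c γ.1) γ.2.1) :=
    fun cs hcs => EmitC.addW cs hw.ext hcs (.rP hc.ext.succ .counter) (.rP hc.ext .counter)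
  have h1 : EmitC σ.ext fun γ => QExpand.loop (γ.2.1 + 1) fun j j' =>
      QExpand.mulW (w γ.1) [] (rD (c γ.1 + 1) γ.2.1) (rD (c γ.1) j) (rD (c γ.1) j') :=
    EmitC.loop IsExpr.counter.succ (EmitC.mulW [] hw.ext.ext .nil
      (.rD hc.ext.ext.succ IsExpr.counter.ext) (.rD hc.ext.ext .counter) (.rD hc.ext.ext .rest))
  have h2 := EmitC.mulW [fun γ => (x γ.1.1, c γ.1.1)] hw.ext.ext
    (.cons hx.ext.ext hc.ext.ext .nil) (IsReg.rP hc.ext.ext.succ (IsExpr.counter (σ := σ)).ext)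
    (IsReg.rP hc.ext.ext .counter) (IsReg.rD hc.ext.ext .rest)
  simp only [List.map_cons, List.map_nil] at h2
  have h2 := EmitC.loop (g := fun (γ : Γ × ℕ × ℕ) j j' => QExpand.mulW (w γ.1) [(x γ.1, c γ.1)]
    (rP (c γ.1 + 1) γ.2.1) (rP (c γ.1) j) (rD (c γ.1) j')) (IsExpr.counter (σ := σ)).succ h2
  have h3 := hadd _ hctrl
  simp only [List.map_cons, List.map_nil] at h3
  exact EmitC.loop hl.succ (h1.append ((hadd [] .nil).append (h2.append h3.dinv)))

theorem EmitC.binTable {w l K : Γ → ℕ} {x : Γ → Reg} (hw : IsExpr σ w) (hl : IsExpr σ l)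
    (hK : IsExpr σ K) (hx : IsReg σ x) : EmitC σ fun γ => binTable (w γ) (l γ) (K γ) (x γ) :=
  ((EmitC.cadd [] hw .nil (.const (rD 0 0)) (.const 0) hw).append
    ((EmitC.cadd [] hw .nil (.const (rD 0 1)) (.const 0) hw).append
      (EmitC.cadd [] hw .nil (.const (rP 0 0)) (.const 0) hw))).append
    (EmitC.loop hK (EmitC.binStep hw.ext hl.ext hx.ext .counter))

theorem EmitC.subBin {w l K k : Γ → ℕ} {x : Γ → Reg} (hw : IsExpr σ w) (hl : IsExpr σ l)
    (hK : IsExpr σ K) (hx : IsReg σ x) (hk : IsExpr σ k) :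
    EmitC σ fun γ => subBin (w γ) (l γ) (K γ) (x γ) (k γ) :=
  (EmitC.binTable hw hl hK hx).append ((EmitC.addW [] hw .nil (.const rM) (.rP hK hk)).dinv.append
    (EmitC.binTable hw hl hK hx).dinv)

theorem EmitC.findBit {w l K k b v : Γ → ℕ} {x : Γ → Reg} (hw : IsExpr σ w)
    (hw' : IsExpr σ fun γ => w γ - 1) (hl : IsExpr σ l) (hK : IsExpr σ K) (hx : IsReg σ x)
    (hk : IsExpr σ k) (hb : IsExpr σ b) (hv : IsExpr σ v) :
    EmitC σ fun γ => findBit (w γ) (l γ) (K γ) (x γ) (k γ) (b γ) (v γ) :=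
  (EmitC.cadd [] hw .nil hx hb hv).append ((EmitC.subBin hw hl hK hx hk).append
    ((EmitC.cadd _ hw (.cons (.const rM) hw' .nil) (.const rF) (.const 0) hw).append
      ((EmitC.subBin hw hl hK hx hk).dinv.append
        ((EmitC.cadd _ hw (.cons (.const rF) (.const 0) .nil) hx hb hv).dinv.append
          ((EmitC.cadd _ hw (.cons hx hb .nil) (.const rF) (.const 0) hw).append
            (EmitC.cadd [] hw .nil (.const rF) (.const 0) hw).dinv)))))

theorem EmitC.unrankLetter {w l K r i : Γ → ℕ} (hw : IsExpr σ w) (hw' : IsExpr σ fun γ => w γ - 1)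
    (hl : IsExpr σ l) (hK : IsExpr σ K) (hr : IsExpr σ r) (hi : IsExpr σ i) :
    EmitC σ fun γ => unrankLetter (w γ) (l γ) (K γ) (r γ) (i γ) := by
  unfold QExpand.unrankLetter
  refine EmitC.append (EmitC.loop hK ?_) (EmitC.append (EmitC.subBin hw hl hK (.rX hi) hi.succ)
    (EmitC.loop hi ?_))
  · exact EmitC.findBit hw.ext hw'.ext hl.ext hK.ext (.rX hi.ext) hi.ext.succ .rest
      (IsExpr.counter.succ.add hr.ext)
  · exact (EmitC.cadd [] hw.ext .nil (.rX hi.ext) (.const 0) hw.ext).dinv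

theorem EmitC.unrank {w l K r : Γ → ℕ} (hw : IsExpr σ w) (hw' : IsExpr σ fun γ => w γ - 1)
    (hl : IsExpr σ l) (hK : IsExpr σ K) (hr : IsExpr σ r) :
    EmitC σ fun γ => unrank (w γ) (l γ) (K γ) (r γ) :=
  EmitC.loop hl (EmitC.unrankLetter hw.ext hw'.ext hl.ext hK.ext hr.ext .rest)

theorem EmitC.sortPair {w j : Γ → ℕ} (hw : IsExpr σ w) (hw' : IsExpr σ fun γ => w γ - 1)
    (hj : IsExpr σ j) : EmitC σ fun γ => sortPair (w γ) (j γ) :=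
  EmitC.append (EmitC.ltFlag hw hw' (.const rS) (.const rH) (.rX hj))
    (EmitC.swapW [fun _ => (rS, 0)] hw (.cons (.const rS) (.const 0) .nil) (.const rT) (.rX hj)
      (.const rH))

theorem EmitC.pairFlags {w j q₁ q₂ q₃ : Γ → ℕ} (hw : IsExpr σ w)
    (hw' : IsExpr σ fun γ => w γ - 1) (hj : IsExpr σ j) (h₁ : IsExpr σ q₁) (h₂ : IsExpr σ q₂)
    (h₃ : IsExpr σ q₃) : EmitC σ fun γ => pairFlags (w γ) (j γ) (q₁ γ) (q₂ γ) (q₃ γ) :=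
  (EmitC.ltFlag hw hw' (.const (rA 1)) (.rX hj) (.const rH)).append
    (((EmitC.cadd [] hw .nil (.const (rA 2)) (.const 0) hw).append
      (EmitC.ltFlag hw hw' (.const (rA 2)) (.const rH) (.rX h₁)).dinv).append
    ((EmitC.ltFlag hw hw' (.const (rA 3)) (.const rH) (.rX h₂)).append
    ((EmitC.cadd [] hw .nil (.const (rA 4)) (.const 0) hw).append
      (EmitC.ltFlag hw hw' (.const (rA 4)) (.rX h₃) (.const rH)).dinv)))

theorem EmitC.partialSwap {w j q₁ q₂ q₃ t u : Γ → ℕ} (hw : IsExpr σ w)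
    (hw' : IsExpr σ fun γ => w γ - 1) (hj : IsExpr σ j) (h₁ : IsExpr σ q₁) (h₂ : IsExpr σ q₂)
    (h₃ : IsExpr σ q₃) (ht : IsExpr σ t) (hu : IsExpr σ u) :
    EmitC σ fun γ => partialSwap (w γ) (j γ) (q₁ γ) (q₂ γ) (q₃ γ) (t γ) (u γ) := by
  have h := (EmitC.sortPair hw hw' hj).append (EmitC.pairFlags hw hw' hj h₁ h₂ h₃)
  have hc : ∀ i, IsExpr σ fun γ => wire (w γ) (rA i) 0 := fun i =>
    (IsReg.const (rA i)).wire hw (.const 0)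
  exact h.append ((EmitC.rot (.cons (hc 1) (.cons (hc 2) (.cons (hc 3) (.cons (hc 4) .nil))))
    ((IsReg.const rS).wire hw (.const 0)) ht hu).append h.dinv)

theorem EmitC.symStage {w c : Γ → ℕ} (hw : IsExpr σ w) (hw' : IsExpr σ fun γ => w γ - 1)
    (hc : IsExpr σ c) : EmitC σ fun γ => symStage (w γ) (c γ) := by
  have h := EmitC.swapW [] hw .nil (.const rT) (.rX hc) (.const rH)
  refine h.append ((EmitC.loop hc (EmitC.loop IsExpr.counter.succ ?_)).append h)
  exact EmitC.partialSwap hw.ext.ext hw'.ext.ext IsExpr.rest.ext (IsExpr.rest.ext.add .counter)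
    (IsExpr.rest.ext.add .counter).succ IsExpr.rest.ext.succ IsExpr.counter.succ
    IsExpr.rest.ext.succ

theorem EmitC.symmetrize {w l K r : Γ → ℕ} (hw : IsExpr σ w) (hw' : IsExpr σ fun γ => w γ - 1)
    (hl : IsExpr σ l) (hK : IsExpr σ K) (hr : IsExpr σ r) :
    EmitC σ fun γ => symmetrize (w γ) (l γ) (K γ) (r γ) := by
  have h := EmitC.cadd [] hw .nil (.const rH) hK hr
  exact h.append ((EmitC.loop hl (EmitC.symStage hw.ext hw'.ext .rest)).append h.dinv)

theorem EmitC.schurCircuit {w l K r : Γ → ℕ} (hw : IsExpr σ w) (hw' : IsExpr σ fun γ => w γ - 1)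
    (hl : IsExpr σ l) (hK : IsExpr σ K) (hr : IsExpr σ r) :
    EmitC σ fun γ => schurCircuit (w γ) (l γ) (K γ) (r γ) :=
  (EmitC.unrank hw hw' hl hK hr).append (EmitC.symmetrize hw hw' hl hK hr)

theorem EmitC.moveLetter {w j : Γ → ℕ} (hw : IsExpr σ w) (hj : IsExpr σ j) :
    EmitC σ fun γ => moveLetter (w γ) (j γ) :=
  (EmitC.addW [] hw .nil (.const rM) (.rX hj)).append
    (EmitC.addW [] hw .nil (.rX hj) (.const rM)).dinv

/-- The description of the expansion circuit is written in polynomial time, given the description of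
the circuit for the unitary. -/
theorem Emit.expandCircuit {w l K r : Γ → ℕ} {c : Γ → List DGate}
    (hc : ∀ γ, σ.dat γ = encGates (c γ)) (hw : IsExpr σ w) (hw' : IsExpr σ fun γ => w γ - 1)
    (hl : IsExpr σ l) (hK : IsExpr σ K) (hr : IsExpr σ r) :
    Emit σ fun γ => encGates (expandCircuit (w γ) (l γ) (K γ) (r γ) (c γ)) := by
  have h := EmitC.schurCircuit hw hw' hl hK hr
  have hm := EmitC.moveLetter hw.ext (j := fun γ => γ.2.1) (σ := σ.ext) .counter
  -- The circuit for `U` is copied from the data in every iteration. It is never inverted, so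
  -- writing it forwards suffices.
  have hd : Emit σ.ext fun γ => encGates (c γ.1) := Emit.dat.congr fun γ => hc γ.1
  refine (h.enc.append ((Emit.loopDir true (g := fun γ i _ => encGates (applyLetter (w γ) (c γ) i))
    hl ((hm.enc.append (hd.append hm.dinv.enc)).congr fun γ => ?_)).append h.dinv.enc)).congr
      fun γ => ?_
  · rw [applyLetter, encGates_append, encGates_append]
  · rw [QExpand.expandCircuit, encGates_append, encGates_append]
    congr 2
    simp only [QExpand.loopDir, QExpand.loop, cond_true, encGates, List.flatMap_assoc]

end QExpand
namespace QExpand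

/-! ## The expansion is a family of efficient unitaries -/

theorem OutputsWithin.length_le {P : Prog} {n : ℕ} {v out : List Bool} {T : ℕ}
    (h : OutputsWithin P n v out T) : out.length ≤ T := by
  obtain ⟨s, t, h1, rfl, h3⟩ := h
  have := h1.length_le 2
  simp only [initStore] at this
  simp at this
  omega

theorem length_encGates_cons (g : DGate) (c : List DGate) :
    (encGates (g :: c)).length = 1 + (encDGate g).length + (encGates c).length := by
  simp [encGates]; omega

/-- Wire numbers are written in unary, so the length of a description bounds the wires it uses. -/
theorem lt_length_encDGate (g : DGate) :
    g.target < (encDGate g).length ∧ (∀ i ∈ g.controls, i < (encDGate g).length) ∧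
      g.controls.length + 1 ≤ (encDGate g).length := by
  have h1 : ∀ cs : List ℕ, (∀ i ∈ cs, i < (cs.flatMap fun i => true :: encUnary i).length) ∧
      cs.length ≤ (cs.flatMap fun i => true :: encUnary i).length := by
    intro cs
    induction cs with
    | nil => simp
    | cons j cs ih =>
      simp only [List.flatMap_cons, List.length_append, List.length_cons, encUnary,
        List.length_replicate, List.length_nil]
      refine ⟨fun i hi => ?_, by have := ih.2; simp only [encUnary] at this; omega⟩
      rcases List.mem_cons.mp hi with rfl | hi
      · omega
      · have := ih.1 i hi; simp only [encUnary] at this; omega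
  have h2 := h1 g.controls
  have h3 : (encUnary g.target).length = g.target + 1 := by simp [encUnary]
  simp only [encDGate, List.length_append, h3]
  refine ⟨by omega, fun i hi => ?_, by omega⟩
  have := h2.1 i hi
  omega

theorem wiresBelow_length (c : List DGate) : wiresBelow (encGates c).length c := by
  induction c with
  | nil => intro g hg; simp at hg
  | cons g c ih =>
    intro g' hg'
    rw [length_encGates_cons]
    rcases List.mem_cons.mp hg' with rfl | hg'
    · have := lt_length_encDGate g'
      exact ⟨by omega, fun i hi => by have := this.2.1 i hi; omega⟩
    · have := ih g' hg'
      exact ⟨by omega, fun i hi => by have := this.2 i hi; omega⟩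

theorem wiresBelow.mono {w w' : ℕ} (h : w ≤ w') {c : List DGate} (hc : wiresBelow w c) :
    wiresBelow w' c := fun g hg =>
  ⟨(hc g hg).1.trans_le h, fun i hi => ((hc g hg).2 i hi).trans_le h⟩

theorem RunsLe.rename {f : ℕ → ℕ} (hf : Function.Injective f) {P : Prog} {s s' : Store} {T : ℕ}
    (h : RunsLe P s s' T) {S : Store} (hS : ∀ r, S (f r) = s r) :
    ∃ S' : Store, RunsLe (P.rename f) S S' T ∧ (∀ r, S' (f r) = s' r) ∧
      ∀ r, (∀ q, f q ≠ r) → S' r = S r := by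
  obtain ⟨t, ht, h⟩ := h
  obtain ⟨S', h1, h2, h3⟩ := h.rename hf S hS
  exact ⟨S', ⟨t, ht, h1⟩, h2, h3⟩

/-- The program that runs `L` on `1ⁿ`, then `Q` on `(1ⁿ, w)`, and then `M` on both outputs, with
stacks kept apart. -/
def compose (L Q M : Prog) : Prog :=
  (Prog.loop 0 none ((Prog.pop 0).seq ((Prog.push 4 true).seq
    ((Prog.push 17 true).seq (.push 2 true))))).seq
  ((moveStack 2 0).seq ((L.rename fun r => 3 * r + 4).seq ((moveStack 10 20).seq
  ((Q.rename fun r => if r < 2 then r else 3 * r).seq ((moveStack 6 11).seq ((Prog.pop 11).seq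
  ((moveStack 11 8).seq ((M.rename fun r => 3 * r + 5).seq ((Prog.push 5 false).seq
  (moveStack 5 2))))))))))

/-- `L` lives on stacks `3r + 4`, `M` on `3r + 5`, and `Q` on 0, 1 and the multiples of 3 from 6 on.
Thus 4 and 17 receive `1ⁿ` as input of `L` and first number of `M`, 10 is the output of `L` and 20
the second number of `M`, 6 is the output of `Q` and 8 the data of `M`, and 5 is the output of `M`.
-/
theorem outputsWithin_compose {L Q M : Prog} {n m T₁ T₂ T₃ : ℕ} {v body out : List Bool}
    (hL : OutputsWithin L n [] (List.replicate m true) T₁)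
    (hQ : OutputsWithin Q n v (body ++ [false]) T₂)
    (hM : RunsLe M (st [] body [] [] [n, m]) (st out.reverse body [] [] [n, m]) T₃) :
    OutputsWithin (compose L Q M) n v (out ++ [false])
      (20 * n + 20 + 10 * T₁ + 20 * T₂ + 10 * T₃) := by
  have hm := hL.length_le
  have hb := hQ.length_le
  simp only [List.length_replicate, List.length_append, List.length_cons, List.length_nil] at hm hb
  obtain ⟨sL, tL, hL, hL2, htL⟩ := hL
  obtain ⟨sQ, tQ, hQ, hQ2, htQ⟩ := hQ
  -- copy the input
  have a1 := RunsLe.loop (P := (Prog.pop 0).seq ((Prog.push 4 true).seq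
    ((Prog.push 17 true).seq (.push 2 true)))) (r := 0) (c := none) (B := 4) n
    (fun i r => if r = 0 then List.replicate (n - i) true else if r = 1 then v else
      if r = 4 ∨ r = 17 ∨ r = 2 then List.replicate i true else [])
    (fun i hi => by
      obtain ⟨j, hj⟩ := Nat.exists_eq_succ_of_ne_zero (show n - i ≠ 0 by omega)
      simp [hj, List.replicate_succ]) (by simp)
    (fun i hi => by
      obtain ⟨j, hj⟩ := Nat.exists_eq_succ_of_ne_zero (show n - i ≠ 0 by omega)
      refine (RunsLe.pop rfl).seq (T := 1) (T' := 3) ((RunsLe.push rfl).seq (T := 1) (T' := 2)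
        ((RunsLe.push rfl).seq (T := 1) (T' := 1) (RunsLe.push ?_)))
      rw [hj, show n - (i + 1) = j by omega]
      ext1 r
      by_cases h0 : r = 0
      · subst h0; simp [List.replicate_succ]
      by_cases h2 : r = 2
      · subst h2; simp [List.replicate_succ]
      by_cases h4 : r = 4
      · subst h4; simp [List.replicate_succ]
      by_cases h17 : r = 17
      · subst h17; simp [List.replicate_succ]
      · simp [h0, h2, h4, h17])
  have e1 : (fun r => if r = 0 then List.replicate (n - 0) true else if r = 1 then v else
      if r = 4 ∨ r = 17 ∨ r = 2 then List.replicate 0 true else []) = initStore n v := by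
    ext1 r; simp [initStore]
  rw [e1] at a1
  simp only [Nat.sub_self, List.replicate_zero] at a1
  have a2 := runsLe_moveStack (a := 2) (b := 0) (by norm_num)
    (fun r => if r = 0 then List.replicate (n - n) true else if r = 1 then v else
      if r = 4 ∨ r = 17 ∨ r = 2 then List.replicate n true else [])
  obtain ⟨s₂, hs₂⟩ : ∃ s : Store, s = fun r => if r = 0 then List.replicate n true else
    if r = 1 then v else if r = 4 ∨ r = 17 then List.replicate n true else [] := ⟨_, rfl⟩
  have e2 : Function.update (Function.update (fun r => if r = 0 then List.replicate (n - n) true else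
      if r = 1 then v else if r = 4 ∨ r = 17 ∨ r = 2 then List.replicate n true else []) 0
      ((List.replicate n true).reverse ++ [])) 2 [] = s₂ := by
    rw [hs₂]
    ext1 r
    by_cases h0 : r = 0
    · subst h0; simp
    by_cases h2 : r = 2
    · subst h2; simp
    · simp [h0, h2]
  simp only [OfNat.ofNat_ne_zero, if_false, OfNat.ofNat_ne_one, or_true, if_true, Nat.sub_self,
    List.replicate_zero, List.length_replicate] at a2 e2
  rw [e2] at a2
  -- run `L`
  obtain ⟨s₃, a3, hs₃, hs₃'⟩ := RunsLe.rename (f := fun r => 3 * r + 4)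
    (fun a b h => by simp only at h; omega) (P := L) ⟨tL, htL, hL⟩ (S := s₂) (fun r => by
      rw [hs₂]
      have : 3 * r + 4 ≠ 17 := by omega
      simp only [initStore, this, or_false]
      rcases r with _ | r
      · simp
      · have h1 : 3 * (r + 1) + 4 ≠ 0 := by omega
        have h2 : 3 * (r + 1) + 4 ≠ 1 := by omega
        have h3 : 3 * (r + 1) + 4 ≠ 4 := by omega
        simp [h2])
  have hs₃n : ∀ r, r % 3 ≠ 1 ∨ r < 4 → s₃ r = s₂ r := fun r hr =>
    hs₃' r fun q => by omega
  have h10 : s₃ 10 = List.replicate m true := by rw [← hL2, ← hs₃ 2]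
  have h20 : s₃ 20 = [] := by rw [hs₃n 20 (by norm_num), hs₂]; simp
  have a4 := runsLe_moveStack (a := 10) (b := 20) (by norm_num) s₃
  rw [h10, h20] at a4
  obtain ⟨s₄, hs₄⟩ : ∃ s : Store, s = Function.update (Function.update s₃ 20
    ((List.replicate m true).reverse ++ [])) 10 [] := ⟨_, rfl⟩
  rw [← hs₄, List.length_replicate] at a4
  have hs₄n : ∀ r, r % 3 ≠ 1 ∨ r < 4 → r ≠ 20 → s₄ r = s₂ r := fun r hr hr' => by
    rw [hs₄, Function.update_of_ne (by omega), Function.update_of_ne hr', hs₃n r hr]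
  -- run `Q`
  obtain ⟨s₅, a5, hs₅, hs₅'⟩ := RunsLe.rename (f := fun r => if r < 2 then r else 3 * r)
    (fun a b h => by simp only at h; split_ifs at h <;> omega) (P := Q) ⟨tQ, htQ, hQ⟩ (S := s₄)
    (fun r => by
      rw [hs₄n _ (by split_ifs <;> omega) (by split_ifs <;> omega), hs₂]
      simp only [initStore]
      split_ifs <;> first | rfl | omega)
  have hs₅n : ∀ r, r % 3 = 2 → s₅ r = s₄ r := fun r hr =>
    hs₅' r fun q => by split_ifs <;> omega
  have h6 : s₅ 6 = body ++ [false] := by rw [← hQ2, ← hs₅ 2]; rfl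
  have h11 : s₅ 11 = [] := by
    rw [hs₅n 11 (by norm_num), hs₄n 11 (by norm_num) (by norm_num), hs₂]; simp
  -- Moving reverses, which brings the end mark of the description to the top, where it is popped; a
  -- second move restores the order.
  have a6 := runsLe_moveStack (a := 6) (b := 11) (by norm_num) s₅
  rw [h6, h11] at a6
  obtain ⟨s₆, hs₆⟩ : ∃ s : Store, s = Function.update (Function.update s₅ 11
    ((body ++ [false]).reverse ++ [])) 6 [] := ⟨_, rfl⟩
  rw [← hs₆] at a6
  obtain ⟨s₇, hs₇⟩ : ∃ s : Store, s = Function.update s₆ 11 body.reverse := ⟨_, rfl⟩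
  have a7 : RunsLe (.pop 11) s₆ s₇ 1 := RunsLe.pop (by rw [hs₇, hs₆]; simp)
  have h8 : s₇ 8 = [] := by
    rw [hs₇, hs₆]
    simp [hs₅n 8 (by norm_num), hs₄n 8 (by norm_num) (by norm_num), hs₂]
  have h11' : s₇ 11 = body.reverse := by rw [hs₇]; simp
  have a8 := runsLe_moveStack (a := 11) (b := 8) (by norm_num) s₇
  rw [h8, h11'] at a8
  obtain ⟨s₈, hs₈⟩ : ∃ s : Store, s = Function.update (Function.update s₇ 8
    (body.reverse.reverse ++ [])) 11 [] := ⟨_, rfl⟩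
  rw [← hs₈, List.length_reverse] at a8
  have hs₈n : ∀ r, r % 3 = 2 → r ≠ 8 → r ≠ 11 → r ≠ 20 → s₈ r = s₂ r := fun r h1 h2 h3 h4 => by
    rw [hs₈, Function.update_of_ne h3, Function.update_of_ne h2, hs₇, Function.update_of_ne h3,
      hs₆, Function.update_of_ne (by omega), Function.update_of_ne h3, hs₅n r h1,
      hs₄n r (by omega) h4]
  have h20' : s₈ 20 = List.replicate m true := by
    rw [hs₈, hs₇, hs₆]
    simp [hs₅n 20 (by norm_num), hs₄]
  -- run `M`
  obtain ⟨s₉, a9, hs₉, hs₉'⟩ := RunsLe.rename (f := fun r => 3 * r + 5)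
    (fun a b h => by simp only at h; omega) hM (S := s₈) (fun r => by
      rcases r with _ | _ | _ | _ | _ | _ | r
      · rw [hs₈n _ (by norm_num) (by norm_num) (by norm_num) (by norm_num), hs₂]; rfl
      · rw [hs₈]; simp [st]
      · rw [hs₈]; simp [st]
      · rw [hs₈n _ (by norm_num) (by norm_num) (by norm_num) (by norm_num), hs₂]; rfl
      · rw [hs₈n _ (by norm_num) (by norm_num) (by norm_num) (by norm_num), hs₂]; simp [st]
      · rw [show 3 * (0 + 1 + 1 + 1 + 1 + 1) + 5 = 20 by norm_num, h20']; simp [st]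
      · rw [hs₈n _ (by omega) (by omega) (by omega) (by omega), hs₂]
        simp only [show 3 * (r + 1 + 1 + 1 + 1 + 1 + 1) + 5 ≠ 0 by omega,
          show 3 * (r + 1 + 1 + 1 + 1 + 1 + 1) + 5 ≠ 1 by omega,
          show 3 * (r + 1 + 1 + 1 + 1 + 1 + 1) + 5 ≠ 4 by omega,
          show 3 * (r + 1 + 1 + 1 + 1 + 1 + 1) + 5 ≠ 17 by omega, or_false, if_false]
        simp [st])
  have h5 : s₉ 5 = out.reverse := hs₉ 0
  have h2 : s₉ 2 = [] := by
    rw [hs₉' 2 (fun q => by omega), hs₈n 2 (by norm_num) (by norm_num) (by norm_num) (by norm_num),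
      hs₂]; simp
  have hlen : out.length ≤ T₃ := by
    obtain ⟨t, ht, h⟩ := hM
    have := h.length_le 0
    simp only [st, List.length_reverse, List.length_nil] at this
    omega
  have a10 : RunsLe (.push 5 false) s₉ (Function.update s₉ 5 (false :: out.reverse)) 1 :=
    RunsLe.push (by rw [h5])
  have a11 := runsLe_moveStack (a := 5) (b := 2) (by norm_num)
    (Function.update s₉ 5 (false :: out.reverse))
  obtain ⟨t, ht, h⟩ := a1.seq (a2.seq (a3.seq (a4.seq (a5.seq (a6.seq (a7.seq (a8.seq (a9.seq
    (a10.seq a11)))))))))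
  refine ⟨_, t, h, ?_, ht.trans ?_⟩
  · simp [h2]
  · simp only [Function.update_self, List.length_cons, List.length_append, List.length_reverse,
      List.length_nil]
    omega

end QExpand
namespace QExpand

/-! ### Choice of the register widths and efficiency of the expanded family. -/

theorem PolyTimeUnary.le {l : ℕ → ℕ} (hl : PolyTimeUnary l) :
    ∃ q : Polynomial ℕ, ∀ n, l n ≤ q.eval n := by
  obtain ⟨P, q, h⟩ := hl
  exact ⟨q, fun n => by simpa using (h n).length_le⟩

/-- The scope with two numbers and a string. -/
def pairScope {Γ : Type} (n l : Γ → ℕ) (dat : Γ → List Bool) : Scope Γ where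
  depth := 2
  env γ := [n γ, l γ]
  dat := dat
  length_env _ := rfl

theorem IsExpr.pair_fst {Γ : Type} (n l : Γ → ℕ) (dat : Γ → List Bool) :
    IsExpr (pairScope n l dat) n := ⟨.var 0, fun _ _ => rfl⟩

theorem IsExpr.pair_snd {Γ : Type} (n l : Γ → ℕ) (dat : Γ → List Bool) :
    IsExpr (pairScope n l dat) l := ⟨.var 1, fun _ _ => rfl⟩

/-- The number of bits of a letter. -/
def letterBits (Q : Polynomial ℕ) (n l : ℕ) : ℕ := Q.eval n + l + 1

/-- The number of further bits of a register. -/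
def spareBits (Q s : Polynomial ℕ) (n l : ℕ) : ℕ := letterBits Q n l * l + 2 + s.eval n

/-- The number of bits of a register. -/
def regBits (Q s : Polynomial ℕ) (n l : ℕ) : ℕ := letterBits Q n l + spareBits Q s n l

theorem add_le_two_pow_letterBits {Q : Polynomial ℕ} {n l p : ℕ} (hp : p ≤ 2 ^ Q.eval n) :
    p + l ≤ 2 ^ letterBits Q n l := by
  have h1 : l < 2 ^ l := Nat.lt_two_pow_self
  have h2 : 1 ≤ 2 ^ Q.eval n := Nat.one_le_two_pow
  have h3 : 1 ≤ 2 ^ l := Nat.one_le_two_pow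
  rw [letterBits, pow_succ, pow_add]
  nlinarith

section

variable {Γ : Type} {σ : Scope Γ} {n l : Γ → ℕ}

theorem IsExpr.letterBits (Q : Polynomial ℕ) (hn : IsExpr σ n) (hl : IsExpr σ l) :
    IsExpr σ fun γ => QExpand.letterBits Q (n γ) (l γ) := ((hn.poly Q).add hl).succ

theorem IsExpr.spareBits (Q s : Polynomial ℕ) (hn : IsExpr σ n) (hl : IsExpr σ l) :
    IsExpr σ fun γ => QExpand.spareBits Q s (n γ) (l γ) :=
  (((hn.letterBits Q hl).mul hl).add (.const 2)).add (hn.poly s)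

theorem IsExpr.regBits (Q s : Polynomial ℕ) (hn : IsExpr σ n) (hl : IsExpr σ l) :
    IsExpr σ fun γ => QExpand.regBits Q s (n γ) (l γ) :=
  (hn.letterBits Q hl).add (hn.spareBits Q s hl)

/-- Expressions contain no subtraction; the summand 2 in `spareBits` allows `w - 1` to be rewritten
as a polynomial. -/
theorem IsExpr.regBits_pred (Q s : Polynomial ℕ) (hn : IsExpr σ n) (hl : IsExpr σ l) :
    IsExpr σ fun γ => QExpand.regBits Q s (n γ) (l γ) - 1 := by
  have : (fun γ => QExpand.regBits Q s (n γ) (l γ) - 1) = fun γ => QExpand.letterBits Q (n γ) (l γ) +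
      (QExpand.letterBits Q (n γ) (l γ) * l γ + 1 + s.eval (n γ)) := by
    ext γ; simp only [QExpand.regBits, QExpand.spareBits]; omega
  rw [this]
  exact (hn.letterBits Q hl).add ((((hn.letterBits Q hl).mul hl).add (.const 1)).add (hn.poly s))

end

theorem Emit.length_le {Γ : Type} {σ : Scope Γ} {f : Γ → List Bool} (h : Emit σ f) :
    ∃ q : Polynomial ℕ, ∀ γ M, (∀ x ∈ σ.env γ, x ≤ M) → (σ.dat γ).length ≤ M →
      (f γ).length ≤ q.eval M := by
  obtain ⟨P, q, h⟩ := h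
  refine ⟨q, fun γ M h1 h2 => ?_⟩
  obtain ⟨t, ht, h⟩ := h γ [] M h1 h2
  have := h.length_le 0
  simp only [st, List.append_nil, List.length_reverse, List.length_nil] at this
  omega

/-- The Schur transform and its inverse have polynomial size. -/
theorem length_schurCircuit_le {l : ℕ → ℕ} (hl : PolyTimeUnary l) (Q s : Polynomial ℕ) :
    ∃ q : Polynomial ℕ, ∀ n,
      (encGates (schurCircuit (regBits Q s n (l n)) (l n) (letterBits Q n (l n))
        (spareBits Q s n (l n)))).length +
      (encGates (dinv (schurCircuit (regBits Q s n (l n)) (l n) (letterBits Q n (l n))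
        (spareBits Q s n (l n))))).length ≤ q.eval n := by
  obtain ⟨ql, hql⟩ := hl.le
  have h1 := IsExpr.pair_fst (fun n : ℕ => n) l (fun _ => [])
  have h2 := IsExpr.pair_snd (fun n : ℕ => n) l (fun _ => [])
  have h := EmitC.schurCircuit (h1.regBits Q s h2) (h1.regBits_pred Q s h2) h2
    (h1.letterBits Q h2) (h1.spareBits Q s h2)
  obtain ⟨q, hq⟩ := (h.enc.append h.dinv.enc).length_le
  refine ⟨q.comp (.X + ql), fun n => ?_⟩
  have h3 := hql n
  simpa using hq n (n + ql.eval n) (by simp [pairScope]; omega) (by simp [pairScope])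

/-- The time bound `s` of the given generator is also the allowance in the register width: it bounds
the length of each description, hence each of its wires, so the circuit for `U` fits into one
register. -/
theorem EfficientFamily.expand {d p l : ℕ → ℕ}
    {U : ∀ n, (Fin (d n) → Bool) → Matrix (Fin (p n)) (Fin (p n)) ℂ} (hU : EfficientFamily d p U)
    (hl : PolyTimeUnary l) (hl_pos : ∀ n, 0 < l n) :
    EfficientFamily d (fun n => symDim (l n) (p n)) fun n k => QExpand.expand (l n) (U n k) := by
  obtain ⟨Q, hQ⟩ := hU.dim_le
  obtain ⟨ql, hql⟩ := hl.le
  have hK : ∀ n, p n + l n ≤ 2 ^ letterBits Q n (l n) := fun n => add_le_two_pow_letterBits (hQ n)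
  refine ⟨fun n => Nat.choose_pos (by have := hU.dim_pos n; omega), ?_, fun n k =>
    expand_mem_unitaryGroup (hl_pos n) (hU.isUnitary n k), ?_⟩
  · refine ⟨(Q + ql + 1) * ql, fun n => (symDim_le_two_pow (hl_pos n) (hK n)).trans
      (Nat.pow_le_pow_right (by norm_num) ?_)⟩
    simp only [Polynomial.eval_mul, Polynomial.eval_add, Polynomial.eval_one, letterBits]
    have := hql n
    gcongr
  · obtain ⟨P, s, hP⟩ := hU.generate
    choose c hc hcU using hP
    obtain ⟨L, qL, hL⟩ := hl
    set Γ := Σ n, (Fin (d n) → Bool)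
    have h1 := IsExpr.pair_fst (fun γ : Γ => γ.1) (fun γ => l γ.1)
      (fun γ => encGates (c γ.1 γ.2))
    have h2 := IsExpr.pair_snd (fun γ : Γ => γ.1) (fun γ => l γ.1)
      (fun γ => encGates (c γ.1 γ.2))
    obtain ⟨M, q, hM⟩ := Emit.expandCircuit (c := fun γ : Γ => c γ.1 γ.2) (fun γ => rfl)
      (h1.regBits Q s h2) (h1.regBits_pred Q s h2) h2 (h1.letterBits Q h2) (h1.spareBits Q s h2)
    refine ⟨compose L P M, 20 * .X + 20 + 10 * qL + 20 * s + 10 * q.comp (.X + ql + s),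
      fun n k => ⟨expandCircuit (regBits Q s n (l n)) (l n) (letterBits Q n (l n))
        (spareBits Q s n (l n)) (c n k), ?_, ?_⟩⟩
    · have h3 := hql n
      have h4 := (hc n k).length_le
      rw [show encCircuit (c n k) = encGates (c n k) ++ [false] from rfl] at h4
      rw [List.length_append] at h4
      -- The size parameter must dominate both numbers `n`, `l n` and the length of the description.
      have h5 := hM ⟨n, k⟩ [] (n + ql.eval n + s.eval n) (by simp [pairScope]; omega)
        (by simp only [pairScope]; omega)
      rw [List.append_nil] at h5
      have := outputsWithin_compose (hL n) (hc n k) h5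
      show OutputsWithin _ _ _ (encGates _ ++ [false]) _
      simpa using this
    · refine implements_expandCircuit (hl_pos n) rfl ?_ (hK n) ?_ (hcU n k)
      · simp only [spareBits]; omega
      · have h4 := (hc n k).length_le
        rw [show encCircuit (c n k) = encGates (c n k) ++ [false] from rfl, List.length_append] at h4
        refine (wiresBelow_length (c n k)).mono ?_
        simp only [spareBits]; omega

end QExpand
namespace QExpand

/-! ## The second moment of the expansion of a Haar random unitary -/

section

variable {l p : ℕ}

/-- Both sides agree after multiplication by `V`, by the intertwining relation, and `V` has a left
inverse. -/
theorem expand_mul (hl : 0 < l) (U V : Matrix (Fin p) (Fin p) ℂ) :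
    expand l (U * V) = expand l U * expand l V := by
  have h : symSchurInv l p * expand l (U * V) = symSchurInv l p * (expand l U * expand l V) := by
    rw [symSchurInv_mul_expand hl, ← Matrix.mul_assoc, symSchurInv_mul_expand hl, Matrix.mul_assoc,
      symSchurInv_mul_expand hl, ← Matrix.mul_assoc, tensorPower_eq_tens, tensorPower_eq_tens,
      tensorPower_eq_tens, tens_mul]
  have := congrArg ((symSchurInv l p).conjTranspose * ·) h
  simpa only [← Matrix.mul_assoc, symSchurInv_isometry hl, Matrix.one_mul] using this

theorem symSchurInv_ne_zero {x : Fin l → Fin p} {y : Fin (symDim l p)} (h : typeIndex x = y) :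
    symSchurInv l p x y ≠ 0 := by
  intro h0
  have h1 := symSchurInv_mul_self x x y h h
  have h2 := typeCount_pos x
  rw [h] at h2
  rw [h0, zero_mul] at h1
  have h3 : (Fintype.card {z : Fin l → Fin p // typeIndex z = (y : ℕ)} : ℝ) ≠ 0 := by
    exact_mod_cast h2.ne'
  exact inv_ne_zero h3 (by exact_mod_cast h1.symm)

theorem symSchurInv_mul_expand_apply (hl : 0 < l) (U : Matrix (Fin p) (Fin p) ℂ)
    {x : Fin l → Fin p} {y : Fin (symDim l p)} (h : typeIndex x = y) (m : Fin (symDim l p)) :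
    symSchurInv l p x y * expand l U y m =
      ∑ x' : Fin l → Fin p, (∏ i, U (x i) (x' i)) * symSchurInv l p x' m := by
  have h1 := congrFun (congrFun (symSchurInv_mul_expand hl U) x) m
  rw [Matrix.mul_apply, Matrix.mul_apply, Finset.sum_eq_single y] at h1
  · exact h1
  · intro z _ hz
    rw [symSchurInv, Matrix.of_apply, if_neg, zero_mul]
    rw [h]
    exact fun e => hz (Fin.ext e).symm
  · simp

/-- Two different types are told apart by the number of occurrences of some letter. -/
theorem exists_count_ne {x x' : Fin l → Fin p} (h : typeIndex x ≠ typeIndex x') :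
    ∃ a : Fin p, (Finset.univ.filter fun i => x i = a).card ≠
      (Finset.univ.filter fun i => x' i = a).card := by
  by_contra! hc
  refine h (typeIndex_eq_iff.mpr ?_)
  have h1 : ∀ x : Fin l → Fin p, (letters x : Multiset ℕ) =
      (Finset.univ.val.map x).map Fin.val := by
    intro x
    rw [letters, Multiset.map_map]
    simp [Fin.univ_def, List.ofFn_eq_map, Function.comp_def]
  rw [h1, h1]
  congr 1
  ext a
  have h2 : ∀ x : Fin l → Fin p, Multiset.count a ((Finset.univ : Finset (Fin l)).val.map x) =
      (Finset.univ.filter fun i => x i = a).card := by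
    intro x
    rw [Multiset.count_map, Finset.card, Finset.filter_val]
    simp only [eq_comm]
  rw [h2, h2, hc]

/-- The diagonal unitary that multiplies letter `a` by `z`. -/
def letterPhase (p : ℕ) (a : Fin p) (z : ℂ) : Matrix (Fin p) (Fin p) ℂ :=
  Matrix.diagonal fun b => if b = a then z else 1

theorem letterPhase_mem (a : Fin p) {z : ℂ} (hz : star z * z = 1) :
    letterPhase p a z ∈ Matrix.unitaryGroup (Fin p) ℂ := by
  rw [Matrix.mem_unitaryGroup_iff', Matrix.star_eq_conjTranspose, letterPhase,
    Matrix.diagonal_conjTranspose, Matrix.diagonal_mul_diagonal, ← Matrix.diagonal_one]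
  congr 1
  ext b
  simp only [Pi.star_apply]
  split_ifs
  · exact hz
  · simp

theorem expand_letterPhase (hl : 0 < l) (a : Fin p) (z : ℂ) {x : Fin l → Fin p}
    {y : Fin (symDim l p)} (h : typeIndex x = y) (m : Fin (symDim l p)) :
    expand l (letterPhase p a z) y m =
      if y = m then z ^ (Finset.univ.filter fun i => x i = a).card else 0 := by
  refine mul_left_cancel₀ (symSchurInv_ne_zero h) ?_
  rw [symSchurInv_mul_expand_apply hl _ h, Finset.sum_eq_single x]
  · rw [letterPhase]
    simp only [Matrix.diagonal_apply_eq]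
    rw [Finset.prod_ite, Finset.prod_const, Finset.prod_const_one, mul_one]
    split_ifs with hy
    · rw [← hy, mul_comm]
    · rw [symSchurInv, Matrix.of_apply, if_neg, mul_zero, mul_zero]
      rw [h]; exact fun e => hy (Fin.ext e)
  · intro x' _ hx'
    obtain ⟨i, hi⟩ := Function.ne_iff.mp hx'
    rw [Finset.prod_eq_zero (Finset.mem_univ i), zero_mul]
    rw [letterPhase, Matrix.diagonal_apply_ne _ hi.symm]
  · simp

/-- A unitary without zero entries. -/
noncomputable def mixing (p : ℕ) : Matrix (Fin p) (Fin p) ℂ :=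
  1 + Matrix.of fun _ _ => (Complex.I - 1) / p

/-- The matrix with all entries `1/p` is a projection, so `mixing` has eigenvalue `i` on constant
vectors and 1 on their complement. -/
theorem mixing_mem (p : ℕ) : mixing p ∈ Matrix.unitaryGroup (Fin p) ℂ := by
  rcases Nat.eq_zero_or_pos p with rfl | hp
  · rw [Matrix.mem_unitaryGroup_iff']; ext i; exact i.elim0
  have hp' : (p : ℂ) ≠ 0 := by exact_mod_cast hp.ne'
  have h1 : (mixing p).conjTranspose = 1 + Matrix.of fun _ _ => (-Complex.I - 1) / p := by
    ext i j
    simp only [mixing, Matrix.conjTranspose_apply, Matrix.add_apply, Matrix.of_apply, star_add]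
    rw [← Matrix.conjTranspose_apply, Matrix.conjTranspose_one]
    simp
  rw [Matrix.mem_unitaryGroup_iff', Matrix.star_eq_conjTranspose, h1, mixing, Matrix.add_mul,
    Matrix.mul_add, Matrix.mul_add, Matrix.one_mul, Matrix.one_mul, Matrix.mul_one]
  ext i j
  simp only [Matrix.add_apply, Matrix.of_apply, Matrix.mul_apply, Finset.sum_const,
    Finset.card_univ, Fintype.card_fin, nsmul_eq_mul]
  field_simp
  ring_nf
  simp only [Complex.I_sq]
  ring

theorem mixing_apply_ne_zero (i j : Fin p) : mixing p i j ≠ 0 := by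
  have hp : (p : ℝ) ≠ 0 := by have := i.2; exact_mod_cast (show p ≠ 0 by omega)
  intro h
  have h1 := congrArg Complex.im h
  have h2 : ((1 : Matrix (Fin p) (Fin p) ℂ) i j).im = 0 := by
    rw [Matrix.one_apply]; split_ifs <;> simp
  rw [mixing, Matrix.add_apply, Matrix.of_apply, Complex.add_im, h2, zero_add,
    Complex.div_natCast_im] at h1
  simp [hp] at h1

/-- In the row of a constant word all words of type `m` contribute the same product of nonzero
entries with the same positive weight, so nothing cancels. -/
theorem expand_mixing_ne_zero (hl : 0 < l) {a : Fin p} {y : Fin (symDim l p)}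
    (h : typeIndex (fun _ : Fin l => a) = y) (m : Fin (symDim l p)) :
    expand l (mixing p) y m ≠ 0 := by
  obtain ⟨x₀, hx₀⟩ := exists_typeIndex_eq hl m
  have h1 : ∑ x' : Fin l → Fin p, (∏ i, mixing p a (x' i)) * symSchurInv l p x' m =
      (∏ i, mixing p a (x₀ i)) * ∑ x' : Fin l → Fin p, symSchurInv l p x' m := by
    rw [Finset.mul_sum]
    refine Finset.sum_congr rfl fun x' _ => ?_
    by_cases hx : typeIndex x' = m
    · obtain ⟨σ, rfl⟩ := exists_perm_of_typeIndex_eq (hx₀.trans hx.symm)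
      rw [← Equiv.prod_comp σ fun i => mixing p a (x₀ i)]
      rfl
    · rw [symSchurInv, Matrix.of_apply, if_neg hx, mul_zero, mul_zero]
  have h2 : ∑ x' : Fin l → Fin p, symSchurInv l p x' m =
      (Fintype.card {z : Fin l → Fin p // typeIndex z = (m : ℕ)} : ℂ) * symSchurInv l p x₀ m := by
    rw [Fintype.card_subtype, ← nsmul_eq_mul, ← Finset.sum_const, Finset.sum_filter]
    refine Finset.sum_congr rfl fun x' _ => ?_
    by_cases hx : typeIndex x' = m
    · simp only [symSchurInv, Matrix.of_apply, if_pos hx, if_pos hx₀]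
    · simp only [symSchurInv, Matrix.of_apply, if_neg hx]
  intro h0
  have h3 := symSchurInv_mul_expand_apply hl (mixing p) h m
  rw [h0, mul_zero, h1, h2] at h3
  have h4 := typeCount_pos x₀
  rw [hx₀] at h4
  refine mul_ne_zero (Finset.prod_ne_zero_iff.mpr fun i _ => mixing_apply_ne_zero a (x₀ i))
    (mul_ne_zero (by exact_mod_cast h4.ne') (symSchurInv_ne_zero hx₀)) h3.symm

/-- Schur's lemma for the symmetric power. -/
theorem eq_smul_one_of_commute (hl : 0 < l) (hp : 0 < p)
    {X : Matrix (Fin (symDim l p)) (Fin (symDim l p)) ℂ}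
    (hX : ∀ U ∈ Matrix.unitaryGroup (Fin p) ℂ, expand l U * X = X * expand l U) :
    ∃ c : ℂ, X = c • 1 := by
  -- Commutation with a diagonal unitary that multiplies one letter by a primitive `(l+1)`-st root
  -- of unity: multiplicities lie in `0, …, l`, so the eigenvalues separate two types that differ in
  -- that letter.
  have hdiag : ∀ y y', y ≠ y' → X y y' = 0 := by
    intro y y' hy
    obtain ⟨x, hx⟩ := exists_typeIndex_eq hl y
    obtain ⟨x', hx'⟩ := exists_typeIndex_eq hl y'
    obtain ⟨a, ha⟩ := exists_count_ne (x := x) (x' := x') (by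
      rw [hx, hx']; exact fun e => hy (Fin.ext e))
    have hζ := Complex.isPrimitiveRoot_exp (l + 1) (by omega)
    set ζ := Complex.exp (2 * Real.pi * Complex.I / (l + 1 : ℕ))
    have hz : star ζ * ζ = 1 := by
      rw [Complex.star_def, ← Complex.normSq_eq_conj_mul_self, Complex.normSq_eq_norm_sq,
        hζ.norm'_eq_one (by omega)]
      simp
    have h1 := congrFun (congrFun (hX _ (letterPhase_mem a hz)) y) y'
    rw [Matrix.mul_apply, Matrix.mul_apply, Finset.sum_eq_single y, Finset.sum_eq_single y',
      expand_letterPhase hl a ζ hx, expand_letterPhase hl a ζ hx', if_pos rfl, if_pos rfl] at h1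
    · by_contra h0
      have h2 : ζ ^ (Finset.univ.filter fun i => x i = a).card =
          ζ ^ (Finset.univ.filter fun i => x' i = a).card :=
        mul_right_cancel₀ h0 (h1.trans (mul_comm _ _))
      have hc : ∀ x : Fin l → Fin p, (Finset.univ.filter fun i => x i = a).card < l + 1 :=
        fun x => Nat.lt_succ_of_le ((Finset.card_le_univ _).trans (by simp))
      exact ha (hζ.pow_inj (hc x) (hc x') h2)
    · intro z _ hz'
      obtain ⟨u, hu⟩ := exists_typeIndex_eq hl z
      rw [expand_letterPhase hl a ζ hu, if_neg hz', mul_zero]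
    · simp
    · intro z _ hz'
      rw [expand_letterPhase hl a ζ hx, if_neg hz'.symm, zero_mul]
    · simp
  set y₀ : Fin (symDim l p) := ⟨typeIndex (fun _ : Fin l => (⟨0, hp⟩ : Fin p)), typeIndex_lt hl _⟩
  refine ⟨X y₀ y₀, ?_⟩
  ext y y'
  rw [Matrix.smul_apply, Matrix.one_apply, smul_eq_mul]
  split_ifs with h
  · subst h
    -- With `X` diagonal, entry `(y₀, y)` of the commutation relation for `mixing` compares the
    -- diagonal entries at `y₀` and `y` through a nonzero factor.
    have h1 := congrFun (congrFun (hX _ (mixing_mem p)) y₀) y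
    rw [Matrix.mul_apply, Matrix.mul_apply, Finset.sum_eq_single y, Finset.sum_eq_single y₀] at h1
    · rw [mul_one]
      have h2 : expand l (mixing p) y₀ y ≠ 0 := expand_mixing_ne_zero hl rfl y
      exact mul_left_cancel₀ h2 (h1.trans (mul_comm _ _))
    · intro z _ hz; rw [hdiag _ _ hz.symm, zero_mul]
    · simp
    · intro z _ hz; rw [hdiag _ _ hz, mul_zero]
    · simp
  · rw [hdiag _ _ h, mul_zero]

/-! ### Haar integrals of products of matrix entries. -/

instance isProbabilityMeasure_haarUnitary (p : ℕ) : IsProbabilityMeasure (haarUnitary p) :=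
  ⟨by simpa [haarUnitary] using Measure.haarMeasure_self (K₀ :=
    (⊤ : TopologicalSpace.PositiveCompacts (Matrix.unitaryGroup (Fin p) ℂ)))⟩

instance isMulLeftInvariant_haarUnitary (p : ℕ) : (haarUnitary p).IsMulLeftInvariant :=
  inferInstanceAs (Measure.haarMeasure _).IsMulLeftInvariant

theorem continuous_expand_apply (y m : Fin (symDim l p)) :
    Continuous fun V : Matrix.unitaryGroup (Fin p) ℂ =>
      expand l (V : Matrix (Fin p) (Fin p) ℂ) y m := by
  simp only [expand, Matrix.mul_apply, tensorPower, Matrix.of_apply]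
  refine continuous_finsetSum _ fun x _ => Continuous.mul (continuous_finsetSum _ fun x' _ =>
    continuous_const.mul (continuous_finsetProd _ fun i _ => ?_)) continuous_const
  exact (continuous_subtype_val (p := fun M => M ∈ Matrix.unitaryGroup (Fin p) ℂ)).matrix_elem _ _

theorem integrable_haarUnitary {E : Type*} [NormedAddCommGroup E]
    {f : Matrix.unitaryGroup (Fin p) ℂ → E} (hf : Continuous f) : Integrable f (haarUnitary p) :=
  hf.integrable_of_hasCompactSupport (HasCompactSupport.of_compactSpace f)

/-- For fixed `m, m'` the integrals form a matrix `X` in `y, y'`. Left invariance of the Haar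
measure gives `W X W† = X` for all `W = expand l U`, so `X` is scalar by Schur's lemma, and
unitarity of the expansion determines its trace. -/
theorem integral_expand_mul_star (hl : 0 < l) (hp : 0 < p) (y m y' m' : Fin (symDim l p)) :
    ∫ V : Matrix.unitaryGroup (Fin p) ℂ, expand l (V : Matrix (Fin p) (Fin p) ℂ) y m *
      star (expand l (V : Matrix (Fin p) (Fin p) ℂ) y' m') ∂(haarUnitary p) =
        if y = y' ∧ m = m' then ((symDim l p : ℝ)⁻¹ : ℂ) else 0 := by
  let W : Matrix.unitaryGroup (Fin p) ℂ → Matrix (Fin (symDim l p)) (Fin (symDim l p)) ℂ :=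
    fun V => expand l (V : Matrix (Fin p) (Fin p) ℂ)
  have hcont : ∀ y m y' m', Continuous fun V => W V y m * star (W V y' m') := fun y m y' m' =>
    (continuous_expand_apply y m).mul (continuous_expand_apply y' m').star
  have hint := fun y m y' m' => integrable_haarUnitary (hcont y m y' m')
  let X : Matrix (Fin (symDim l p)) (Fin (symDim l p)) ℂ := Matrix.of fun y y' => ∫ V, W V y m * star (W V y' m') ∂(haarUnitary p)
  have hinv : ∀ U ∈ Matrix.unitaryGroup (Fin p) ℂ, expand l U * X * (expand l U).conjTranspose = X := by
    intro U hU
    ext y y'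
    have h1 := integral_mul_left_eq_self (μ := haarUnitary p)
      (fun V => W V y m * star (W V y' m')) ⟨U, hU⟩
    refine Eq.trans ?_ h1
    have h2 : ∀ V, W (⟨U, hU⟩ * V) y m * star (W (⟨U, hU⟩ * V) y' m') =
        ∑ z', ∑ z, expand l U y z * star (expand l U y' z') * (W V z m * star (W V z' m')) := by
      intro V
      have h3 : W (⟨U, hU⟩ * V) = expand l U * W V := expand_mul hl U V
      rw [h3, Matrix.mul_apply, Matrix.mul_apply, star_sum, Finset.sum_mul_sum, Finset.sum_comm]
      refine Finset.sum_congr rfl fun z' _ => Finset.sum_congr rfl fun z _ => ?_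
      rw [star_mul']; ring
    simp only [h2]
    rw [integral_finsetSum _ fun z' _ => integrable_finsetSum _ fun z _ =>
      (hint z m z' m').const_mul _]
    rw [Matrix.mul_apply]
    refine Finset.sum_congr rfl fun z' _ => ?_
    rw [integral_finsetSum _ fun z _ => (hint z m z' m').const_mul _, Matrix.mul_apply,
      Finset.sum_mul]
    refine Finset.sum_congr rfl fun z _ => ?_
    rw [integral_const_mul, Matrix.conjTranspose_apply, show X z z' = ∫ V, W V z m * star (W V z' m') ∂(haarUnitary p) from rfl]
    ring
  obtain ⟨c, hc⟩ := eq_smul_one_of_commute hl hp (X := X) fun U hU => by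
    conv_rhs => rw [← hinv U hU]
    have := Matrix.mem_unitaryGroup_iff'.mp (expand_mem_unitaryGroup hl hU)
    rw [Matrix.mul_assoc _ _ (expand l U), ← Matrix.star_eq_conjTranspose, this, Matrix.mul_one]
  have htr : X.trace = if m = m' then 1 else 0 := by
    have h1 : X.trace = ∫ V, ∑ y, W V y m * star (W V y m') ∂(haarUnitary p) := by
      rw [integral_finsetSum _ fun z _ => hint z m z m']; rfl
    have h2 : ∀ V, ∑ y, W V y m * star (W V y m') = if m = m' then 1 else 0 := by
      intro V
      have h3 := congrFun (congrFun (Matrix.mem_unitaryGroup_iff'.mp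
        (expand_mem_unitaryGroup hl V.2)) m') m
      rw [Matrix.star_eq_conjTranspose, Matrix.mul_apply, Matrix.one_apply] at h3
      simp only [Matrix.conjTranspose_apply] at h3
      simp only [eq_comm (a := m), ← h3]
      exact Finset.sum_congr rfl fun y _ => mul_comm _ _
    rw [h1]
    simp only [h2]
    simp
  have hN : (symDim l p : ℂ) ≠ 0 := by
    have : 0 < symDim l p := Nat.choose_pos (by omega)
    exact_mod_cast this.ne'
  rw [hc, Matrix.trace_smul, Matrix.trace_one, smul_eq_mul, Fintype.card_fin] at htr
  have hX : X y y' = if y = y' then c else 0 := by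
    rw [hc, Matrix.smul_apply, Matrix.one_apply]; simp
  change X y y' = _
  rw [hX]
  by_cases hm : m = m'
  · rw [if_pos hm] at htr
    have hc' : c = ((symDim l p : ℝ)⁻¹ : ℂ) := by
      rw [Complex.ofReal_natCast]
      exact eq_inv_of_mul_eq_one_left htr
    simp [hm, hc']
  · rw [if_neg hm] at htr
    have hc' : c = 0 := by
      rcases mul_eq_zero.mp htr with h | h
      · exact h
      · exact absurd h hN
    simp [hm, hc']

end

end QExpand
namespace QExpand

/-! ## Averages of acceptance probabilities -/

theorem acceptProb_of_subset {ψ : QState} {F : Finset (Finset ℕ)} (h : ψ.support ⊆ F) :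
    acceptProb ψ = ∑ S ∈ F, if 0 ∈ S then ‖ψ S‖ ^ 2 else 0 := by
  rw [acceptProb, Finsupp.sum_of_support_subset _ h]
  simp

/-- Expand the square; orthogonality of the coefficient functions leaves the diagonal terms. -/
theorem integral_norm_sum_sq {ι : Type*} [Fintype ι] [DecidableEq ι] {p : ℕ}
    {w : ι → Matrix.unitaryGroup (Fin p) ℂ → ℂ} (hw : ∀ a, Continuous (w a)) {c : ℝ}
    (horth : ∀ a b, ∫ V, w a V * star (w b V) ∂(haarUnitary p) = if a = b then (c : ℂ) else 0)
    (z : ι → ℂ) :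
    ∫ V, ‖∑ a, w a V * z a‖ ^ 2 ∂(haarUnitary p) = c * ∑ a, ‖z a‖ ^ 2 := by
  have h1 : ∀ V, ((‖∑ a, w a V * z a‖ ^ 2 : ℝ) : ℂ) =
      ∑ a, ∑ b, z a * star (z b) * (w a V * star (w b V)) := by
    intro V
    rw [← Complex.normSq_eq_norm_sq, Complex.normSq_eq_conj_mul_self, mul_comm, ← Complex.star_def,
      star_sum, Finset.sum_mul_sum]
    refine Finset.sum_congr rfl fun a _ => Finset.sum_congr rfl fun b _ => ?_
    rw [star_mul']; ring
  have hint : ∀ a b, Integrable (fun V => z a * star (z b) * (w a V * star (w b V)))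
      (haarUnitary p) := fun a b =>
    (integrable_haarUnitary ((hw a).mul (hw b).star)).const_mul _
  have h2 : ((∫ V, ‖∑ a, w a V * z a‖ ^ 2 ∂(haarUnitary p) : ℝ) : ℂ) =
      ((c * ∑ a, ‖z a‖ ^ 2 : ℝ) : ℂ) := by
    rw [← integral_complex_ofReal]
    simp only [h1]
    rw [integral_finsetSum _ fun a _ => integrable_finsetSum _ fun b _ => hint a b]
    push_cast
    rw [Finset.mul_sum]
    refine Finset.sum_congr rfl fun a _ => ?_
    rw [integral_finsetSum _ fun b _ => hint a b]
    simp only [integral_const_mul, horth]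
    rw [Finset.sum_eq_single a]
    · rw [if_pos rfl, ← Complex.ofReal_pow, ← Complex.normSq_eq_norm_sq,
        Complex.normSq_eq_conj_mul_self, ← Complex.star_def]
      ring
    · intro b _ hb; rw [if_neg hb.symm, mul_zero]
    · simp
  exact_mod_cast h2

/-- The states `β a` share a finite support, so acceptance is a finite sum of squared norms, and all
interference between the `β a` averages out. -/
theorem integral_acceptProb_sum {ι : Type*} [Fintype ι] [DecidableEq ι] {p : ℕ}
    {w : ι → Matrix.unitaryGroup (Fin p) ℂ → ℂ} (hw : ∀ a, Continuous (w a)) {c : ℝ}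
    (horth : ∀ a b, ∫ V, w a V * star (w b V) ∂(haarUnitary p) = if a = b then (c : ℂ) else 0)
    (β : ι → QState) :
    Integrable (fun V => acceptProb (∑ a, w a V • β a)) (haarUnitary p) ∧
    ∫ V, acceptProb (∑ a, w a V • β a) ∂(haarUnitary p) = c * ∑ a, acceptProb (β a) := by
  classical
  set F : Finset (Finset ℕ) := Finset.univ.biUnion fun a => (β a).support with hF
  have hβ : ∀ a, (β a).support ⊆ F := fun a =>
    Finset.subset_biUnion_of_mem (fun a => (β a).support) (Finset.mem_univ a)
  have h1 : ∀ V, acceptProb (∑ a, w a V • β a) =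
      ∑ S ∈ F, if 0 ∈ S then ‖∑ a, w a V * β a S‖ ^ 2 else 0 := by
    intro V
    rw [acceptProb_of_subset (F := F)]
    · simp [Finsupp.finsetSum_apply]
    · refine (Finsupp.support_finsetSum).trans (Finset.biUnion_subset.mpr fun a _ => ?_)
      exact Finsupp.support_smul.trans (hβ a)
  have hint : ∀ S ∈ F, Integrable (fun V => if 0 ∈ S then ‖∑ a, w a V * β a S‖ ^ 2 else 0)
      (haarUnitary p) := by
    intro S _
    split_ifs
    · exact integrable_haarUnitary ((continuous_finsetSum _ fun a _ =>
        (hw a).mul continuous_const).norm.pow 2)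
    · exact integrable_zero _ _ _
  simp only [h1]
  refine ⟨integrable_finsetSum _ hint, ?_⟩
  rw [integral_finsetSum _ hint, Finset.sum_congr rfl fun a _ => acceptProb_of_subset (hβ a),
    Finset.sum_comm, Finset.mul_sum]
  refine Finset.sum_congr rfl fun S _ => ?_
  split_ifs
  · exact integral_norm_sum_sq hw horth _
  · simp

/-- The joint state of the reply and of the private wires, if the message is `m` and `y` is
returned. -/
noncomputable def replyKet {N : ℕ} (A : EncAdversary N) (y m : Fin N) : QState :=
  A.state.sum fun mR z => if mR.1 = m then Finsupp.single (jointKet y mR.2) z else 0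

theorem reply0_eq {N : ℕ} (W : Matrix (Fin N) (Fin N) ℂ) (A : EncAdversary N) :
    reply0 W A = ∑ ym : Fin N × Fin N, W ym.1 ym.2 • replyKet A ym.1 ym.2 := by
  simp only [reply0, replyKet, Finsupp.sum, Finset.smul_sum]
  conv_rhs => rw [Finset.sum_comm]
  refine Finset.sum_congr rfl fun mR _ => ?_
  rw [Fintype.sum_prod_type]
  refine Finset.sum_congr rfl fun y _ => ?_
  rw [Finset.sum_eq_single mR.1]
  · simp [mul_comm]
  · intro m _ hm; simp [hm.symm]
  · simp

theorem mulVec_zeroKet {N : ℕ} (hN : 0 < N) (W : Matrix (Fin N) (Fin N) ℂ) (y : Fin N) :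
    W.mulVec (zeroKet N) y = W y ⟨0, hN⟩ := by
  rw [Matrix.mulVec, dotProduct, Finset.sum_eq_single ⟨0, hN⟩]
  · simp [zeroKet]
  · intro z _ hz
    rw [zeroKet, if_neg, mul_zero]
    exact fun h => hz (Fin.ext h)
  · simp

theorem reply1_eq {N : ℕ} (hN : 0 < N) (W : Matrix (Fin N) (Fin N) ℂ) (A : EncAdversary N)
    (m : Fin N) : reply1 W A m = ∑ y : Fin N, W y ⟨0, hN⟩ • replyKet A y m := by
  simp only [reply1, replyKet, Finsupp.sum, Finset.smul_sum]
  rw [Finset.sum_comm]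
  refine Finset.sum_congr rfl fun mR _ => ?_
  split_ifs
  · simp [mulVec_zeroKet hN, mul_comm]
  · simp

/-- With a Haar random unitary the reply is independent of the message. -/
theorem integral_guess_eq {l p : ℕ} (hl : 0 < l) (hp : 0 < p) (A : EncAdversary (symDim l p)) :
    ∫ V : Matrix.unitaryGroup (Fin p) ℂ, guess0 (expand l (V : Matrix (Fin p) (Fin p) ℂ)) A
      ∂(haarUnitary p) =
    ∫ V : Matrix.unitaryGroup (Fin p) ℂ, guess1 (expand l (V : Matrix (Fin p) (Fin p) ℂ)) A
      ∂(haarUnitary p) := by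
  have hN : 0 < symDim l p := Nat.choose_pos (by omega)
  -- For bit 0 all `N²` entries of the unitary occur as coefficients; below, for bit 1, only the
  -- column of `|0⟩`, once for each message. In both cases every pair (returned state, message) ends
  -- up with weight `1/N`.
  have h0 := integral_acceptProb_sum (p := p) (c := (symDim l p : ℝ)⁻¹)
    (w := fun (ym : Fin (symDim l p) × Fin (symDim l p)) V =>
      expand l (V : Matrix (Fin p) (Fin p) ℂ) ym.1 ym.2)
    (fun ym => continuous_expand_apply ym.1 ym.2)
    (fun a b => by
      rw [integral_expand_mul_star hl hp]
      simp only [Prod.ext_iff, Complex.ofReal_inv])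
    (fun ym => runGates A.circuit (replyKet A ym.1 ym.2))
  have h1 := fun m => integral_acceptProb_sum (p := p) (c := (symDim l p : ℝ)⁻¹)
    (w := fun (y : Fin (symDim l p)) V =>
      expand l (V : Matrix (Fin p) (Fin p) ℂ) y ⟨0, hN⟩)
    (fun y => continuous_expand_apply y _)
    (fun a b => by
      rw [integral_expand_mul_star hl hp]
      simp)
    (fun y => runGates A.circuit (replyKet A y m))
  simp only [guess0, guess1, reply0_eq, reply1_eq hN, map_sum, map_smul]
  rw [h0.2, integral_finsetSum _ fun m _ => (h1 m).1, Finset.sum_congr rfl fun m _ => (h1 m).2,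
    ← Finset.mul_sum, Fintype.sum_prod_type, Finset.sum_comm]

end QExpand
namespace QExpand

/-! ## An adversary that keeps its message -/

theorem mem_code {x i : ℕ} : i ∈ code x ↔ x.testBit i = true := by
  simp [code, Nat.mem_bitIndices]

theorem code_injective : Function.Injective code := fun x y h =>
  Nat.eq_of_testBit_eq fun i => by rw [Bool.eq_iff_iff, ← mem_code, ← mem_code, h]

theorem lt_of_mem_code {x i D : ℕ} (hx : x < 2 ^ D) (hi : i ∈ code x) : i < D := by
  by_contra h
  rw [mem_code, Nat.testBit_lt_two_pow (hx.trans_le (Nat.pow_le_pow_right (by norm_num)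
    (not_lt.mp h)))] at hi
  simp at hi

theorem lt_clog_of_mem_code {N i : ℕ} {y : Fin N} (hi : i ∈ code y) : i < Nat.clog 2 N :=
  lt_of_mem_code (y.2.trans_le (Nat.le_pow_clog (by norm_num) N)) hi

theorem jointKet_injective {N : ℕ} :
    Function.Injective fun mR : Fin N × Finset ℕ => jointKet mR.1 mR.2 := by
  rintro ⟨y, R⟩ ⟨y', R'⟩ h
  simp only [jointKet] at h
  have hy : ∀ (y : Fin N) (R : Finset ℕ) i, i < Nat.clog 2 N →
      (i ∈ code y ∪ shift (Nat.clog 2 N) R ↔ i ∈ code y) := by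
    intro y R i hi
    simp only [shift, Finset.mem_union, Finset.mem_image, or_iff_left_iff_imp]
    rintro ⟨j, _, rfl⟩; omega
  have hR : ∀ (y : Fin N) (R : Finset ℕ) i,
      (i + Nat.clog 2 N ∈ code y ∪ shift (Nat.clog 2 N) R ↔ i ∈ R) := by
    intro y R i
    simp only [shift, Finset.mem_union, Finset.mem_image, add_left_inj, exists_eq_right]
    refine or_iff_right fun h => ?_
    have := lt_clog_of_mem_code h; omega
  refine Prod.ext (Fin.ext (code_injective ?_)) ?_
  · ext i
    by_cases hi : i < Nat.clog 2 N
    · rw [← hy y R i hi, ← hy y' R' i hi, h]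
    · exact iff_of_false (fun h => hi (lt_clog_of_mem_code h)) fun h => hi (lt_clog_of_mem_code h)
  · ext i
    rw [← hR y R i, ← hR y' R' i, h]

theorem sum_mapDomain_norm_sq {α β : Type*} {f : α → β} (hf : Function.Injective f) (ψ : α →₀ ℂ) :
    ((ψ.mapDomain f).sum fun _ z => ‖z‖ ^ 2) = ψ.sum fun _ z => ‖z‖ ^ 2 :=
  Finsupp.sum_mapDomain_index_inj hf

/-- Makes room between the wires from `D` on. -/
def spread (D i : ℕ) : ℕ := if i < D then i else 2 * i - D

theorem spread_injective (D : ℕ) : Function.Injective (spread D) := by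
  intro i j h
  simp only [spread] at h
  split_ifs at h <;> omega

theorem spread_zero (D : ℕ) : spread D 0 = 0 := by simp [spread]

/-- A copy of the message, interleaved with the private wires. -/
def interleave {N : ℕ} (m : Fin N) (R : Finset ℕ) : Finset ℕ :=
  R.image (fun i => 2 * i) ∪ (code m).image fun i => 2 * i + 1

theorem interleave_injective {N : ℕ} :
    Function.Injective fun mR : Fin N × Finset ℕ => interleave mR.1 mR.2 := by
  rintro ⟨y, R⟩ ⟨y', R'⟩ h
  simp only [interleave] at h
  have h0 : ∀ (y : Fin N) (R : Finset ℕ) i, 2 * i ∈ R.image (fun i => 2 * i) ∪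
      (code y).image (fun i => 2 * i + 1) ↔ i ∈ R := by
    intro y R i
    simp only [Finset.mem_union, Finset.mem_image]
    constructor
    · rintro (⟨j, hj, e⟩ | ⟨j, hj, e⟩)
      · rwa [show i = j by omega]
      · omega
    · exact fun hi => .inl ⟨i, hi, rfl⟩
  have h1 : ∀ (y : Fin N) (R : Finset ℕ) i, 2 * i + 1 ∈ R.image (fun i => 2 * i) ∪
      (code y).image (fun i => 2 * i + 1) ↔ i ∈ code y := by
    intro y R i
    simp only [Finset.mem_union, Finset.mem_image]
    constructor
    · rintro (⟨j, hj, e⟩ | ⟨j, hj, e⟩)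
      · omega
      · rwa [show i = j by omega]
    · exact fun hi => .inr ⟨i, hi, rfl⟩
  refine Prod.ext (Fin.ext (code_injective ?_)) ?_
  · ext i; rw [← h1 y R i, ← h1 y' R' i, h]
  · ext i; rw [← h0 y R i, ← h0 y' R' i, h]

/-- The wires that hold the copy of the message. -/
def copyWires {N : ℕ} (m : Fin N) : Finset ℕ := (code m).image fun i => 2 * i + 1 + Nat.clog 2 N

/-- With `D` wires in the message register, private wire `D + i` moves to `D + 2i` and bit `i` of
the kept message sits on `D + 2i + 1`. -/
theorem jointKet_interleave {N : ℕ} (y m : Fin N) (R : Finset ℕ) :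
    jointKet y (interleave m R) = (jointKet y R).image (spread (Nat.clog 2 N)) ∪ copyWires m := by
  have h1 : (code y).image (spread (Nat.clog 2 N)) = code y := by
    conv_rhs => rw [← Finset.image_id (s := code y)]
    refine Finset.image_congr fun i hi => ?_
    rw [spread, if_pos (lt_clog_of_mem_code hi)]; rfl
  rw [jointKet, jointKet, Finset.image_union, h1, Finset.union_assoc]
  congr 1
  rw [interleave, shift, shift, Finset.image_union, Finset.image_image, Finset.image_image,
    Finset.image_image, copyWires]
  congr 1
  refine Finset.image_congr fun i _ => ?_
  simp only [Function.comp, spread, if_neg (show ¬ i + Nat.clog 2 N < Nat.clog 2 N by omega)]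
  omega

/-- The adversary that sends `|0⟩` and keeps its message. -/
noncomputable def keepMessage {N : ℕ} (hN : 0 < N) (A : EncAdversary N) : EncAdversary N where
  state := A.state.mapDomain fun mR => (⟨0, hN⟩, interleave mR.1 mR.2)
  state_unit := by
    rw [sum_mapDomain_norm_sq, A.state_unit]
    exact fun a b h => interleave_injective (Prod.ext_iff.mp h).2
  circuit := A.circuit.map (Gate.rename (spread (Nat.clog 2 N)))

theorem Gate.size_rename_le (f : ℕ → ℕ) (g : Gate) : (g.rename f).size ≤ g.size :=
  Nat.succ_le_succ Finset.card_image_le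

theorem size_keepMessage_le {N : ℕ} (hN : 0 < N) (A : EncAdversary N) :
    (keepMessage hN A).size ≤ A.size := by
  rw [EncAdversary.size, EncAdversary.size, keepMessage, List.map_map]
  exact List.sum_le_sum fun g _ => Gate.size_rename_le _ g

theorem reply0_keepMessage {N : ℕ} (hN : 0 < N) (W : Matrix (Fin N) (Fin N) ℂ)
    (A : EncAdversary N) :
    reply0 W (keepMessage hN A) = ∑ m, Finsupp.mapDomain
      (fun S => S.image (spread (Nat.clog 2 N)) ∪ copyWires m) (reply1 W A m) := by
  have h1 : ∀ m, Finsupp.mapDomain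
      (fun S => S.image (spread (Nat.clog 2 N)) ∪ copyWires m) (reply1 W A m) =
      ∑ mR ∈ A.state.support, if mR.1 = m then ∑ y : Fin N,
        Finsupp.single (jointKet y (interleave m mR.2)) (A.state mR * W y ⟨0, hN⟩) else 0 := by
    intro m
    rw [reply1, Finsupp.sum, Finsupp.mapDomain_finsetSum]
    refine Finset.sum_congr rfl fun mR _ => ?_
    split_ifs
    · rw [Finsupp.mapDomain_finsetSum]
      refine Finset.sum_congr rfl fun y _ => ?_
      rw [Finsupp.mapDomain_single, jointKet_interleave, mulVec_zeroKet hN]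
    · simp
  rw [Finset.sum_congr rfl fun m _ => h1 m, Finset.sum_comm, reply0, keepMessage,
    Finsupp.sum_mapDomain_index_inj, Finsupp.sum]
  · exact Finset.sum_congr rfl fun mR _ => by simp
  · exact fun a b h => interleave_injective (Prod.ext_iff.mp h).2

theorem acceptProb_sum_of_disjoint {ι : Type*} (s : Finset ι) (φ : ι → QState)
    (h : ∀ a ∈ s, ∀ b ∈ s, a ≠ b → Disjoint (φ a).support (φ b).support) :
    acceptProb (∑ a ∈ s, φ a) = ∑ a ∈ s, acceptProb (φ a) := by
  classical
  induction s using Finset.induction_on with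
  | empty => simp [acceptProb]
  | insert a s ha ih =>
    rw [Finset.sum_insert ha, Finset.sum_insert ha, ← ih fun b hb c hc =>
      h b (Finset.mem_insert_of_mem hb) c (Finset.mem_insert_of_mem hc)]
    refine Finsupp.sum_add_index_of_disjoint (Finset.disjoint_of_subset_right
      Finsupp.support_finsetSum ((Finset.disjoint_biUnion_right _ _ _).mpr fun b hb => ?_)) _
    exact h a (Finset.mem_insert_self a s) b (Finset.mem_insert_of_mem hb)
      fun e => ha (e ▸ hb)

/-- The circuit never touches the kept copy, so branches with different messages have disjoint
supports and their acceptance probabilities add up. This realizes the partial trace over the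
challenger's message. -/
theorem guess0_keepMessage {N : ℕ} (hN : 0 < N) (W : Matrix (Fin N) (Fin N) ℂ)
    (A : EncAdversary N) : guess0 W (keepMessage hN A) = guess1 W A := by
  have hsp : ∀ (i : ℕ) (m : Fin N), spread (Nat.clog 2 N) i ∉ copyWires m := by
    intro i m hi
    obtain ⟨j, _, e⟩ := Finset.mem_image.mp hi
    simp only [spread] at e
    split_ifs at e <;> omega
  have hmem : ∀ (S : Finset ℕ) (m : Fin N) i, spread (Nat.clog 2 N) i ∈
      S.image (spread (Nat.clog 2 N)) ∪ copyWires m ↔ i ∈ S := by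
    intro S m i
    rw [Finset.mem_union, or_iff_left (hsp i m), Finset.mem_image]
    exact ⟨fun ⟨j, hj, e⟩ => spread_injective _ e ▸ hj, fun h => ⟨i, h, rfl⟩⟩
  have hinj : ∀ (m m' : Fin N) (S S' : Finset ℕ), S.image (spread (Nat.clog 2 N)) ∪ copyWires m =
      S'.image (spread (Nat.clog 2 N)) ∪ copyWires m' → m = m' ∧ S = S' := by
    intro m m' S S' h
    have hc : ∀ (S : Finset ℕ) (m : Fin N) i, 2 * i + 1 + Nat.clog 2 N ∈
        S.image (spread (Nat.clog 2 N)) ∪ copyWires m ↔ i ∈ code m := by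
      intro S m i
      rw [Finset.mem_union, or_iff_right]
      · simp [copyWires]
      · intro hi
        obtain ⟨j, _, e⟩ := Finset.mem_image.mp hi
        simp only [spread] at e
        split_ifs at e <;> omega
    refine ⟨Fin.ext (code_injective ?_), ?_⟩
    · ext i; rw [← hc S m i, ← hc S' m' i, h]
    · ext i; rw [← hmem S m i, ← hmem S' m' i, h]
  rw [guess0, reply0_keepMessage, map_sum, guess1, acceptProb_sum_of_disjoint]
  · refine Finset.sum_congr rfl fun m _ => ?_
    rw [keepMessage]
    rw [runGates_rename (spread_injective _) _ _ fun g _ i _ => hsp i m, acceptProb,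
      Finsupp.sum_mapDomain_index_inj fun S S' h => (hinj m m S S' h).2, acceptProb]
    refine Finset.sum_congr rfl fun S _ => ?_
    have := hmem S m 0
    rw [spread_zero] at this
    simp only [this]
  · intro m _ m' _ hm
    rw [keepMessage]
    rw [runGates_rename (spread_injective _) _ _ fun g _ i _ => hsp i m,
      runGates_rename (spread_injective _) _ _ fun g _ i _ => hsp i m',
      Finset.disjoint_left]
    intro T h1 h2
    obtain ⟨S, _, rfl⟩ := Finset.mem_image.mp (Finsupp.mapDomain_support h1)
    obtain ⟨S', _, e⟩ := Finset.mem_image.mp (Finsupp.mapDomain_support h2)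
    exact hm (hinj m' m S' S e).1.symm

end QExpand
namespace QExpand

/-! ## The distinguisher that runs the encryption experiment -/

theorem runOracle_append {p : ℕ} (U : Matrix (Fin p) (Fin p) ℂ) (A B : List OGate) :
    runOracle U (A ++ B) = (runOracle U B).comp (runOracle U A) := by
  induction A with
  | nil => rfl
  | cons g A ih => simp only [List.cons_append, runOracle, ih, LinearMap.comp_assoc]

theorem runOracle_map_gate {p : ℕ} (U : Matrix (Fin p) (Fin p) ℂ) (L : List Gate) :
    runOracle U (L.map OGate.gate) = runGates L := by
  induction L with
  | nil => rfl
  | cons g L ih => simp only [List.map_cons, runOracle, runGates, ih]; rfl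

theorem shift_injective (o : ℕ) : Function.Injective (shift o) :=
  Finset.image_injective (add_left_injective o)

theorem oracleMap_single {p : ℕ} (U : Matrix (Fin p) (Fin p) ℂ) {o : ℕ} {Q : Finset ℕ}
    (hQ : Disjoint Q (shift o (Finset.range (Nat.clog 2 p)))) (x : Fin p) :
    oracleMap U o (Finsupp.single (Q ∪ shift o (code x)) 1) =
      ∑ y, U y x • Finsupp.single (Q ∪ shift o (code y)) 1 := by
  set B := shift o (Finset.range (Nat.clog 2 p)) with hB
  have hsub : ∀ y : Fin p, shift o (code y) ⊆ B := fun y =>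
    Finset.image_subset_image fun i hi => Finset.mem_range.mpr (lt_clog_of_mem_code hi)
  have h1 : (Q ∪ shift o (code x)) ∩ B = shift o (code x) := by
    rw [Finset.union_inter_distrib_right, Finset.disjoint_iff_inter_eq_empty.mp hQ,
      Finset.empty_union, Finset.inter_eq_left.mpr (hsub x)]
  have h2 : (Q ∪ shift o (code x)) \ B = Q := by
    rw [Finset.union_sdiff_distrib, Finset.sdiff_eq_self_of_disjoint hQ,
      Finset.sdiff_eq_empty_iff_subset.mpr (hsub x), Finset.union_empty]
  rw [oracleMap, Finsupp.linearCombination_single, one_smul, Finset.sum_eq_single x]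
  · rw [← hB, h1, if_pos rfl, h2]
    exact Finset.sum_congr rfl fun y _ => by simp
  · intro z _ hz
    rw [← hB, h1, if_neg]
    exact fun h => hz (Fin.ext (code_injective (shift_injective o h))).symm
  · simp

/-- A gap of `X` wires before wire `D`. -/
def gap (D X i : ℕ) : ℕ := if i < D then i else i + X

theorem gap_injective (D X : ℕ) : Function.Injective (gap D X) := by
  intro i j h
  simp only [gap] at h
  split_ifs at h <;> omega

theorem gap_notMem_shift {D X : ℕ} {R : Finset ℕ} (hR : ∀ i ∈ R, i < X) (i : ℕ) :
    gap D X i ∉ shift D R := by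
  intro h
  obtain ⟨j, hj, e⟩ := Finset.mem_image.mp h
  have := hR j hj
  simp only [gap] at e
  split_ifs at e <;> omega

theorem wire_eq_add (w : ℕ) (ρ : Reg) (b : ℕ) : wire w ρ b = b + wire w ρ 0 := by
  simp [wire, add_comm]

theorem ket_update {w a : ℕ} (ha : a < 2 ^ w) {σ : WState w} {ρ : Reg} (hσ : σ ρ = 0)
    {R : Finset ℕ} (hR : (R : Set ℕ) = wireSet σ) :
    ket (Function.update σ ρ (a : ZMod (2 ^ w))) =
      Finsupp.single (R ∪ shift (wire w ρ 0) (code a)) 1 := by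
  apply ket_eq_single
  have hbit : ∀ b, wbit (a : ZMod (2 ^ w)) b = a.testBit b := by
    intro b; rw [wbit, ZMod.val_natCast_of_lt ha]
  rw [Finset.coe_union, hR]
  ext i
  constructor
  · rintro (⟨ρ', b, hb, h1, rfl⟩ | hi)
    · rw [wire_mem_wireSet _ _ hb]
      have hρ : ρ' ≠ ρ := by rintro rfl; rw [hσ, wbit_zero] at h1; simp at h1
      simpa [hρ] using h1
    · obtain ⟨b, hb, rfl⟩ := Finset.mem_image.mp (Finset.mem_coe.mp hi)
      rw [← wire_eq_add, wire_mem_wireSet _ _ (lt_of_mem_code ha hb), Function.update_self, hbit]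
      exact mem_code.mp hb
  · rintro ⟨ρ', b, hb, h1, rfl⟩
    by_cases hρ : ρ' = ρ
    · subst hρ
      rw [Function.update_self, hbit] at h1
      exact .inr (Finset.mem_coe.mpr (Finset.mem_image.mpr
        ⟨b, mem_code.mpr h1, (wire_eq_add _ _ _).symm⟩))
    · rw [Function.update_of_ne hρ] at h1
      exact .inl ((wire_mem_wireSet _ _ hb).mpr h1)

/-- A state with a gap before wire `D` that is filled with `R`. -/
noncomputable def embed (D X : ℕ) (R : Finset ℕ) (φ : QState) : QState :=
  Finsupp.mapDomain (fun S => S.image (gap D X) ∪ shift D R) φ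

section

variable {l p D X : ℕ} {R : Finset ℕ}

theorem embed_sum_smul {ι : Type*} (s : Finset ι) (c : ι → ℂ) (φ : ι → QState) :
    embed D X R (∑ a ∈ s, c a • φ a) = ∑ a ∈ s, c a • embed D X R (φ a) := by
  rw [embed, Finsupp.mapDomain_finsetSum]
  exact Finset.sum_congr rfl fun a _ => Finsupp.mapDomain_smul _ _

/-- The gates of a described circuit, with a gap. -/
noncomputable def gapGates (D X : ℕ) (C : List DGate) : List Gate :=
  (C.map DGate.toGate).map (Gate.rename (gap D X))

theorem runGates_gapGates (hR : ∀ i ∈ R, i < X) (C : List DGate) (φ : QState) :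
    runGates (gapGates D X C) (embed D X R φ) = embed D X R (runD C φ) := by
  rw [gapGates, embed, runGates_rename (gap_injective D X) _ _ fun g _ i _ =>
    gap_notMem_shift hR i, runD_eq_runGates]
  rfl

theorem embed_code {N : ℕ} (y : Fin N) :
    embed (Nat.clog 2 N) X R (Finsupp.single (code y) 1) = Finsupp.single (jointKet y R) 1 := by
  rw [embed, Finsupp.mapDomain_single, jointKet]
  congr 2
  conv_rhs => rw [← Finset.image_id (s := code y)]
  refine Finset.image_congr fun i hi => ?_
  rw [gap, if_pos (lt_clog_of_mem_code hi)]; rfl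

/-- The oracle acts directly on a letter register, shifted by the gap; unlike the explicit circuit
it can be placed on any wires, so letters need not be moved. -/
theorem oracleMap_embed (hR : ∀ i ∈ R, i < X) {w : ℕ} {ρ : Reg} (hD : D ≤ wire w ρ 0)
    (hp : p ≤ 2 ^ w) (U : Matrix (Fin p) (Fin p) ℂ) {σ : WState w} (hσ : σ ρ = 0) (x : Fin p) :
    oracleMap U (wire w ρ 0 + X)
        (embed D X R (ket (Function.update σ ρ ((x : ℕ) : ZMod (2 ^ w))))) =
      ∑ a, U a x • embed D X R (ket (Function.update σ ρ ((a : ℕ) : ZMod (2 ^ w)))) := by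
  rcases ket_cases σ with ⟨S, hS, -⟩ | ⟨hinf, -⟩
  · set o := wire w ρ 0
    have h1 : ∀ a : Fin p, embed D X R (ket (Function.update σ ρ ((a : ℕ) : ZMod (2 ^ w)))) =
        Finsupp.single ((S.image (gap D X) ∪ shift D R) ∪ shift (o + X) (code a)) 1 := by
      intro a
      have h2 : (shift o (code a)).image (gap D X) = shift (o + X) (code a) := by
        rw [shift, shift, Finset.image_image]
        refine Finset.image_congr fun i _ => ?_
        simp only [Function.comp, gap]
        rw [if_neg (by omega)]
        omega
      rw [ket_update (a.2.trans_le hp) hσ hS, embed, Finsupp.mapDomain_single, Finset.image_union,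
        Finset.union_right_comm, h2]
    rw [h1, oracleMap_single]
    · exact Finset.sum_congr rfl fun a _ => by rw [h1]
    · have hpw : Nat.clog 2 p ≤ w := Nat.clog_le_of_le_pow hp
      rw [Finset.disjoint_left]
      intro i hi hi'
      obtain ⟨b, hb, rfl⟩ := Finset.mem_image.mp hi'
      rw [Finset.mem_range] at hb
      rcases Finset.mem_union.mp hi with h | h
      · obtain ⟨j, hj, e⟩ := Finset.mem_image.mp h
        have h2 : j ∈ wireSet σ := by rw [← hS]; exact hj
        have h3 : j = wire w ρ b := by
          refine gap_injective D X (e.trans ?_)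
          rw [wire_eq_add, gap, if_neg (by omega)]; omega
        rw [h3, wire_mem_wireSet _ _ (by omega), hσ, wbit_zero] at h2
        simp at h2
      · obtain ⟨j, hj, e⟩ := Finset.mem_image.mp h
        have := hR j hj
        omega
  · have h0 : ∀ z : ZMod (2 ^ w), ket (Function.update σ ρ z) = 0 := by
      intro z
      rcases ket_cases (Function.update σ ρ z) with ⟨S, hS, -⟩ | ⟨-, h⟩
      · refine absurd ((S.finite_toSet.union (((Finset.range w).image (wire w ρ)).finite_toSet)).subset ?_) hinf
        rintro i ⟨ρ', b, hb, h1, rfl⟩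
        by_cases hρ : ρ' = ρ
        · subst hρ
          exact .inr (Finset.mem_coe.mpr (Finset.mem_image.mpr ⟨b, by simpa using hb, rfl⟩))
        · left
          rw [hS, wire_mem_wireSet _ _ hb, Function.update_of_ne hρ]
          exact h1
      · exact h
    simp [h0, embed]

/-- A bound for the private wires that an adversary uses before the reply. -/
def EncAdversary.width {N : ℕ} (A : EncAdversary N) : ℕ :=
  (A.state.support.biUnion fun mR => mR.2).sup id + 1

theorem EncAdversary.lt_width {N : ℕ} (A : EncAdversary N) {mR : Fin N × Finset ℕ}
    (h : mR ∈ A.state.support) {i : ℕ} (hi : i ∈ mR.2) : i < A.width :=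
  Nat.lt_succ_of_le (Finset.le_sup (f := id) (Finset.mem_biUnion.mpr ⟨mR, h, hi⟩))

/-- The distinguisher that encrypts the message of `A` with its oracle and then runs `A`. -/
noncomputable def simulate (w l K r : ℕ) {N : ℕ} (A : EncAdversary N) : Distinguisher where
  circuit :=
    (gapGates (Nat.clog 2 N) A.width (schurCircuit w l K r)).map OGate.gate ++
    ((List.range l).map (fun j => OGate.query (wire w (rX j) 0 + A.width)) ++
    ((gapGates (Nat.clog 2 N) A.width (dinv (schurCircuit w l K r))).map OGate.gate ++
    A.circuit.map OGate.gate))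
  advice := A.state.mapDomain fun mR => jointKet mR.1 mR.2
  advice_unit := by rw [sum_mapDomain_norm_sq jointKet_injective, A.state_unit]

/-- The workspace of the Schur circuit is shifted past the private wires that are occupied when the
message is sent. It returns to `|0⟩` before the adversary continues, so the adversary may use those
wires as fresh ones. -/
theorem prob_simulate {w K r : ℕ} (hl : 0 < l) (hr : K + r = w) (hw : K * l + 1 < w)
    (hK : p + l ≤ 2 ^ K) (A : EncAdversary (symDim l p)) (U : Matrix (Fin p) (Fin p) ℂ) :
    (simulate w l K r A).prob U = guess0 (expand l U) A := by
  set D := Nat.clog 2 (symDim l p) with hD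
  set X := A.width with hX
  set C := schurCircuit w l K r with hC
  have hDw : D ≤ w := (Nat.clog_le_of_le_pow (symDim_le_two_pow hl hK)).trans (by omega)
  have hpw : p ≤ 2 ^ w := by
    have := Nat.pow_le_pow_right (n := 2) (by norm_num) (show K ≤ w by omega)
    omega
  have key : ∀ (m : Fin (symDim l p)) (R : Finset ℕ), (∀ i ∈ R, i < X) →
      runGates (gapGates D X (dinv C))
        (runOracle U ((List.range l).map fun j => OGate.query (wire w (rX j) 0 + X))
          (runGates (gapGates D X C) (Finsupp.single (jointKet m R) 1))) =
        ∑ y, expand l U y m • Finsupp.single (jointKet y R) 1 := by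
    intro m R hR
    set e : (Fin l → Fin p) → QState := fun x =>
      embed D X R (ket (symState w (letters x) 0)) with he
    have hE : ∀ y : Fin (symDim l p), embed D X R (runD C (Finsupp.single (code y) 1)) =
        ∑ x, symSchurInv l p x y • e x := by
      intro y
      rw [runD_schurCircuit hl hr hw hK, embed_sum_smul]
    have h1 := apply_letters U e (fun j => oracleMap U (wire w (rX j) 0 + X))
      (fun j => runOracle U ((List.range j).map fun j => OGate.query (wire w (rX j) 0 + X))
        (∑ x, symSchurInv l p x m • e x))
      (fun j hj x => by
        obtain ⟨σ, hσ, h2⟩ : ∃ σ : WState w, σ (rX j) = 0 ∧ ∀ a : Fin p,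
            symState w (letters (Function.update x ⟨j, hj⟩ a)) 0 =
              Function.update σ (rX j) ((a : ℕ) : ZMod (2 ^ w)) :=
          ⟨Function.update (symState w (letters x) 0) (rX j) 0, Function.update_self ..,
            fun a => by rw [symState_update, Function.update_idem]⟩
        have h3 := h2 (x ⟨j, hj⟩)
        rw [Function.update_eq_self] at h3
        simp only [he, h2]
        rw [h3]
        refine oracleMap_embed hR ?_ hpw U hσ _
        -- Letter registers have positive address and the message register fits into `w` wires, so
        -- the queries lie entirely behind the gap.
        refine hDw.trans ?_
        have : 1 ≤ addr (rX j) := by simp [addr, rX]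
        simp only [wire]; nlinarith)
      (v := fun x => symSchurInv l p x m) rfl (fun j _ => by
        simp only [List.range_succ, List.map_append, runOracle_append, LinearMap.comp_apply]; rfl)
    rw [sum_tensorPower_symSchurInv hl] at h1
    simp only [← hE] at h1
    rw [← embed_code (X := X), runGates_gapGates hR, h1, map_sum]
    refine Finset.sum_congr rfl fun y _ => ?_
    rw [map_smul, runGates_gapGates hR, ← LinearMap.comp_apply (runD (dinv C)), runD_dinv_comp,
      LinearMap.id_apply, embed_code]
  rw [Distinguisher.prob, guess0]
  congr 1
  simp only [simulate, runOracle_append, runOracle_map_gate, LinearMap.comp_apply]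
  congr 1
  rw [Finsupp.mapDomain, Finsupp.sum, map_sum, map_sum, map_sum, reply0, Finsupp.sum]
  refine Finset.sum_congr rfl fun mR hmR => ?_
  have h4 : (Finsupp.single (jointKet mR.1 mR.2) (A.state mR) : QState) =
    A.state mR • Finsupp.single (jointKet mR.1 mR.2) 1 := by simp
  rw [h4, map_smul, map_smul, map_smul, key _ _ fun i hi => A.lt_width hmR hi, Finset.smul_sum]
  exact Finset.sum_congr rfl fun y _ => by simp

theorem sum_size_gapGates_le (D X : ℕ) (C : List DGate) :
    ((gapGates D X C).map Gate.size).sum ≤ (encGates C).length := by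
  induction C with
  | nil => simp [gapGates]
  | cons g C ih =>
    rw [length_encGates_cons]
    simp only [gapGates, List.map_cons, List.sum_cons] at ih ⊢
    have h1 := Gate.size_rename_le (gap D X) g.toGate
    have h2 : g.toGate.size ≤ g.controls.length + 1 :=
      Nat.succ_le_succ (List.toFinset_card_le _)
    have h3 := (lt_length_encDGate g).2.2
    omega

theorem size_simulate_le (w l K r : ℕ) {N : ℕ} (A : EncAdversary N) :
    (simulate w l K r A).size ≤ ((encGates (schurCircuit w l K r)).length +
      (encGates (dinv (schurCircuit w l K r))).length) + l + A.size := by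
  have h1 : ∀ L : List Gate, ((L.map OGate.gate).map OGate.size).sum = (L.map Gate.size).sum := by
    intro L; rw [List.map_map]; rfl
  have h2 := sum_size_gapGates_le (Nat.clog 2 N) A.width (schurCircuit w l K r)
  have h3 := sum_size_gapGates_le (Nat.clog 2 N) A.width (dinv (schurCircuit w l K r))
  have h4 : (((List.range l).map fun j => OGate.query (wire w (rX j) 0 + A.width)).map
      OGate.size).sum = l := by
    rw [List.map_map, show OGate.size ∘ (fun j => OGate.query (wire w (rX j) 0 + A.width)) =
      fun _ => 1 from rfl]
    simp
  simp only [Distinguisher.size, simulate, List.map_append, List.sum_append, h1, h4,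
    EncAdversary.size]
  omega

end

end QExpand
namespace QExpand

/-! ## Uniform bounds -/

theorem exists_eval_le_pow (q : Polynomial ℕ) : ∃ j : ℕ, ∀ n, q.eval n ≤ (n + 2) ^ j := by
  induction q using Polynomial.induction_on' with
  | add p q hp hq =>
    obtain ⟨i, hi⟩ := hp
    obtain ⟨j, hj⟩ := hq
    refine ⟨max i j + 1, fun n => ?_⟩
    have h1 : (n + 2) ^ i ≤ (n + 2) ^ max i j := Nat.pow_le_pow_right (by omega) (le_max_left _ _)
    have h2 : (n + 2) ^ j ≤ (n + 2) ^ max i j := Nat.pow_le_pow_right (by omega) (le_max_right _ _)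
    have := hi n
    have := hj n
    rw [Polynomial.eval_add, pow_succ]
    nlinarith
  | monomial k a =>
    refine ⟨a + k, fun n => ?_⟩
    rw [Polynomial.eval_monomial, pow_add]
    have h1 : a ≤ (n + 2) ^ a := Nat.lt_two_pow_self.le.trans (Nat.pow_le_pow_left (by omega) _)
    gcongr
    omega

/-- If every polynomial-size family has negligible advantage, then the advantages have a common
negligible bound. -/
theorem exists_negligible_bound {α : ℕ → Type*} (size : ∀ n, α n → ℕ) (adv : ∀ n, α n → ℝ)
    (h0 : ∀ n, ∃ A : α n, size n A ≤ 1)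
    (h : ∀ A : ∀ n, α n, (∃ q : Polynomial ℕ, ∀ n, size n (A n) ≤ q.eval n) →
      ∃ f, Negligible f ∧ ∀ n, adv n (A n) ≤ f n) :
    ∃ μ, Negligible μ ∧ ∀ A : ∀ n, α n, (∃ q : Polynomial ℕ, ∀ n, size n (A n) ≤ q.eval n) →
      ∀ᶠ n in atTop, adv n (A n) ≤ μ n := by
  have key : ∀ j : ℕ, ∃ m : ℕ, ∀ n ≥ m, ∀ A : α n, size n A ≤ (n + 2) ^ j →
      (n : ℝ) ^ j * adv n A ≤ 1 := by
    intro j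
    -- For each `n` a violator within the size bound is chosen if there is one, and any small member
    -- otherwise. This is a polynomial-size family, so violations stop from some `n` on, for all
    -- members within the bound at once.
    have h1 : ∀ n, ∃ A : α n, size n A ≤ (n + 2) ^ j ∧ ∀ B : α n, size n B ≤ (n + 2) ^ j →
        1 < (n : ℝ) ^ j * adv n B → 1 < (n : ℝ) ^ j * adv n A := by
      intro n
      by_cases hB : ∃ B : α n, size n B ≤ (n + 2) ^ j ∧ 1 < (n : ℝ) ^ j * adv n B
      · obtain ⟨B, hB, hB'⟩ := hB
        exact ⟨B, hB, fun _ _ _ => hB'⟩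
      · obtain ⟨A, hA⟩ := h0 n
        exact ⟨A, hA.trans (Nat.one_le_pow _ _ (by omega)), fun B h1 h2 => absurd ⟨B, h1, h2⟩ hB⟩
    choose A hA hA' using h1
    obtain ⟨f, hf, hAf⟩ := h A ⟨(.X + 2) ^ j, fun n => by simpa using hA n⟩
    obtain ⟨m, hm⟩ := eventually_atTop.mp ((hf j).eventually (ge_mem_nhds one_pos))
    refine ⟨m, fun n hn B hB => ?_⟩
    by_contra! hlt
    have h2 := hA' n B hB hlt
    have h3 : (n : ℝ) ^ j * adv n (A n) ≤ (n : ℝ) ^ j * f n :=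
      mul_le_mul_of_nonneg_left (hAf n) (by positivity)
    exact absurd (hm n hn) (not_le.mpr (h2.trans_le h3))
  choose m hm using key
  -- Diagonalization: `J n` is the largest exponent up to `n` whose threshold has been passed. It
  -- tends to infinity, so `n^(-J n)` is negligible and eventually overtakes each fixed exponent.
  set J : ℕ → ℕ := fun n => Nat.findGreatest (fun j => m j ≤ n) n with hJ
  have hJm : ∀ n ≥ m 0, m (J n) ≤ n := fun n hn =>
    Nat.findGreatest_spec (P := fun j => m j ≤ n) (Nat.zero_le n) hn
  have hJle : ∀ j n, j ≤ n → m j ≤ n → j ≤ J n := fun j n h1 h2 =>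
    Nat.le_findGreatest (P := fun j => m j ≤ n) h1 h2
  refine ⟨fun n => ((n : ℝ) ^ J n)⁻¹, fun c => ?_, fun A ⟨q, hq⟩ => ?_⟩
  · refine squeeze_zero' (Eventually.of_forall fun n => by positivity) ?_
      (tendsto_inv_atTop_nhds_zero_nat (𝕜 := ℝ))
    filter_upwards [eventually_ge_atTop (max (max (c + 1) (m (c + 1))) 1)] with n hn
    have h1 : c + 1 ≤ J n := hJle _ _ (by omega) (by omega)
    have hn1 : (1 : ℝ) ≤ n := by exact_mod_cast (show 1 ≤ n by omega)
    have hn0 : (0 : ℝ) < n := by linarith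
    rw [← div_eq_mul_inv, div_le_iff₀ (by positivity), inv_mul_eq_div, le_div_iff₀ hn0, ← pow_succ]
    exact pow_le_pow_right₀ hn1 h1
  · obtain ⟨j, hj⟩ := exists_eval_le_pow q
    filter_upwards [eventually_ge_atTop (max (max j (m j)) (max (m 0) 1))] with n hn
    have h1 : j ≤ J n := hJle _ _ (by omega) (by omega)
    have hn0 : (0 : ℝ) < n := by exact_mod_cast (show 0 < n by omega)
    have h2 := hm (J n) n (hJm n (by omega)) (A n)
      ((hq n).trans ((hj n).trans (Nat.pow_le_pow_right (by omega) h1)))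
    rwa [inv_eq_one_div, le_div_iff₀ (by positivity), mul_comm]

/-! ## Security -/

section

variable {d p l : ℕ → ℕ} {U : ∀ n, (Fin (d n) → Bool) → Matrix (Fin (p n)) (Fin (p n)) ℂ}

/-- The average over the keys is close to the average over the Haar measure. -/
theorem IsPRU.guess0_negligible (hU : IsPRU d p U) (hl : PolyTimeUnary l) (hl_pos : ∀ n, 0 < l n)
    (A : ∀ n, EncAdversary (symDim (l n) (p n)))
    (hA : ∃ q : Polynomial ℕ, ∀ n, (A n).size ≤ q.eval n) :
    Negligible fun n => |keyAvg (fun k => guess0 (expand (l n) (U n k)) (A n)) -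
      ∫ V : Matrix.unitaryGroup (Fin (p n)) ℂ,
        guess0 (expand (l n) (V : Matrix (Fin (p n)) (Fin (p n)) ℂ)) (A n)
          ∂(haarUnitary (p n))| := by
  obtain ⟨Q, hQ⟩ := hU.efficient.dim_le
  obtain ⟨q, hq⟩ := hA
  obtain ⟨ql, hql⟩ := hl.le
  obtain ⟨qC, hqC⟩ := length_schurCircuit_le hl Q 0
  have h1 := hU.pseudorandom (fun n => simulate (regBits Q 0 n (l n)) (l n) (letterBits Q n (l n))
    (spareBits Q 0 n (l n)) (A n)) ⟨qC + ql + q, fun n => by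
      refine (size_simulate_le _ _ _ _ _).trans ?_
      rw [Polynomial.eval_add, Polynomial.eval_add]
      have := hqC n; have := hql n; have := hq n
      omega⟩
  have h2 : ∀ n (V : Matrix (Fin (p n)) (Fin (p n)) ℂ),
      (simulate (regBits Q 0 n (l n)) (l n) (letterBits Q n (l n)) (spareBits Q 0 n (l n))
        (A n)).prob V = guess0 (expand (l n) V) (A n) := fun n V =>
    prob_simulate (hl_pos n) rfl (by simp only [spareBits]; omega)
      (add_le_two_pow_letterBits (hQ n)) (A n) V
  simpa only [h2] using h1

/-- The success probability exceeds `1/2` by half the difference of the averages of `guess1` and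
`guess0`. Both averages are compared with the common Haar value: `guess0` directly, `guess1` through
`keepMessage`. -/
theorem IsPRU.isOneTimeSecure_expand (hU : IsPRU d p U) (hl : PolyTimeUnary l)
    (hl_pos : ∀ n, 0 < l n) :
    IsOneTimeSecureQEnc d (fun n => symDim (l n) (p n)) fun n k => QExpand.expand (l n) (U n k) := by
  have heff := hU.efficient.expand hl hl_pos
  have hN : ∀ n, 0 < symDim (l n) (p n) := heff.dim_pos
  refine ⟨heff, ?_⟩
  obtain ⟨μ, hμ, h⟩ := exists_negligible_bound (α := fun n => EncAdversary (symDim (l n) (p n)))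
    (fun n A => A.size)
    (fun n A => (keyAvg (fun k => guess1 (QExpand.expand (l n) (U n k)) A) -
      keyAvg (fun k => guess0 (QExpand.expand (l n) (U n k)) A)) / 2)
    (fun n => ⟨⟨Finsupp.single (⟨0, hN n⟩, ∅) 1, by simp, []⟩, by simp [EncAdversary.size]⟩)
    (fun A hA => by
      have h0 := hU.guess0_negligible hl hl_pos A hA
      have h1 := hU.guess0_negligible hl hl_pos (fun n => keepMessage (hN n) (A n)) (by
        obtain ⟨q, hq⟩ := hA
        exact ⟨q, fun n => (size_keepMessage_le (hN n) (A n)).trans (hq n)⟩)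
      refine ⟨_, h0.add h1, fun n => ?_⟩
      simp only [guess0_keepMessage, Pi.add_apply,
        ← integral_guess_eq (hl_pos n) (hU.efficient.dim_pos n)]
      set a := keyAvg fun k => guess0 (QExpand.expand (l n) (U n k)) (A n)
      set b := keyAvg fun k => guess1 (QExpand.expand (l n) (U n k)) (A n)
      set c := ∫ V : Matrix.unitaryGroup (Fin (p n)) ℂ,
        guess0 (QExpand.expand (l n) (V : Matrix (Fin (p n)) (Fin (p n)) ℂ)) (A n)
          ∂(haarUnitary (p n))
      have h2 := neg_le_abs (a - c)
      have h3 := le_abs_self (b - c)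
      have h4 := abs_nonneg (a - c)
      have h5 := abs_nonneg (b - c)
      linarith)
  refine ⟨μ, hμ, fun A hA => (h A hA).mono fun n hn => ?_⟩
  rw [winProb]
  linarith

end

end QExpand
theorem theoremC1 (d p l : ℕ → ℕ)
    (U : ∀ n, (Fin (d n) → Bool) → Matrix (Fin (p n)) (Fin (p n)) ℂ)
    (hU : QExpand.IsPRU d p U)
    (hl : QExpand.PolyTimeUnary l) (hl_pos : ∀ n, 0 < l n) :
    QExpand.IsOneTimeSecureQEnc d (fun n => (l n + p n - 1).choose (l n))
        (fun n k => QExpand.expand (l n) (U n k)) ∧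
      ∀ n, (1 + ((p n : ℝ) - 1) / (l n : ℝ)) ^ (l n) ≤ (((l n + p n - 1).choose (l n) : ℕ) : ℝ) :=
  ⟨hU.isOneTimeSecure_expand hl hl_pos,
    fun n => QExpand.pow_le_symDim (hl_pos n) (hU.efficient.dim_pos n)⟩
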